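/- Conventions. A quantum-secure one-way function is a function $f:\{0,1\}^*\to\{0,1\}^*$ that is computable in deterministic polynomial time and such that for every polynomial-time quantum algorithm $\mathcal A$ the probability $$\Pr_{x\leftarrow\{0,1\}^n}\big[f(\mathcal A(1^n,f(x)))=f(x)\big],$$ taken over uniform $x\in\{0,1\}^n$ and the randomness of $\mathcal A$, is negligible in $n$ (smaller than every inverse polynomial). TQBF is the set of true closed prenex quantified Boolean formulas $Q_1x_1\cdots Q_nx_n\,\psi(x_1,\dots,x_n)$, $Q_i\in\{\forall,\exists\}$, with $\psi$ in conjunctive normal form. A purported TQBF oracle $\mathcal O$ answers each query $w\in\{0,1\}^*$ with a random bit, whose distribution depends only on $w$ and which is independent of all other answers. It is implemented by polynomial-size quantum circuits if there is a uniform family $(C_m)_{m\ge 0}$ of quantum circuits (a deterministic polynomial-time algorithm writes down $C_m$ on input $1^m$) such that the answer to a query $w$ of length $m$ is the outcome of measuring the output qubit after $C_m$ is applied to $|w\rangle$ and ancillas $|0\cdots0\rangle$. Theorem. Assume that quantum-secure one-way functions exist. Then there is a polynomial-time classical probabilistic algorithm $\mathcal V$ (the verifier) which, given the system size $n$ (as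 $1^n$) and black-box access to a purported TQBF oracle $\mathcal O$, runs in time polynomial in $n$ for every $\mathcal O$, outputs $\mathsf{True}$ or $\mathsf{Pseudo}$, and satisfies: 1. If on every TQBF instance $\mathcal O$ gives the correct answer with probability at least $2/3$, then for every $n$ the verifier $\mathcal V^{\mathcal O}(1^n)$ outputs $\mathsf{True}$ with probability at least $2/3$. 2. If $\mathcal O$ is implemented by polynomial-size quantum circuits, then for all sufficiently large $n$ (depending on $\mathcal O$) the verifier $\mathcal V^{\mathcal O}(1^n)$ outputs $\mathsf{Pseudo}$ with probability at least $2/3$. -/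

import Mathlib

open scoped ENNReal NNReal

noncomputable section

namespace TQBFVerification

/-! ### Quantum states, gates and circuits

Qubits are numbered by `ℕ`. The basis vector `|s⟩`, for a finite set `s` of qubits, is the one in
which the qubits of `s` are `1` and all others are `0`. A circuit touches only finitely many qubits;
those that do not carry input are ancillas in the state `0`. -/

/-- State vectors. All gates are unitary. After a measurement a state is projected but not rescaled;
`qubitProb` divides by the squared norm. -/
abbrev QState := Finset ℕ →₀ ℂ

/-- The basis vector `|s⟩`. -/
def ket (s : Finset ℕ) : QState := Finsupp.single s 1

/-- The universal gate set `H`, `T`, `CNOT`, where `α` is the type of qubit names. -/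
inductive Gate (α : Type) : Type
  | H (q : α)
  | T (q : α)
  | CNOT (control target : α)

/-- Rename the qubits of a gate. -/
def Gate.map {α β : Type} (g : α → β) : Gate α → Gate β
  | .H q => .H (g q)
  | .T q => .T (g q)
  | .CNOT c t => .CNOT (g c) (g t)

/-- The image of a basis vector under a gate:
`H|0⟩ = (|0⟩ + |1⟩)/√2`, `H|1⟩ = (|0⟩ - |1⟩)/√2`; `T|0⟩ = |0⟩`, `T|1⟩ = exp(iπ/4)|1⟩`;
`CNOT` flips the target when the control is `1` (and is the identity if the two coincide). -/
def Gate.applyKet : Gate ℕ → Finset ℕ → QState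
  | .H q, s => ((1 / Real.sqrt 2 : ℝ) : ℂ) •
      (ket (s.erase q) + (if q ∈ s then (-1 : ℂ) else 1) • ket (insert q s))
  | .T q, s => (if q ∈ s then Complex.exp (Complex.I * (Real.pi / 4)) else 1) • ket s
  | .CNOT c t, s => ket (if c ∈ s ∧ c ≠ t then symmDiff s {t} else s)

/-- The linear action of a gate on state vectors. -/
def Gate.apply (g : Gate ℕ) : QState →ₗ[ℂ] QState := Finsupp.linearCombination ℂ g.applyKet

/-- A quantum circuit: its gates in the order in which they are applied. -/
abbrev Circuit := List (Gate ℕ)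

def Circuit.apply (C : Circuit) (ψ : QState) : QState := C.foldl (fun φ g => g.apply φ) ψ

/-- The (unnormalised) state after qubit `q` was measured with outcome `b`. -/
def project (q : ℕ) (b : Bool) (ψ : QState) : QState := ψ.filter fun s => decide (q ∈ s) = b

/-- The squared norm. -/
def normSq (ψ : QState) : ℝ≥0 := ∑ s ∈ ψ.support, ‖ψ s‖₊ ^ 2

/-- The probability that a measurement of qubit `q` gives `1`. -/
def qubitProb (q : ℕ) (ψ : QState) : ℝ≥0 := normSq (project q true ψ) / normSq ψ

theorem qubitProb_le_one (q : ℕ) (ψ : QState) : qubitProb q ψ ≤ 1 := by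
  refine div_le_one_of_le₀ ?_ (zero_le)
  unfold normSq project
  rw [Finsupp.support_filter]
  refine (Finset.sum_le_sum fun s hs => ?_).trans
    (Finset.sum_le_sum_of_subset (Finset.filter_subset (fun s => decide (q ∈ s) = true) _))
  rw [Finsupp.filter_apply_pos (fun s => decide (q ∈ s) = true) ψ (Finset.mem_filter.1 hs).2]

/-- The outcome of measuring qubit `q`. -/
def measureQubit (q : ℕ) (ψ : QState) : PMF Bool :=
  PMF.ofFintype (fun b => if b then (qubitProb q ψ : ℝ≥0∞) else 1 - (qubitProb q ψ : ℝ≥0∞)) (by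
    have h : (qubitProb q ψ : ℝ≥0∞) ≤ 1 := by exact_mod_cast qubitProb_le_one q ψ
    simpa using add_tsub_cancel_of_le h)

/-! ### A machine model with a step count

Machines have finitely many stacks of bits (those registers, out of countably many, that their
program mentions), like multi-tape Turing machines, and a structured program as finite control. One
step touches only the tops of stacks. A machine may also toss coins, query an oracle, and own a
register of qubits, to which it applies gates and measurements one at a time. -/

/-- Programs; `i`, `j` are names of registers. -/
inductive Cmd : Type
  /-- Push the bit `b` on register `i`. -/
  | push (i : ℕ) (b : Bool)
  /-- Remove the top bit of register `i`, if there is one. -/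
  | pop (i : ℕ)
  /-- Do the first command, then the second. -/
  | seq (c d : Cmd)
  /-- Do `c₁`, `c₀` or `e` according as the top of register `i` is `1`, is `0`, or is absent. -/
  | branch (i : ℕ) (c₁ c₀ e : Cmd)
  /-- Repeat `c` as long as register `i` is not empty. -/
  | loop (i : ℕ) (c : Cmd)
  /-- Push a fair random bit on register `i`. -/
  | toss (i : ℕ)
  /-- Query the oracle on the content of register `i` and push the answer on register `j`. -/
  | query (i j : ℕ)
  /-- Apply a gate; the qubit named by a register is the one whose number is the register's length. -/
  | gate (g : Gate ℕ)
  /-- Measure the qubit whose number is the length of register `i`; push the outcome on `j`. -/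
  | meas (i j : ℕ)

/-- No quantum instructions: the program of a classical, probabilistic oracle machine. -/
def Cmd.IsClassical : Cmd → Prop
  | .push _ _ | .pop _ | .toss _ | .query _ _ => True
  | .seq c d => c.IsClassical ∧ d.IsClassical
  | .branch _ c d e => c.IsClassical ∧ d.IsClassical ∧ e.IsClassical
  | .loop _ c => c.IsClassical
  | .gate _ | .meas _ _ => False

/-- No oracle queries. -/
def Cmd.IsOracleFree : Cmd → Prop
  | .push _ _ | .pop _ | .toss _ | .gate _ | .meas _ _ => True
  | .seq c d => c.IsOracleFree ∧ d.IsOracleFree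
  | .branch _ c d e => c.IsOracleFree ∧ d.IsOracleFree ∧ e.IsOracleFree
  | .loop _ c => c.IsOracleFree
  | .query _ _ => False

/-- No coins, no queries and no quantum instructions. -/
def Cmd.IsDeterministic : Cmd → Prop
  | .push _ _ | .pop _ => True
  | .seq c d => c.IsDeterministic ∧ d.IsDeterministic
  | .branch _ c d e => c.IsDeterministic ∧ d.IsDeterministic ∧ e.IsDeterministic
  | .loop _ c => c.IsDeterministic
  | .toss _ | .query _ _ | .gate _ | .meas _ _ => False

/-- A probabilistic oracle for yes/no questions. Each query is answered with fresh randomness,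
independently of all other queries. -/
abbrev Oracle := List Bool → PMF Bool

/-- For machines that make no queries. -/
def noOracle : Oracle := fun _ => PMF.pure false

/-- A configuration: the commands still to be done, the registers (the head of a list is the top of
the stack), and the state of the qubits. -/
structure Config where
  todo : List Cmd
  reg : ℕ → List Bool
  qubits : QState

/-- One step of computation. A configuration with nothing left to do is halted. -/
def step (O : Oracle) : Config → PMF Config
  | ⟨[], r, ψ⟩ => PMF.pure ⟨[], r, ψ⟩
  | ⟨.push i b :: k, r, ψ⟩ => PMF.pure ⟨k, Function.update r i (b :: r i), ψ⟩
  | ⟨.pop i :: k, r, ψ⟩ => PMF.pure ⟨k, Function.update r i (r i).tail, ψ⟩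
  | ⟨.seq c d :: k, r, ψ⟩ => PMF.pure ⟨c :: d :: k, r, ψ⟩
  | ⟨.branch i c₁ c₀ e :: k, r, ψ⟩ =>
      match r i with
      | true :: _ => PMF.pure ⟨c₁ :: k, r, ψ⟩
      | false :: _ => PMF.pure ⟨c₀ :: k, r, ψ⟩
      | [] => PMF.pure ⟨e :: k, r, ψ⟩
  | ⟨.loop i c :: k, r, ψ⟩ =>
      match r i with
      | [] => PMF.pure ⟨k, r, ψ⟩
      | _ :: _ => PMF.pure ⟨c :: .loop i c :: k, r, ψ⟩
  | ⟨.toss i :: k, r, ψ⟩ =>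
      (PMF.uniformOfFintype Bool).map fun b => ⟨k, Function.update r i (b :: r i), ψ⟩
  | ⟨.query i j :: k, r, ψ⟩ =>
      (O (r i)).map fun b => ⟨k, Function.update r j (b :: r j), ψ⟩
  | ⟨.gate g :: k, r, ψ⟩ =>
      PMF.pure ⟨k, r, (g.map fun i => (r i).length).apply ψ⟩
  | ⟨.meas i j :: k, r, ψ⟩ =>
      (measureQubit (r i).length ψ).map fun b =>
        ⟨k, Function.update r j (b :: r j), project (r i).length b ψ⟩

/-- The random configuration reached after `t` steps. -/
def run (O : Oracle) : ℕ → Config → PMF Config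
  | 0, C => PMF.pure C
  | t + 1, C => (step O C).bind (run O t)

/-- The initial configuration of `c`: the inputs stand in the registers `0`, `1`, …, all other
registers are empty and all qubits are `0`. -/
def start (c : Cmd) (inputs : List (List Bool)) : Config :=
  ⟨[c], fun i => inputs.getD i [], ket ∅⟩

/-- With certainty, `c` halts within `t` steps. -/
def HaltsWithin (O : Oracle) (c : Cmd) (inputs : List (List Bool)) (t : ℕ) : Prop :=
  ∀ C ∈ (run O t (start c inputs)).support, C.todo = []

/-- The content of register `0` after `t` steps (the output, if `c` halts within `t` steps). -/
def output (O : Oracle) (c : Cmd) (inputs : List (List Bool)) (t : ℕ) : PMF (List Bool) :=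
  (run O t (start c inputs)).map fun C => C.reg 0

/-- The string `1ⁿ`. -/
abbrev unary (n : ℕ) : List Bool := List.replicate n true

/-- `f` is computed by a deterministic machine in polynomial time. -/
def PolyTimeComputable (f : List Bool → List Bool) : Prop :=
  ∃ (c : Cmd) (p : Polynomial ℕ), c.IsDeterministic ∧ ∀ x,
    HaltsWithin noOracle c [x] (p.eval x.length) ∧
      output noOracle c [x] (p.eval x.length) = PMF.pure (f x)

/-! ### Quantum-secure one-way functions -/

/-- The probability, over uniform `x ∈ {0,1}ⁿ` and the randomness of `A`, that `A` on input
`(1ⁿ, f x)`, with time bound `p` in the length of its input, outputs a preimage of `f x`. -/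
def inversionProb (f : List Bool → List Bool) (A : Cmd) (p : Polynomial ℕ) (n : ℕ) : ℝ :=
  (∑ x : Fin n → Bool, ((output noOracle A [unary n, f (List.ofFn x)]
      (p.eval (n + (f (List.ofFn x)).length))).toOuterMeasure
        {x' | f x' = f (List.ofFn x)}).toReal) / 2 ^ n

/-- `f` is computable in polynomial time, and every polynomial-time quantum algorithm inverts it on
random inputs of length `n` with negligible probability only. -/
def IsQuantumSecureOWF (f : List Bool → List Bool) : Prop :=
  PolyTimeComputable f ∧
    ∀ (A : Cmd) (p : Polynomial ℕ), A.IsOracleFree →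
      (∀ (n : ℕ) (y : List Bool), HaltsWithin noOracle A [unary n, y] (p.eval (n + y.length))) →
      Asymptotics.SuperpolynomialDecay Filter.atTop (fun n : ℕ => (n : ℝ)) (inversionProb f A p)

/-! ### True quantified Boolean formulas -/

inductive Quantifier : Type
  | all
  | ex

/-- Formulas in conjunctive normal form: lists of clauses, which are lists of literals. The literal
`(i, true)` is the variable `i`, and `(i, false)` is its negation. -/
abbrev CNF (n : ℕ) := List (List (Fin n × Bool))

/-- `a` satisfies every clause. -/
def CNF.Holds {n : ℕ} (ψ : CNF n) (a : Fin n → Bool) : Prop :=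
  ∀ c ∈ ψ, ∃ l ∈ c, a l.1 = l.2

/-- Closed quantified Boolean formulas `Q₁x₁ ⋯ Qₙxₙ ψ(x₁, …, xₙ)`. -/
structure QBF where
  quants : List Quantifier
  matrix : CNF quants.length

/-- `Q₁x₁ ⋯ Qₙxₙ P(x₁, …, xₙ)`. -/
def quantify : (qs : List Quantifier) → ((Fin qs.length → Bool) → Prop) → Prop
  | [], P => P Fin.elim0
  | .all :: qs, P => ∀ b : Bool, quantify qs fun a => P (Fin.cons b a)
  | .ex :: qs, P => ∃ b : Bool, quantify qs fun a => P (Fin.cons b a)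

/-- Membership in TQBF. -/
def QBF.IsTrue (φ : QBF) : Prop := quantify φ.quants φ.matrix.Holds

/-- Self-delimiting code of a number. -/
def encodeNat (n : ℕ) : List Bool := unary n ++ [false]

/-- Self-delimiting code of a list: `1` before each item, `0` at the end. -/
def encodeList {α : Type} (enc : α → List Bool) (l : List α) : List Bool :=
  (l.flatMap fun a => true :: enc a) ++ [false]

def Quantifier.encode : Quantifier → List Bool
  | .all => [false]
  | .ex => [true]

/-- The code of a formula: its quantifiers, then its clauses. -/
def QBF.encode (φ : QBF) : List Bool :=
  encodeList Quantifier.encode φ.quants ++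
    encodeList (encodeList fun l => l.2 :: encodeNat l.1) φ.matrix

open Classical in
/-- On every instance the oracle gives the right answer with probability at least `2/3`. -/
def SolvesTQBF (O : Oracle) : Prop :=
  ∀ φ : QBF, (2 / 3 : ℝ≥0∞) ≤ O φ.encode (decide φ.IsTrue)

/-! ### Oracles implemented by quantum circuits -/

def Gate.encode : Gate ℕ → List Bool
  | .H q => false :: false :: encodeNat q
  | .T q => false :: true :: encodeNat q
  | .CNOT c t => true :: (encodeNat c ++ encodeNat t)

def Circuit.encode (C : Circuit) : List Bool := encodeList Gate.encode C

/-- A uniform family of polynomial-size circuits: a deterministic polynomial-time machine writes down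
the `n`-th circuit on input `1ⁿ`. -/
def IsUniformPolySize (C : ℕ → Circuit) : Prop :=
  ∃ g : List Bool → List Bool, PolyTimeComputable g ∧ ∀ n, g (unary n) = (C n).encode

/-- The basis state in which the first qubits carry the string `w` and all others are `0`. -/
def inputState (w : List Bool) : QState :=
  ket ((Finset.range w.length).filter fun i => w.getD i false = true)

/-- `O` is implemented by a uniform family of polynomial-size quantum circuits: on a query of length
`n`, the `n`-th circuit is run on the query and on ancillas `0`, and qubit `0` is measured. -/
def IsQuantumImplemented (O : Oracle) : Prop :=
  ∃ C : ℕ → Circuit, IsUniformPolySize C ∧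
    ∀ w, O w = measureQubit 0 ((C w.length).apply (inputState w))

/-! ### The verifier's answer -/

inductive Verdict : Type
  | True
  | Pseudo

/-- The verdict of a verifier that ends with `w` in its output register. -/
def verdictOf : List Bool → Verdict
  | true :: _ => .True
  | _ => .Pseudo

/-- The verdict of `V` with oracle `O` on input `1ⁿ`, run for `t` steps. -/
def verdict (O : Oracle) (V : Cmd) (n t : ℕ) : PMF Verdict :=
  (output O V [unary n] t).map verdictOf

end TQBFVerification

end

open TQBFVerification

open scoped ENNReal NNReal
open TQBFVerification

noncomputable section

namespace TQBFVerification

/-! ### Output distributions in continuation-passing style -/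

/-! The verifier turns the oracle into an inverter for the one-way function `f` and tests it. It
tosses a random `x` of length `n`, computes `y = f x`, and looks for a preimage of `y` of length `n`
bit by bit: if `u` is the prefix found so far, it asks whether some preimage has prefix `u ++
[true]`, takes the majority of `51 * n` answers and appends it to `u`. It says `True` exactly if the
final `u` satisfies `f u = y`. The question is an NP statement, hence expressible by a purely
existential formula in conjunctive normal form, through the tableau of the machine for `f`
(`exists_preimage_formula`).

If the oracle solves TQBF, every correctly decided bit keeps the prefix extendable, and a majority
is wrong with probability at most `(17/18) ^ (51 * n)`. A union bound over `n` bits gives failure at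
most `1/3` (`searchDist_failure`, `mul_pow_le_third`, `searchSuccess_false_le`).

If the oracle is implemented by quantum circuits, the same search can be run without an oracle by a
quantum machine which, at each query, writes down the circuit, applies it, measures the answer and
resets the qubits (`exists_simulates`, `exists_inverter`). This machine is a polynomial-time
inverter whose output has exactly the distribution of the verifier's search, so the probability of
the verdict `True` equals its inversion probability (`inversionProb_eq`). That is negligible, hence
eventually below `1/3`. The verifier depends only on `f`; the inverter and the threshold `n₀` depend
on the oracle.

Most of the work is to realise these algorithms as programs. `Big` describes the computations
without randomness and `Out` the output distribution of a configuration with its time bound;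
`Big.out` joins the two. `FP` is a calculus of polynomial-time functions of register contents,
closed under concatenation, case distinction, bounded iteration (`FP.fold`) and the functions of
given machines (`FP.of_polyTimeComputable`); it yields the program that writes down the formula. The
search is programmed once, with the query as a subprogram satisfying `Simulates` (`exists_search`),
so that verifier and inverter share it. -/

abbrev Regs := ℕ → List Bool

/-- From `C`, every computation path halts within `T` steps, and the final content of register `0`
is distributed as `A`. -/
structure Out (O : Oracle) (C : Config) (T : ℕ) (A : PMF (List Bool)) : Prop where
  halts : ∀ C' ∈ (run O T C).support, C'.todo = []
  dist : (run O T C).map (fun C' => C'.reg 0) = A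

theorem bind_congr_support {α β : Type*} {μ : PMF α} {f g : α → PMF β}
    (h : ∀ a ∈ μ.support, f a = g a) : μ.bind f = μ.bind g := by
  ext b
  simp only [PMF.bind_apply]
  refine tsum_congr fun a => ?_
  by_cases ha : μ a = 0
  · simp [ha]
  · rw [h a ((PMF.mem_support_iff _ _).2 ha)]

/-- `run` unfolds at its first step. Peeling off the last one instead shows that extra time is
harmless, as halted configurations are fixed by `step`. -/
theorem run_succ_last (O : Oracle) (t : ℕ) (C : Config) :
    run O (t + 1) C = (run O t C).bind (step O) := by
  induction t generalizing C with
  | zero =>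
    change (step O C).bind (fun C => PMF.pure C) = (PMF.pure C).bind (step O)
    rw [PMF.bind_pure, PMF.pure_bind]
  | succ t ih =>
    rw [run, run, PMF.bind_bind]
    exact congrArg _ (funext ih)

theorem step_halted (O : Oracle) {C : Config} (h : C.todo = []) : step O C = PMF.pure C := by
  obtain ⟨k, r, ψ⟩ := C
  subst h
  rfl

namespace Out
variable {O : Oracle} {C C' : Config} {T T' : ℕ} {A : PMF (List Bool)}

theorem succ (h : Out O C T A) : Out O C (T + 1) A := by
  have e : run O (T + 1) C = run O T C := by
    rw [run_succ_last, bind_congr_support fun C' hC' => step_halted O (h.halts C' hC'),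
      PMF.bind_pure]
  exact ⟨by rw [e]; exact h.halts, by rw [e]; exact h.dist⟩

theorem mono (h : Out O C T A) (hT : T ≤ T') : Out O C T' A := by
  induction hT with
  | refl => exact h
  | step _ ih => exact ih.succ

theorem halted (r : Regs) (ψ : QState) : Out O ⟨[], r, ψ⟩ 0 (PMF.pure (r 0)) :=
  ⟨fun C' h => by
    rw [run, PMF.support_pure] at h
    rw [h], by rw [run, PMF.pure_map]⟩

/-- The random outcomes may lead to different output distributions, but they must share one time
bound. -/
theorem of_bind {β : Type*} {μ : PMF β} {g : β → Config} {B : β → PMF (List Bool)}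
    (hs : step O C = μ.map g) (h : ∀ b ∈ μ.support, Out O (g b) T (B b)) :
    Out O C (T + 1) (μ.bind B) := by
  constructor
  · intro C' hC'
    rw [run, hs, PMF.bind_map, PMF.mem_support_bind_iff] at hC'
    obtain ⟨b, hb, hC'⟩ := hC'
    exact (h b hb).halts C' hC'
  · rw [run, hs, PMF.bind_map, PMF.map_bind]
    exact bind_congr_support fun b hb => (h b hb).dist

theorem of_pure (hs : step O C = PMF.pure C') (h : Out O C' T A) : Out O C (T + 1) A := by
  have := of_bind (O := O) (C := C) (μ := PMF.pure ()) (g := fun _ => C') (T := T) (B := fun _ => A)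
    (by rw [hs, PMF.pure_map]) (fun _ _ => h)
  rwa [PMF.pure_bind] at this

end Out

/-! ### Big-step semantics of deterministic computations -/

/-- From registers `r` and quantum state `ψ`, the command `c` leads to `r'` and `ψ'` within `t`
steps, without coins, queries and measurements. -/
inductive Big : Cmd → Regs → QState → ℕ → Regs → QState → Prop
  | push (i : ℕ) (b : Bool) (r : Regs) (ψ : QState) :
      Big (.push i b) r ψ 1 (Function.update r i (b :: r i)) ψ
  | pop (i : ℕ) (r : Regs) (ψ : QState) :
      Big (.pop i) r ψ 1 (Function.update r i (r i).tail) ψ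
  | seq {c d : Cmd} {r r' r'' : Regs} {ψ ψ' ψ'' : QState} {t t' : ℕ} :
      Big c r ψ t r' ψ' → Big d r' ψ' t' r'' ψ'' → Big (.seq c d) r ψ (t + t' + 1) r'' ψ''
  | branch_true {i : ℕ} {c₁ c₀ e : Cmd} {r r' : Regs} {ψ ψ' : QState} {t : ℕ} {l : List Bool} :
      r i = true :: l → Big c₁ r ψ t r' ψ' → Big (.branch i c₁ c₀ e) r ψ (t + 1) r' ψ'
  | branch_false {i : ℕ} {c₁ c₀ e : Cmd} {r r' : Regs} {ψ ψ' : QState} {t : ℕ} {l : List Bool} :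
      r i = false :: l → Big c₀ r ψ t r' ψ' → Big (.branch i c₁ c₀ e) r ψ (t + 1) r' ψ'
  | branch_nil {i : ℕ} {c₁ c₀ e : Cmd} {r r' : Regs} {ψ ψ' : QState} {t : ℕ} :
      r i = [] → Big e r ψ t r' ψ' → Big (.branch i c₁ c₀ e) r ψ (t + 1) r' ψ'
  | loop_nil {i : ℕ} {c : Cmd} {r : Regs} {ψ : QState} :
      r i = [] → Big (.loop i c) r ψ 1 r ψ
  | loop_cons {i : ℕ} {c : Cmd} {r r' r'' : Regs} {ψ ψ' ψ'' : QState} {t t' : ℕ} :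
      r i ≠ [] → Big c r ψ t r' ψ' → Big (.loop i c) r' ψ' t' r'' ψ'' →
      Big (.loop i c) r ψ (t + t' + 1) r'' ψ''
  | gate (g : Gate ℕ) (r : Regs) (ψ : QState) :
      Big (.gate g) r ψ 1 r ((g.map fun i => (r i).length).apply ψ)
  | mono {c : Cmd} {r r' : Regs} {ψ ψ' : QState} {t t' : ℕ} :
      Big c r ψ t r' ψ' → t ≤ t' → Big c r ψ t' r' ψ'

/-- The induction is over arbitrary continuations `k`: when `seq` or a loop is unfolded, the second
computation joins the continuation of the first. -/
theorem Big.out {O : Oracle} {c : Cmd} {r r' : Regs} {ψ ψ' : QState} {t : ℕ}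
    (h : Big c r ψ t r' ψ') {k : List Cmd} {T : ℕ} {A : PMF (List Bool)}
    (hk : Out O ⟨k, r', ψ'⟩ T A) : Out O ⟨c :: k, r, ψ⟩ (t + T) A := by
  induction h generalizing k T with
  | push => exact (Out.of_pure (by rfl) hk).mono (by omega)
  | pop => exact (Out.of_pure (by rfl) hk).mono (by omega)
  | seq _ _ ih₁ ih₂ => exact (Out.of_pure (by rfl) (ih₁ (ih₂ hk))).mono (by omega)
  | branch_true h _ ih => exact (Out.of_pure (by simp [step, h]) (ih hk)).mono (by omega)
  | branch_false h _ ih => exact (Out.of_pure (by simp [step, h]) (ih hk)).mono (by omega)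
  | branch_nil h _ ih => exact (Out.of_pure (by simp [step, h]) (ih hk)).mono (by omega)
  | loop_nil h => exact (Out.of_pure (by simp [step, h]) hk).mono (by omega)
  | @loop_cons i c r _ _ _ _ _ _ _ h _ _ ih₁ ih₂ =>
    refine (Out.of_pure ?_ (ih₁ (ih₂ hk))).mono (by omega)
    cases hr : r i with
    | nil => exact absurd hr h
    | cons b l => simp [step, hr]
  | gate => exact (Out.of_pure (by rfl) hk).mono (by omega)
  | mono _ hle ih => exact (ih hk).mono (by omega)

/-! ### Renaming registers -/

/-- Rename the registers of a command. -/
def Cmd.rename (ρ : ℕ → ℕ) : Cmd → Cmd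
  | .push i b => .push (ρ i) b
  | .pop i => .pop (ρ i)
  | .seq c d => .seq (c.rename ρ) (d.rename ρ)
  | .branch i c d e => .branch (ρ i) (c.rename ρ) (d.rename ρ) (e.rename ρ)
  | .loop i c => .loop (ρ i) (c.rename ρ)
  | .toss i => .toss (ρ i)
  | .query i j => .query (ρ i) (ρ j)
  | .gate g => .gate (g.map ρ)
  | .meas i j => .meas (ρ i) (ρ j)

theorem Cmd.IsDeterministic.rename {c : Cmd} (h : c.IsDeterministic) (ρ : ℕ → ℕ) :
    (c.rename ρ).IsDeterministic := by
  induction c with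
  | seq c d ihc ihd => exact ⟨ihc h.1, ihd h.2⟩
  | branch i c d e ihc ihd ihe => exact ⟨ihc h.1, ihd h.2.1, ihe h.2.2⟩
  | loop i c ih => exact ih h
  | _ => exact h

theorem Gate.map_map {α β γ : Type} (g : Gate α) (f : α → β) (f' : β → γ) :
    (g.map f).map f' = g.map fun i => f' (f i) := by
  cases g <;> rfl

theorem update_comp_injective {ρ : ℕ → ℕ} (hρ : Function.Injective ρ) (R : Regs) (i : ℕ)
    (l : List Bool) :
    (fun j => Function.update R (ρ i) l (ρ j)) = Function.update (fun j => R (ρ j)) i l := by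
  funext j
  by_cases h : j = i
  · subst h; simp
  · simp [h, hρ.eq_iff]

/-- Running a renamed program. -/
theorem Big.rename {c : Cmd} {r r' : Regs} {ψ ψ' : QState} {t : ℕ} (h : Big c r ψ t r' ψ')
    {ρ : ℕ → ℕ} (hρ : Function.Injective ρ) (R : Regs) (hR : (fun j => R (ρ j)) = r) :
    ∃ R' : Regs, (fun j => R' (ρ j)) = r' ∧ (∀ i ∉ Set.range ρ, R' i = R i) ∧
      Big (c.rename ρ) R ψ t R' ψ' := by
  induction h generalizing R with
  | push i b r ψ =>
    subst hR
    refine ⟨_, update_comp_injective hρ R i _, fun j hj => ?_, .push _ _ _ _⟩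
    exact Function.update_of_ne (fun h => hj ⟨i, h.symm⟩) _ _
  | pop i r ψ =>
    subst hR
    refine ⟨_, update_comp_injective hρ R i _, fun j hj => ?_, .pop _ _ _⟩
    exact Function.update_of_ne (fun h => hj ⟨i, h.symm⟩) _ _
  | seq _ _ ih₁ ih₂ =>
    obtain ⟨R₁, h₁, f₁, b₁⟩ := ih₁ R hR
    obtain ⟨R₂, h₂, f₂, b₂⟩ := ih₂ R₁ h₁
    exact ⟨R₂, h₂, fun i hi => (f₂ i hi).trans (f₁ i hi), .seq b₁ b₂⟩
  | branch_true h _ ih =>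
    obtain ⟨R₁, h₁, f₁, b₁⟩ := ih R hR
    exact ⟨R₁, h₁, f₁, .branch_true (by rw [← h, ← hR]) b₁⟩
  | branch_false h _ ih =>
    obtain ⟨R₁, h₁, f₁, b₁⟩ := ih R hR
    exact ⟨R₁, h₁, f₁, .branch_false (by rw [← h, ← hR]) b₁⟩
  | branch_nil h _ ih =>
    obtain ⟨R₁, h₁, f₁, b₁⟩ := ih R hR
    exact ⟨R₁, h₁, f₁, .branch_nil (by rw [← h, ← hR]) b₁⟩
  | loop_nil h => exact ⟨R, hR, fun _ _ => rfl, .loop_nil (by rw [← h, ← hR])⟩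
  | loop_cons h _ _ ih₁ ih₂ =>
    obtain ⟨R₁, h₁, f₁, b₁⟩ := ih₁ R hR
    obtain ⟨R₂, h₂, f₂, b₂⟩ := ih₂ R₁ h₁
    exact ⟨R₂, h₂, fun i hi => (f₂ i hi).trans (f₁ i hi),
      .loop_cons (by rw [← hR] at h; exact h) b₁ b₂⟩
  | gate g r ψ =>
    refine ⟨R, hR, fun _ _ => rfl, ?_⟩
    have := Big.gate (g.map ρ) R ψ
    rw [Gate.map_map] at this
    rw [← hR]
    exact this
  | mono _ hle ih =>
    obtain ⟨R₁, h₁, f₁, b₁⟩ := ih R hR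
    exact ⟨R₁, h₁, f₁, b₁.mono hle⟩

/-! ### Deterministic small steps -/

/-- The effect of the next command on the content of register `i`. -/
def act : List Cmd → ℕ → List Bool → List Bool
  | .push j b :: _, i, l => if i = j then b :: l else l
  | .pop j :: _, i, l => if i = j then l.tail else l
  | _, _, l => l

/-- The commands left after the next one, given the tops of the registers. -/
def ctl : List Cmd → (ℕ → Option Bool) → List Cmd
  | [], _ => []
  | .seq c d :: k, _ => c :: d :: k
  | .branch i c₁ c₀ e :: k, h =>
      match h i with
      | some true => c₁ :: k
      | some false => c₀ :: k
      | none => e :: k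
  | .loop i c :: k, h =>
      match h i with
      | none => k
      | some _ => c :: .loop i c :: k
  | _ :: k, _ => k

/-- One step of a deterministic program. -/
def dstep (s : List Cmd × Regs) : List Cmd × Regs :=
  (ctl s.1 fun i => (s.2 i).head?, fun i => act s.1 i (s.2 i))

theorem ctl_isDeterministic {q : List Cmd} (hq : ∀ c ∈ q, c.IsDeterministic)
    (h : ℕ → Option Bool) : ∀ c ∈ ctl q h, c.IsDeterministic := by
  intro c hc
  rcases q with _ | ⟨d, k⟩
  · simp [ctl] at hc
  have hd : d.IsDeterministic := hq d (by simp)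
  have hk : ∀ c ∈ k, c.IsDeterministic := fun c hc => hq c (by simp [hc])
  cases d with
  | seq d e =>
    simp only [ctl, List.mem_cons] at hc
    rcases hc with rfl | rfl | hc
    exacts [hd.1, hd.2, hk _ hc]
  | branch i d e f =>
    simp only [ctl] at hc
    split at hc <;> rcases List.mem_cons.1 hc with rfl | hc
    exacts [hd.1, hk _ hc, hd.2.1, hk _ hc, hd.2.2, hk _ hc]
  | loop i d =>
    simp only [ctl] at hc
    split at hc
    · exact hk _ hc
    · simp only [List.mem_cons] at hc
      rcases hc with rfl | rfl | hc
      exacts [hd, hd, hk _ hc]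
  | _ => exact hk _ hc

/-- The step splits into `ctl`, which sees only the tops of the registers, and `act`, which changes
each register on its own. This locality is what the tableau relies on. -/
theorem step_deterministic (O : Oracle) {q : List Cmd} (hq : ∀ c ∈ q, c.IsDeterministic)
    (r : Regs) (ψ : QState) :
    step O ⟨q, r, ψ⟩ = PMF.pure ⟨(dstep (q, r)).1, (dstep (q, r)).2, ψ⟩ := by
  rcases q with _ | ⟨d, k⟩
  · rfl
  have hd : d.IsDeterministic := hq d (by simp)
  cases d with
  | push i b =>
    simp only [step, dstep, ctl, act]
    congr 2
    funext j
    simp only [Function.update_apply]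
    split_ifs with h
    · rw [h]
    · rfl
  | pop i =>
    simp only [step, dstep, ctl, act]
    congr 2
    funext j
    simp only [Function.update_apply]
    split_ifs with h
    · rw [h]
    · rfl
  | seq d e => rfl
  | branch i d e f =>
    simp only [step, dstep, ctl, act]
    rcases h : r i with _ | ⟨_ | _, l⟩ <;> simp
  | loop i d =>
    simp only [step, dstep, ctl, act]
    rcases h : r i with _ | ⟨_ | _, l⟩ <;> simp
  | _ => exact hd.elim

theorem run_deterministic (O : Oracle) (t : ℕ) {q : List Cmd} (hq : ∀ c ∈ q, c.IsDeterministic)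
    (r : Regs) (ψ : QState) :
    run O t ⟨q, r, ψ⟩ = PMF.pure ⟨(dstep^[t] (q, r)).1, (dstep^[t] (q, r)).2, ψ⟩ := by
  induction t generalizing q r with
  | zero => rfl
  | succ t ih =>
    rw [run, step_deterministic O hq, PMF.pure_bind]
    exact ih (ctl_isDeterministic hq _) _

/-- Big-step semantics of a list of commands. -/
inductive BigList : List Cmd → Regs → QState → ℕ → Regs → QState → Prop
  | nil (r : Regs) (ψ : QState) (t : ℕ) : BigList [] r ψ t r ψ
  | cons {c : Cmd} {k : List Cmd} {r r' r'' : Regs} {ψ ψ' ψ'' : QState} {t t' T : ℕ} :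
      Big c r ψ t r' ψ' → BigList k r' ψ' t' r'' ψ'' → t + t' ≤ T →
      BigList (c :: k) r ψ T r'' ψ''

theorem act_push (i : ℕ) (b : Bool) (k : List Cmd) (r : Regs) :
    (fun j => act (.push i b :: k) j (r j)) = Function.update r i (b :: r i) := by
  funext j
  simp only [act, Function.update_apply]
  split_ifs with h
  · rw [h]
  · rfl

theorem act_pop (i : ℕ) (k : List Cmd) (r : Regs) :
    (fun j => act (.pop i :: k) j (r j)) = Function.update r i (r i).tail := by
  funext j
  simp only [act, Function.update_apply]
  split_ifs with h
  · rw [h]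
  · rfl

/-- A halting run becomes a derivation, so that a machine known only through its input and output
can serve as a subprogram. The derivation for the commands left after one step is taken apart and
its pieces are reassembled around the command just executed. -/
theorem BigList.of_dstep (t : ℕ) {q : List Cmd} (hq : ∀ c ∈ q, c.IsDeterministic) {r r' : Regs}
    (h : dstep^[t] (q, r) = ([], r')) (ψ : QState) : BigList q r ψ t r' ψ := by
  induction t generalizing q r with
  | zero =>
    obtain ⟨rfl, rfl⟩ := Prod.mk.inj h
    exact .nil _ _ _
  | succ t ih =>
    rw [Function.iterate_succ_apply] at h
    have ih := ih (ctl_isDeterministic hq fun i => (r i).head?) (r := (dstep (q, r)).2) h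
    rcases q with _ | ⟨d, k⟩
    · simp only [dstep, ctl, act] at ih
      generalize hk : ([] : List Cmd) = k at ih
      cases ih with
      | nil => exact .nil _ _ _
      | cons => simp at hk
    have hd : d.IsDeterministic := hq d (by simp)
    cases d with
    | push i b =>
      simp only [dstep, ctl, act_push] at ih
      exact .cons (.push _ _ _ _) ih (by omega)
    | pop i =>
      simp only [dstep, ctl, act_pop] at ih
      exact .cons (.pop _ _ _) ih (by omega)
    | seq d e =>
      simp only [dstep, ctl, act] at ih
      obtain _ | ⟨h₁, _ | ⟨h₂, h₃, l₂⟩, l₁⟩ := ih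
      exact .cons (.seq h₁ h₂) h₃ (by omega)
    | branch i d e f =>
      simp only [dstep, ctl, act] at ih
      rcases hr : r i with _ | ⟨_ | _, l⟩ <;> simp only [hr, List.head?_nil, List.head?_cons] at ih <;>
        obtain _ | ⟨h₁, h₂, l₁⟩ := ih
      · exact .cons (.branch_nil hr h₁) h₂ (by omega)
      · exact .cons (.branch_false hr h₁) h₂ (by omega)
      · exact .cons (.branch_true hr h₁) h₂ (by omega)
    | loop i d =>
      simp only [dstep, ctl, act] at ih
      rcases hr : r i with _ | ⟨b, l⟩ <;> simp only [hr, List.head?_nil, List.head?_cons] at ih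
      · exact .cons (.loop_nil hr) ih (by omega)
      · obtain _ | ⟨h₁, _ | ⟨h₂, h₃, l₂⟩, l₁⟩ := ih
        exact .cons (.loop_cons (by simp [hr]) h₁ h₂) h₃ (by omega)
    | _ => exact hd.elim

/-- A step pushes at most one bit, so running time bounds the length of every register, in
particular of the output. -/
theorem dstep_length_le (t : ℕ) (s : List Cmd × Regs) (i : ℕ) :
    ((dstep^[t] s).2 i).length ≤ (s.2 i).length + t := by
  induction t with
  | zero => simp
  | succ t ih =>
    rw [Function.iterate_succ_apply']
    refine le_trans ?_ (Nat.succ_le_succ ih)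
    generalize dstep^[t] s = s'
    simp only [dstep]
    unfold act
    split
    · split_ifs <;> simp
    · split_ifs <;> simp; omega
    · simp

/-! ### Finiteness of the control of a program -/

/-- The lists of commands that can be left while `c` is executed before `k`. -/
def conts : Cmd → List Cmd → Set (List Cmd)
  | .seq c d, k => {.seq c d :: k} ∪ (conts c (d :: k) ∪ conts d k)
  | .branch i c₁ c₀ e, k => {.branch i c₁ c₀ e :: k} ∪ (conts c₁ k ∪ (conts c₀ k ∪ conts e k))
  | .loop i c, k => {.loop i c :: k} ∪ conts c (.loop i c :: k)
  | c, k => {c :: k}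

/-- The body of a loop is continued by the loop itself, the same list in every round; structural
recursion therefore covers all rounds at once. -/
theorem conts_finite (c : Cmd) (k : List Cmd) : (conts c k).Finite := by
  induction c generalizing k with
  | seq c d ihc ihd => exact (Set.finite_singleton _).union ((ihc _).union (ihd _))
  | branch i c d e ihc ihd ihe =>
    exact (Set.finite_singleton _).union ((ihc _).union ((ihd _).union (ihe _)))
  | loop i c ih => exact (Set.finite_singleton _).union (ih _)
  | _ => exact Set.finite_singleton _

theorem self_mem_conts (c : Cmd) (k : List Cmd) : c :: k ∈ conts c k := by
  cases c <;> simp [conts]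

/-- A subcommand that finishes hands control to its continuation, which is again the beginning of a
member of the enclosing set; only the whole command exits to `k`. -/
theorem ctl_mem_conts (c : Cmd) (k : List Cmd) {q : List Cmd} (hq : q ∈ conts c k)
    (h : ℕ → Option Bool) : ctl q h ∈ insert k (conts c k) := by
  induction c generalizing k q with
  | seq c d ihc ihd =>
    rcases hq with rfl | hq | hq
    · exact .inr (.inr (.inl (self_mem_conts _ _)))
    · rcases ihc _ hq with h | h
      · exact .inr (.inr (.inr (h ▸ self_mem_conts _ _)))
      · exact .inr (.inr (.inl h))
    · rcases ihd _ hq with h | h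
      · exact .inl h
      · exact .inr (.inr (.inr h))
  | branch i c d e ihc ihd ihe =>
    rcases hq with rfl | hq | hq | hq
    · simp only [ctl]
      split
      · exact .inr (.inr (.inl (self_mem_conts _ _)))
      · exact .inr (.inr (.inr (.inl (self_mem_conts _ _))))
      · exact .inr (.inr (.inr (.inr (self_mem_conts _ _))))
    · exact (ihc _ hq).imp_right fun h => .inr (.inl h)
    · exact (ihd _ hq).imp_right fun h => .inr (.inr (.inl h))
    · exact (ihe _ hq).imp_right fun h => .inr (.inr (.inr h))
  | loop i c ih =>
    rcases hq with rfl | hq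
    · simp only [ctl]
      split
      · exact .inl rfl
      · exact .inr (.inr (self_mem_conts _ _))
    · rcases ih _ hq with h | h
      · exact .inr (.inl h)
      · exact .inr (.inr h)
  | _ =>
    cases hq
    exact .inl rfl

/-- The control states of the program `c`. -/
def ctlStates (c : Cmd) : Set (List Cmd) := insert [] (conts c [])

theorem ctlStates_finite (c : Cmd) : (ctlStates c).Finite := (conts_finite c []).insert _

theorem ctl_mem_ctlStates {c : Cmd} {q : List Cmd} (hq : q ∈ ctlStates c) (h : ℕ → Option Bool) :
    ctl q h ∈ ctlStates c := by
  rcases hq with rfl | hq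
  · exact .inl rfl
  · exact ctl_mem_conts c [] hq h

theorem dstep_mem_ctlStates {c : Cmd} (t : ℕ) {s : List Cmd × Regs} (h : s.1 ∈ ctlStates c) :
    (dstep^[t] s).1 ∈ ctlStates c := by
  induction t with
  | zero => exact h
  | succ t ih =>
    rw [Function.iterate_succ_apply']
    exact ctl_mem_ctlStates ih _

/-- A program pushes only on finitely many registers. -/
theorem exists_act_nil (c : Cmd) : ∃ M, ∀ q ∈ ctlStates c, ∀ i ≥ M, act q i [] = [] := by
  have h : ∀ q : List Cmd, ∃ M, ∀ i ≥ M, act q i [] = [] := by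
    intro q
    rcases q with _ | ⟨_ | _, _⟩
    case cons.push k j _ => exact ⟨j + 1, fun i hi => if_neg (by omega)⟩
    case cons.pop j k => exact ⟨0, fun i _ => by simp [act]⟩
    all_goals exact ⟨0, fun _ _ => rfl⟩
  choose b hb using h
  obtain ⟨M, hM⟩ := ((ctlStates_finite c).image b).bddAbove
  exact ⟨M, fun q hq i hi => hb q i ((hM (Set.mem_image_of_mem b hq)).trans hi)⟩

/-- Finitely many registers thus describe the whole computation, and a column of the tableau ranges
over a finite set. -/
theorem dstep_eq_nil {c : Cmd} {M : ℕ} (hM : ∀ q ∈ ctlStates c, ∀ i ≥ M, act q i [] = [])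
    {s : List Cmd × Regs} (hs : s.1 ∈ ctlStates c) {i : ℕ} (hi : M ≤ i) (h0 : s.2 i = []) (t : ℕ) :
    (dstep^[t] s).2 i = [] := by
  induction t with
  | zero => exact h0
  | succ t ih =>
    rw [Function.iterate_succ_apply']
    simp only [dstep, ih]
    exact hM _ (dstep_mem_ctlStates t hs) i hi

/-! ### Blocks of registers -/

/-- The registers hold the strings of `G`, then those of `xs`, and are empty from then on. -/
def blk (G xs : List (List Bool)) : Regs := fun i => (G ++ xs).getD i []

theorem blk_apply (G xs : List (List Bool)) (j : ℕ) : blk G xs (G.length + j) = xs.getD j [] := by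
  simp [blk, List.getD_eq_getElem?_getD, List.getElem?_append_right]

theorem blk_lt {G : List (List Bool)} (xs : List (List Bool)) {i : ℕ} (h : i < G.length) :
    blk G xs i = G.getD i [] := by
  simp [blk, List.getD_eq_getElem?_getD, List.getElem?_append_left h]

theorem blk_update (G xs : List (List Bool)) {j : ℕ} (hj : j < xs.length) (v : List Bool) :
    Function.update (blk G xs) (G.length + j) v = blk G (xs.set j v) := by
  funext i
  rcases lt_or_ge i G.length with h | h
  · rw [Function.update_of_ne (by omega)]
    simp [blk, List.getD_eq_getElem?_getD, List.getElem?_append_left h]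
  · obtain ⟨i, rfl⟩ := Nat.exists_eq_add_of_le h
    rw [blk_apply]
    by_cases hij : i = j
    · subst hij
      simp [List.getD_eq_getElem?_getD, hj]
    · rw [Function.update_of_ne (by omega), blk_apply]
      simp [List.getD_eq_getElem?_getD, List.getElem?_set_ne (Ne.symm hij)]

/-- Registers past the end of the list are empty anyway, so scratch registers can be made explicit
before use and forgotten afterwards. -/
theorem blk_pad (G xs : List (List Bool)) (k : ℕ) :
    blk G (xs ++ List.replicate k []) = blk G xs := by
  funext i
  simp only [blk, List.getD_eq_getElem?_getD, ← List.append_assoc]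
  rcases lt_or_ge i (G ++ xs).length with h | h
  · rw [List.getElem?_append_left h]
  · rw [List.getElem?_append_right h, List.getElem?_eq_none h, List.getElem?_replicate]
    split_ifs <;> rfl

theorem blk_snoc (G xs : List (List Bool)) (x : List Bool) : blk (G ++ [x]) xs = blk G (x :: xs) := by
  unfold blk
  rw [List.append_assoc]
  rfl

/-! ### Elementary programs -/

theorem Big.of_eq {c : Cmd} {r r' r'' : Regs} {ψ ψ' : QState} {t t' : ℕ} (h : Big c r ψ t r' ψ')
    (hr : r' = r'') (ht : t ≤ t') : Big c r ψ t' r'' ψ' :=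
  hr ▸ h.mono ht

/-- Do nothing, given an empty register. -/
def Cmd.skip (i : ℕ) : Cmd := .seq (.push i true) (.pop i)

theorem Big.skip (i : ℕ) (r : Regs) (ψ : QState) : Big (.skip i) r ψ 3 r ψ := by
  exact ((Big.push i true r ψ).seq (Big.pop i _ ψ)).of_eq (by simp) (by omega)

/-- Empty register `i`. -/
def Cmd.clear (i : ℕ) : Cmd := .loop i (.pop i)

theorem Big.clear (i : ℕ) (r : Regs) (ψ : QState) :
    Big (.clear i) r ψ (2 * (r i).length + 1) (Function.update r i []) ψ := by
  generalize hl : r i = l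
  induction l generalizing r with
  | nil =>
    rw [← hl, Function.update_eq_self, hl]
    exact .loop_nil hl
  | cons b l ih =>
    have h₁ := ih (Function.update r i (r i).tail) (by simp [hl])
    rw [Function.update_idem] at h₁
    exact (Big.loop_cons (by simp [hl]) (.pop i r ψ) h₁).mono (by simp; omega)

/-- Move the content of register `i` to register `j`, in reverse order. -/
def Cmd.move (i j : ℕ) : Cmd :=
  .loop i (.branch i (.seq (.push j true) (.pop i)) (.seq (.push j false) (.pop i)) (.pop i))

theorem Big.move {i j : ℕ} (hij : i ≠ j) (r : Regs) (ψ : QState) :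
    Big (.move i j) r ψ (5 * (r i).length + 1)
      (Function.update (Function.update r j ((r i).reverse ++ r j)) i []) ψ := by
  generalize hl : r i = l
  induction l generalizing r with
  | nil =>
    have : Function.update (Function.update r j ([].reverse ++ r j)) i [] = r := by
      simpa using hl.symm
    rw [this]
    exact .loop_nil hl
  | cons b l ih =>
    have h₁ := ih (Function.update (Function.update r j (b :: r j)) i l) (by simp)
    have e : Function.update (Function.update (Function.update (Function.update r j (b :: r j)) i l) j
        (l.reverse ++ Function.update (Function.update r j (b :: r j)) i l j)) i [] =
        Function.update (Function.update r j ((b :: l).reverse ++ r j)) i [] := by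
      funext k
      by_cases hk : k = i
      · subst hk; simp
      · by_cases hk' : k = j
        · subst hk'; simp [hk]
        · simp [hk, hk']
    rw [e] at h₁
    have h₂ : Big (.seq (.push j b) (.pop i)) r ψ 3
        (Function.update (Function.update r j (b :: r j)) i l) ψ := by
      have := (Big.push j b r ψ).seq (Big.pop i _ ψ)
      rwa [Function.update_of_ne hij, hl] at this
    refine (Big.loop_cons (t := 4) (by simp [hl]) ?_ h₁).mono (by simp; omega)
    cases b
    · exact .branch_false hl h₂
    · exact .branch_true hl h₂

/-- Prepend the content of register `i` to register `j`, using the empty register `s`. -/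
def Cmd.transfer (i j s : ℕ) : Cmd := .seq (.move i s) (.move s j)

/-- Two moves reverse twice, which restores the order. -/
theorem Big.transfer {i j s : ℕ} (hij : i ≠ j) (his : i ≠ s) (hjs : j ≠ s) (r : Regs) (ψ : QState)
    (hs : r s = []) :
    Big (.transfer i j s) r ψ (10 * (r i).length + 3)
      (Function.update (Function.update r j (r i ++ r j)) i []) ψ := by
  have h := (Big.move his r ψ).seq (Big.move hjs.symm _ ψ)
  refine h.of_eq ?_ (by simp [his.symm, hs]; omega)
  funext k
  by_cases hk : k = i
  · subst hk; simp [hij, his]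
  · by_cases hk' : k = j
    · subst hk'; simp [hk, hs, his.symm, hjs]
    · by_cases hk'' : k = s
      · subst hk''; simp [hk, hk', hs]
      · simp [hk, hk', hk'']

/-- Copy the content of register `i` to the empty register `j`, using the empty register `s`. -/
def Cmd.copy (i j s : ℕ) : Cmd :=
  .seq (.move i s) (.loop s (.branch s
    (.seq (.push i true) (.seq (.push j true) (.pop s)))
    (.seq (.push i false) (.seq (.push j false) (.pop s))) (.pop s)))

/-- Moving `i` to `s` reverses it; emptying `s` then rebuilds `i` and fills `j` in the same pass. -/
theorem Big.copy {i j s : ℕ} (hij : i ≠ j) (his : i ≠ s) (hjs : j ≠ s) (r : Regs) (ψ : QState)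
    (hs : r s = []) (hj : r j = []) :
    Big (.copy i j s) r ψ (12 * (r i).length + 3) (Function.update r j (r i)) ψ := by
  have key : ∀ (l : List Bool) (r : Regs), r s = l →
      Big (.loop s (.branch s (.seq (.push i true) (.seq (.push j true) (.pop s)))
        (.seq (.push i false) (.seq (.push j false) (.pop s))) (.pop s))) r ψ (7 * l.length + 1)
      (Function.update (Function.update (Function.update r i (l.reverse ++ r i)) j
        (l.reverse ++ r j)) s []) ψ := by
    intro l
    induction l with
    | nil =>
      intro r hl
      have : Function.update (Function.update (Function.update r i ([].reverse ++ r i)) j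
        ([].reverse ++ r j)) s [] = r := by simpa using hl.symm
      rw [this]
      exact .loop_nil hl
    | cons b l ih =>
      intro r hl
      have h₁ := ih (Function.update (Function.update (Function.update r i (b :: r i)) j
        (b :: r j)) s l) (by simp)
      have h₂ : Big (.seq (.push i b) (.seq (.push j b) (.pop s))) r ψ 5
          (Function.update (Function.update (Function.update r i (b :: r i)) j (b :: r j)) s l) ψ := by
        have := (Big.push i b r ψ).seq ((Big.push j b _ ψ).seq (Big.pop s _ ψ))
        rwa [Function.update_of_ne hjs.symm, Function.update_of_ne his.symm,
          Function.update_of_ne hij.symm, hl] at this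
      have h₃ := Big.loop_cons (t := 6) (by simp [hl])
        (show Big (.branch s (.seq (.push i true) (.seq (.push j true) (.pop s)))
          (.seq (.push i false) (.seq (.push j false) (.pop s))) (.pop s)) r ψ 6 _ ψ by
        cases b
        · exact .branch_false hl h₂
        · exact .branch_true hl h₂) h₁
      refine h₃.of_eq ?_ (by simp; omega)
      funext k
      by_cases hk : k = s
      · subst hk; simp
      · by_cases hk' : k = j
        · subst hk'; simp [hk]
        · by_cases hk'' : k = i
          · subst hk''; simp [hk, hk']
          · simp [hk, hk', hk'']
  have h := (Big.move his r ψ).seq (key _ _ rfl)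
  refine h.of_eq ?_ (by simp [his.symm, hs]; omega)
  funext k
  by_cases hk : k = s
  · subst hk; simp [hjs.symm, hs]
  · by_cases hk' : k = j
    · subst hk'; simp [hk, hs, hj, his.symm, hij.symm]
    · by_cases hk'' : k = i
      · subst hk''; simp [hk, hk', hs, his.symm]
      · simp [hk, hk', hk'']

section Blocks
variable {m : ℕ} {G : List (List Bool)}

theorem Big.blk_push (hG : G.length = m) (xs : List (List Bool)) (ψ : QState)
    {i : ℕ} (hi : i < xs.length) (b : Bool) :
    Big (.push (m + i) b) (blk G xs) ψ 1 (blk G (xs.set i (b :: xs.getD i []))) ψ := by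
  subst hG
  have := Big.push (G.length + i) b (blk G xs) ψ
  rwa [blk_apply, blk_update _ _ hi] at this

theorem Big.blk_pop (hG : G.length = m) (xs : List (List Bool)) (ψ : QState)
    {i : ℕ} (hi : i < xs.length) :
    Big (.pop (m + i)) (blk G xs) ψ 1 (blk G (xs.set i (xs.getD i []).tail)) ψ := by
  subst hG
  have := Big.pop (G.length + i) (blk G xs) ψ
  rwa [blk_apply, blk_update _ _ hi] at this

theorem Big.blk_clear (hG : G.length = m) (xs : List (List Bool)) (ψ : QState)
    {i : ℕ} (hi : i < xs.length) :
    Big (.clear (m + i)) (blk G xs) ψ (2 * (xs.getD i []).length + 1)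
      (blk G (xs.set i [])) ψ := by
  subst hG
  have := Big.clear (G.length + i) (blk G xs) ψ
  rwa [blk_apply, blk_update _ _ hi] at this

theorem Big.blk_transfer (hG : G.length = m) (xs : List (List Bool)) (ψ : QState)
    {i j s : ℕ} (hi : i < xs.length) (hj : j < xs.length)
    (hij : i ≠ j) (his : i ≠ s) (hjs : j ≠ s) (h : xs.getD s [] = []) :
    Big (.transfer (m + i) (m + j) (m + s)) (blk G xs) ψ
      (10 * (xs.getD i []).length + 3)
      (blk G ((xs.set j (xs.getD i [] ++ xs.getD j [])).set i [])) ψ := by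
  subst hG
  have := Big.transfer (i := G.length + i) (j := G.length + j) (s := G.length + s) (by omega)
    (by omega) (by omega) (blk G xs) ψ (by rw [blk_apply, h])
  rwa [blk_apply, blk_apply, blk_update _ _ hj, blk_update _ _ (by simpa using hi)] at this

theorem Big.blk_copy (hG : G.length = m) (xs : List (List Bool)) (ψ : QState)
    {i j s : ℕ} (hj : j < xs.length)
    (hij : i ≠ j) (his : i ≠ s) (hjs : j ≠ s) (h : xs.getD s [] = []) (h' : xs.getD j [] = []) :
    Big (.copy (m + i) (m + j) (m + s)) (blk G xs) ψ
      (12 * (xs.getD i []).length + 3) (blk G (xs.set j (xs.getD i []))) ψ := by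
  subst hG
  have := Big.copy (i := G.length + i) (j := G.length + j) (s := G.length + s) (by omega)
    (by omega) (by omega) (blk G xs) ψ (by rw [blk_apply, h]) (by rw [blk_apply, h'])
  rwa [blk_apply, blk_update _ _ hj] at this

end Blocks

theorem Cmd.transfer_isDeterministic (i j s : ℕ) : (Cmd.transfer i j s).IsDeterministic := by
  simp [Cmd.transfer, Cmd.IsDeterministic, Cmd.move]

theorem Cmd.copy_isDeterministic (i j s : ℕ) : (Cmd.copy i j s).IsDeterministic := by
  simp [Cmd.copy, Cmd.IsDeterministic, Cmd.move]

theorem Cmd.clear_isDeterministic (i : ℕ) : (Cmd.clear i).IsDeterministic := by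
  simp [Cmd.clear, Cmd.IsDeterministic]

theorem Cmd.skip_isDeterministic (i : ℕ) : (Cmd.skip i).IsDeterministic := by
  simp [Cmd.skip, Cmd.IsDeterministic]

/-! ### Polynomial-time functions of register contents -/

theorem polynomial_eval_mono (p : Polynomial ℕ) {m n : ℕ} (h : m ≤ n) : p.eval m ≤ p.eval n := by
  rw [Polynomial.eval_eq_sum, Polynomial.eval_eq_sum]
  exact Finset.sum_le_sum fun i _ => Nat.mul_le_mul_left _ (Nat.pow_le_pow_left h i)

/-- The contents of the first `m` registers, as functions of some data of type `α`. -/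
structure Ctx (α : Type) where
  m : ℕ
  val : α → List (List Bool)
  len : ∀ a, (val a).length = m

namespace Ctx
variable {α β : Type} (Γ : Ctx α)

/-- One more register. -/
def push (g : α → List Bool) : Ctx α := ⟨Γ.m + 1, fun a => Γ.val a ++ [g a], fun a => by simp [Γ.len]⟩

/-- The same registers, as functions of other data. -/
def comap (φ : β → α) : Ctx β := ⟨Γ.m, fun b => Γ.val (φ b), fun b => Γ.len (φ b)⟩

def size (a : α) : ℕ := ((Γ.val a).map List.length).sum

theorem size_push (g : α → List Bool) (a : α) : (Γ.push g).size a = Γ.size a + (g a).length := by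
  simp [size, push]

end Ctx

/-- `T` is bounded by a polynomial in the total length of the registers. -/
def PB {α : Type} (Γ : Ctx α) (T : α → ℕ) : Prop := ∃ p : Polynomial ℕ, ∀ a, T a ≤ p.eval (Γ.size a)

namespace PB
variable {α β : Type} {Γ : Ctx α} {T T' : α → ℕ}

theorem of_le (h : PB Γ T') (hT : ∀ a, T a ≤ T' a) : PB Γ T :=
  h.imp fun _ hp a => (hT a).trans (hp a)

theorem const (n : ℕ) : PB Γ fun _ => n := ⟨Polynomial.C n, fun a => by simp⟩

theorem size : PB Γ Γ.size := ⟨Polynomial.X, fun a => by simp⟩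

theorem add (h : PB Γ T) (h' : PB Γ T') : PB Γ fun a => T a + T' a := by
  obtain ⟨p, hp⟩ := h
  obtain ⟨q, hq⟩ := h'
  exact ⟨p + q, fun a => by rw [Polynomial.eval_add]; exact Nat.add_le_add (hp a) (hq a)⟩

theorem mul (h : PB Γ T) (h' : PB Γ T') : PB Γ fun a => T a * T' a := by
  obtain ⟨p, hp⟩ := h
  obtain ⟨q, hq⟩ := h'
  exact ⟨p * q, fun a => by rw [Polynomial.eval_mul]; exact Nat.mul_le_mul (hp a) (hq a)⟩

theorem eval (q : Polynomial ℕ) (h : PB Γ T) : PB Γ fun a => q.eval (T a) := by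
  obtain ⟨p, hp⟩ := h
  exact ⟨q.comp p, fun a => by rw [Polynomial.eval_comp]; exact polynomial_eval_mono q (hp a)⟩

theorem push (h : PB Γ T) (g : α → List Bool) : PB (Γ.push g) T := by
  obtain ⟨p, hp⟩ := h
  exact ⟨p, fun a => (hp a).trans (polynomial_eval_mono p (by rw [Γ.size_push]; omega))⟩

/-- A register whose length is polynomial in the others can be dropped from the measure, by
composing polynomials. Bounds for intermediate results return to the original context this way. -/
theorem of_push {g : α → List Bool} (h : PB (Γ.push g) T) (hg : PB Γ fun a => (g a).length) :
    PB Γ T := by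
  obtain ⟨p, hp⟩ := h
  exact (((size).add hg).eval p).of_le fun a => by simpa [Γ.size_push] using hp a

theorem comap (h : PB Γ T) (φ : β → α) : PB (Γ.comap φ) fun b => T (φ b) := by
  obtain ⟨p, hp⟩ := h
  exact ⟨p, fun b => hp (φ b)⟩

end PB

/-- From registers `Γ a`, a deterministic program appends a register with content `f a`, in
polynomial time. -/
def FP {α : Type} (Γ : Ctx α) (f : α → List Bool) : Prop :=
  PB Γ (fun a => (f a).length) ∧ ∃ (c : Cmd) (T : α → ℕ), c.IsDeterministic ∧ PB Γ T ∧
    ∀ a ψ, Big c (blk (Γ.val a) []) ψ (T a) (blk (Γ.val a) [f a]) ψ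

/-- Do `c`, then `d`, and so on. -/
def Cmd.block : Cmd → List Cmd → Cmd
  | c, [] => c
  | c, d :: k => .seq c (Cmd.block d k)

namespace FP
variable {α β : Type} {Γ : Ctx α} {f g : α → List Bool}

theorem congr (h : FP Γ f) (hfg : ∀ a, f a = g a) : FP Γ g := by
  rwa [← funext hfg]

theorem comap (h : FP Γ f) (φ : β → α) : FP (Γ.comap φ) fun b => f (φ b) := by
  obtain ⟨hs, c, T, hc, hT, h⟩ := h
  exact ⟨hs.comap φ, c, _, hc, hT.comap φ, fun b ψ => h (φ b) ψ⟩

theorem top : FP (Γ.push g) g := by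
  refine ⟨PB.size.of_le fun a => by simp [Γ.size_push], .copy (Γ.m + 0) (Γ.m + 1) (Γ.m + 2),
    fun a => 12 * (g a).length + 3, Cmd.copy_isDeterministic _ _ _,
    ((PB.const 12).mul PB.size |>.add (PB.const 3)).of_le fun a => by simp [Γ.size_push], ?_⟩
  intro a ψ
  have h := Big.blk_copy (Γ.len a) [g a, [], []] ψ (i := 0) (j := 1) (s := 2) (by simp) (by simp)
    (by simp) (by simp) rfl rfl
  change Big _ (blk (Γ.val a ++ [g a]) []) ψ _ (blk (Γ.val a ++ [g a]) [g a]) ψ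
  rw [blk_snoc, blk_snoc, ← blk_pad _ [g a] 2, ← blk_pad _ [g a, g a] 1]
  exact h

/-- The program is renamed so that its result and scratch registers skip register `Γ.m`, which is
now occupied. -/
theorem weaken (h : FP Γ f) (g : α → List Bool) : FP (Γ.push g) f := by
  obtain ⟨hs, c, T, hc, hT, h⟩ := h
  let ρ : ℕ → ℕ := fun i => if i < Γ.m then i else i + 1
  have hρ : Function.Injective ρ := by
    intro i j hij
    simp only [ρ] at hij
    split_ifs at hij <;> omega
  refine ⟨hs.push g, c.rename ρ, T, hc.rename ρ, hT.push g, fun a ψ => ?_⟩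
  have hm := Γ.len a
  change Big _ (blk (Γ.val a ++ [g a]) []) ψ _ (blk (Γ.val a ++ [g a]) [f a]) ψ
  rw [blk_snoc, blk_snoc]
  have key : ∀ xs, (fun j => blk (Γ.val a) (g a :: xs) (ρ j)) = blk (Γ.val a) xs := by
    intro xs
    funext j
    simp only [ρ]
    split_ifs with hj
    · rw [blk_lt _ (by omega), blk_lt _ (by omega)]
    · obtain ⟨k, rfl⟩ := Nat.exists_eq_add_of_le (not_lt.1 hj)
      rw [← hm, add_assoc, blk_apply, blk_apply, List.getD_cons_succ]
  obtain ⟨R', h₁, h₂, h₃⟩ := (h a ψ).rename hρ (blk (Γ.val a) [g a]) (key [])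
  convert h₃ using 1
  funext i
  by_cases hi : i = Γ.m
  · rw [h₂]
    · rw [hi, ← hm]
      exact (blk_apply _ [g a, f a] 0).trans (blk_apply _ [g a] 0).symm
    · rintro ⟨j, hj⟩
      simp only [ρ] at hj
      split_ifs at hj <;> omega
  · obtain ⟨j, rfl⟩ : ∃ j, i = ρ j := by
      by_cases hi' : i < Γ.m
      · exact ⟨i, by simp [ρ, hi']⟩
      · refine ⟨i - 1, ?_⟩
        simp only [ρ]
        split_ifs <;> omega
    rw [congrFun (key [f a]) j, ← congrFun h₁ j]

theorem nil : FP Γ fun _ => [] := by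
  refine ⟨.const 0, .skip 0, fun _ => 3, Cmd.skip_isDeterministic _, .const 3, fun a ψ => ?_⟩
  rw [show blk (Γ.val a) [[]] = blk (Γ.val a) [] from blk_pad _ [] 1]
  exact .skip _ _ _

theorem cons (b : Bool) (hf : FP Γ f) : FP Γ fun a => b :: f a := by
  obtain ⟨sf, c, T, hc, hT, hf⟩ := hf
  refine ⟨sf.add (.const 1), .seq c (.push (Γ.m + 0) b), fun a => T a + 1 + 1, ⟨hc, trivial⟩,
    (hT.add (.const 1)).add (.const 1), fun a ψ => ?_⟩
  exact (hf a ψ).seq (Big.blk_push (Γ.len a) [f a] ψ (i := 0) (by simp) b)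

theorem tail (hf : FP Γ f) : FP Γ fun a => (f a).tail := by
  obtain ⟨sf, c, T, hc, hT, hf⟩ := hf
  refine ⟨sf.of_le fun a => by simp, .seq c (.pop (Γ.m + 0)), fun a => T a + 1 + 1, ⟨hc, trivial⟩,
    (hT.add (.const 1)).add (.const 1), fun a ψ => ?_⟩
  exact (hf a ψ).seq (Big.blk_pop (Γ.len a) [f a] ψ (i := 0) (by simp))

theorem const (l : List Bool) : FP Γ fun _ => l := by
  induction l with
  | nil => exact nil
  | cons b l ih => exact ih.cons b

theorem append (hf : FP Γ f) (hg : FP Γ g) : FP Γ fun a => f a ++ g a := by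
  obtain ⟨sg, d, U, hd, hU, hg⟩ := hg
  -- Since `transfer` prepends, `g` is evaluated first and `f` on top of it.
  obtain ⟨sf, c, T, hc, hT, hf⟩ := hf.weaken g
  have hT := hT.of_push sg
  have sf := sf.of_push sg
  refine ⟨(sf.add sg).of_le fun a => by simp,
    Cmd.block d [c, .transfer (Γ.m + 1) (Γ.m + 0) (Γ.m + 2)],
    fun a => U a + (T a + (10 * (f a).length + 3) + 1) + 1,
    ⟨hd, hc, Cmd.transfer_isDeterministic _ _ _⟩, ?_, ?_⟩
  · exact (hU.add ((hT.add (((PB.const 10).mul sf).add (.const 3))).add (.const 1))).add (.const 1)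
  intro a ψ
  have h₂ := hf a ψ
  change Big _ (blk (Γ.val a ++ [g a]) []) ψ _ (blk (Γ.val a ++ [g a]) [f a]) ψ at h₂
  rw [blk_snoc, blk_snoc, ← blk_pad _ [g a, f a] 1] at h₂
  rw [← blk_pad _ [f a ++ g a] 2]
  exact Big.seq (hg a ψ) (Big.seq h₂ (Big.blk_transfer (Γ.len a) [g a, f a, []] ψ
    (i := 1) (j := 0) (s := 2) (by simp) (by simp) (by simp) (by simp) (by simp) rfl))

/-- Case distinction on the first bit of a string. -/
def cases {γ : Type} (l : List Bool) (x y z : γ) : γ :=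
  match l with
  | true :: _ => x
  | false :: _ => y
  | [] => z

/-- The branches expect register `Γ.m` to be empty, so the tested string is cleared before two of
them; in the third case it is empty already. -/
theorem branch {e : α → List Bool} {h : α → List Bool} (he : FP Γ e) (hf : FP Γ f) (hg : FP Γ g)
    (hh : FP Γ h) : FP Γ fun a => cases (e a) (f a) (g a) (h a) := by
  obtain ⟨se, ce, Te, hce, hTe, he⟩ := he
  obtain ⟨sf, cf, Tf, hcf, hTf, hf⟩ := hf
  obtain ⟨sg, cg, Tg, hcg, hTg, hg⟩ := hg
  obtain ⟨sh, ch, Th, hch, hTh, hh⟩ := hh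
  refine ⟨((sf.add sg).add sh).of_le fun a => ?_,
    .seq ce (.branch (Γ.m + 0) (.seq (.clear (Γ.m + 0)) cf) (.seq (.clear (Γ.m + 0)) cg) ch),
    fun a => Te a + ((2 * (e a).length + 1) + (Tf a + Tg a + Th a) + 1 + 1) + 1,
    ⟨hce, ⟨Cmd.clear_isDeterministic _, hcf⟩, ⟨Cmd.clear_isDeterministic _, hcg⟩, hch⟩, ?_, ?_⟩
  · dsimp only
    rcases e a with _ | ⟨_ | _, l⟩ <;> simp only [cases] <;> omega
  · exact (hTe.add (((((PB.const 2).mul se).add (.const 1)).add ((hTf.add hTg).add hTh)).add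
      (.const 1) |>.add (.const 1))).add (.const 1)
  intro a ψ
  have h₁ := he a ψ
  have hcl := Big.blk_clear (Γ.len a) [e a] ψ (i := 0) (by simp)
  change Big _ _ ψ (2 * (e a).length + 1) (blk (Γ.val a) [[]]) ψ at hcl
  rw [show blk (Γ.val a) [[]] = blk (Γ.val a) [] from blk_pad _ [] 1] at hcl
  have hr : blk (Γ.val a) [e a] (Γ.m + 0) = e a := by
    rw [← Γ.len a, blk_apply]
    rfl
  refine h₁.seq ?_
  beta_reduce
  rcases hl : e a with _ | ⟨_ | _, l⟩ <;> rw [hl] at hcl hr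
  · have hh := hh a ψ
    rw [← show blk (Γ.val a) [[]] = blk (Γ.val a) [] from blk_pad _ [] 1] at hh
    refine Big.mono (Big.branch_nil hr hh) ?_
    omega
  · refine Big.mono (Big.branch_false hr (hcl.seq (hg a ψ))) ?_
    omega
  · refine Big.mono (Big.branch_true hr (hcl.seq (hf a ψ))) ?_
    omega

end FP

/-- The registers inside a loop: those of `Γ`, the loop index in unary, and the loop state. -/
def Ctx.loop {α : Type} (Γ : Ctx α) : Ctx (α × ℕ × List Bool) :=
  ((Γ.comap Prod.fst).push fun p => unary p.2.1).push fun p => p.2.2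

/-- The registers inside a loop without state. -/
def Ctx.index {α : Type} (Γ : Ctx α) : Ctx (α × ℕ) :=
  (Γ.comap Prod.fst).push fun p => unary p.2

/-- Iterate `h`, starting with `s`. -/
def iter (h : ℕ → List Bool → List Bool) (s : List Bool) : ℕ → List Bool
  | 0 => s
  | i + 1 => h i (iter h s i)

namespace FP
variable {α β : Type} {Γ : Ctx α} {f g : α → List Bool}

/-- The bound `B` on all intermediate states is indispensable: iterating a polynomial-time function
may otherwise produce strings of exponential length. During the loop, registers `m + 0`, `m + 1`, `m
+ 2` hold the index in unary, the state, and what is left of `N a` as a counter. -/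
theorem fold {N s : α → List Bool} {h : α × ℕ × List Bool → List Bool} {B : α → ℕ}
    (hN : FP Γ N) (hs : FP Γ s) (hh : FP Γ.loop h) (hB : PB Γ B)
    (hle : ∀ a i, i ≤ (N a).length → (iter (fun i s => h (a, i, s)) (s a) i).length ≤ B a) :
    FP Γ fun a => iter (fun i s => h (a, i, s)) (s a) (N a).length := by
  obtain ⟨sN, cN, TN, hcN, hTN, hN⟩ := (hN.weaken (fun _ => [])).weaken s
  obtain ⟨ss, cs, Ts, hcs, hTs, hs⟩ := hs.weaken fun _ => []
  have ss := ss.of_push (PB.const 0)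
  have hTs := hTs.of_push (PB.const 0)
  have hTN := (hTN.of_push (ss.push _)).of_push (PB.const 0)
  have sN := (sN.of_push (ss.push _)).of_push (PB.const 0)
  -- The loop body runs with the counter as one more register in the context, so the new state
  -- appears in register `m + 3`.
  obtain ⟨-, cH, TH, hcH, ⟨p, hp⟩, hH⟩ :=
    (hh.comap (β := (α × ℕ × List Bool) × List Bool) Prod.fst).weaken fun q => q.2
  let m := Γ.m
  let body := Cmd.block (.pop (m + 2)) [cH, .clear (m + 1), .transfer (m + 3) (m + 1) (m + 4),
    .push (m + 0) true]
  -- The cost of one round: index and counter have length at most that of `N a`, the state at most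
  -- `B a`; clearing the old state and transferring the new one take `2 * B a` and `10 * B a` steps
  -- up to constants.
  let D : α → ℕ := fun a => p.eval (Γ.size a + (N a).length + B a + (N a).length) + 12 * B a + 20
  have hD : PB Γ D := ((((PB.size.add sN).add hB).add sN).eval p |>.add ((PB.const 12).mul hB)).add
    (.const 20)
  refine ⟨hB.of_le fun a => hle a _ le_rfl,
    Cmd.block cs [cN, .loop (m + 2) body, .clear (m + 0), .transfer (m + 1) (m + 0) (m + 2)],
    fun a => Ts a + (TN a + (((N a).length * (D a + 1) + 1) + ((2 * (N a).length + 1) +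
      (10 * B a + 3) + 1) + 1) + 1) + 1,
    ⟨hcs, hcN, ⟨trivial, hcH, Cmd.clear_isDeterministic _, Cmd.transfer_isDeterministic _ _ _,
      trivial⟩, Cmd.clear_isDeterministic _, Cmd.transfer_isDeterministic _ _ _⟩, ?_, ?_⟩
  · exact (hTs.add ((hTN.add (((sN.mul (hD.add (.const 1))).add (.const 1)).add
      ((((PB.const 2).mul sN).add (.const 1)).add (((PB.const 10).mul hB).add (.const 3)) |>.add
        (.const 1)) |>.add (.const 1))).add (.const 1))).add (.const 1)
  intro a ψ
  set G := Γ.val a with hG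
  set n := (N a).length with hn
  set S := iter (fun i s => h (a, i, s)) (s a) with hS
  have hlen : G.length = m := Γ.len a
  have e₀ : blk G [[]] = blk G [] := blk_pad G [] 1
  have h₁ := hs a ψ
  change Big _ (blk (G ++ [[]]) []) ψ _ (blk (G ++ [[]]) [s a]) ψ at h₁
  rw [blk_snoc, blk_snoc, e₀] at h₁
  have h₂ := hN a ψ
  change Big _ (blk (G ++ [[]] ++ [s a]) []) ψ _ (blk (G ++ [[]] ++ [s a]) [N a]) ψ at h₂
  rw [blk_snoc, blk_snoc, blk_snoc, blk_snoc] at h₂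
  have hb : ∀ i cnt, i + 1 + cnt.length = n → ∀ b, Big body (blk G [unary i, S i, b :: cnt]) ψ (D a)
      (blk G [unary (i + 1), S (i + 1), cnt]) ψ := by
    intro i cnt hi b
    have l₁ : (S i).length ≤ B a := hle a i (by omega)
    have l₂ : (S (i + 1)).length ≤ B a := hle a (i + 1) (by omega)
    have b₁ := Big.blk_pop hlen [unary i, S i, b :: cnt] ψ (i := 2) (by simp)
    have b₂ := hH ((a, i, S i), cnt) ψ
    change Big _ (blk (G ++ [unary i] ++ [S i] ++ [cnt]) []) ψ _
      (blk (G ++ [unary i] ++ [S i] ++ [cnt]) [S (i + 1)]) ψ at b₂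
    simp only [blk_snoc] at b₂
    rw [← blk_pad G [unary i, S i, cnt, S (i + 1)] 1] at b₂
    have b₃ := Big.blk_clear hlen [unary i, S i, cnt, S (i + 1), []] ψ (i := 1) (by simp)
    have b₄ := Big.blk_transfer hlen [unary i, [], cnt, S (i + 1), []] ψ (i := 3) (j := 1) (s := 4)
      (by simp) (by simp) (by simp) (by simp) (by simp) rfl
    have b₅ := Big.blk_push hlen [unary i, S (i + 1) ++ [], cnt, [], []] ψ (i := 0) (by simp) true
    have b := b₁.seq (b₂.seq (b₃.seq (b₄.seq b₅)))
    refine b.of_eq ?_ ?_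
    · rw [← blk_pad G [unary (i + 1), S (i + 1), cnt] 2]
      simp [List.replicate_succ]
    · have hsz := hp ((a, i, S i), cnt)
      have hsz' : (((Γ.loop.comap Prod.fst).push fun q => q.2).size
          (((a, i, S i), cnt) : (α × ℕ × List Bool) × List Bool)) =
          Γ.size a + i + (S i).length + cnt.length := by
        simp [Ctx.size, Ctx.push, Ctx.comap, Ctx.loop]
        ring
      rw [hsz'] at hsz
      have := hsz.trans (polynomial_eval_mono p
        (show _ ≤ Γ.size a + n + B a + n by omega))
      simp only [D, List.getD_cons_succ, List.getD_cons_zero, ← hn]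
      omega
  have hloop : ∀ k i cnt, cnt.length = k → i + k = n →
      Big (.loop (m + 2) body) (blk G [unary i, S i, cnt]) ψ (k * (D a + 1) + 1)
        (blk G [unary n, S n, []]) ψ := by
    intro k
    have hr : ∀ x y z, blk G [x, y, z] (m + 2) = z := by
      intro x y z
      rw [← hlen, blk_apply]
      rfl
    induction k with
    | zero =>
      intro i cnt hc hi
      obtain rfl := List.eq_nil_of_length_eq_zero hc
      obtain rfl : i = n := by omega
      exact (Big.loop_nil (hr _ _ _)).mono (by omega)
    | succ k ih =>
      intro i cnt hc hi
      rcases cnt with _ | ⟨b, cnt⟩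
      · simp at hc
      simp only [List.length_cons, Nat.add_right_cancel_iff] at hc
      refine (Big.loop_cons (by rw [hr]; simp) (hb i cnt (by omega) b)
        (ih (i + 1) cnt hc (by omega))).mono ?_
      have := Nat.add_one_mul k (D a + 1)
      omega
  have h₃ := hloop n 0 (N a) rfl (by omega)
  have h₄ := Big.blk_clear hlen [unary n, S n, []] ψ (i := 0) (by simp)
  have h₅ := Big.blk_transfer hlen [[], S n, []] ψ (i := 1) (j := 0) (s := 2) (by simp) (by simp)
    (by simp) (by simp) (by simp) rfl
  refine Big.of_eq (h₁.seq (h₂.seq (h₃.seq (h₄.seq h₅)))) ?_ ?_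
  · rw [← blk_pad G [S n] 2]
    simp [List.replicate_succ]
  · have l := hle a n le_rfl
    simp only [List.getD_cons_succ, List.getD_cons_zero]
    simp only [← hS] at l
    simp only [unary, List.length_replicate, ← hn]
    omega

theorem loop_state : FP Γ.loop fun p => p.2.2 := top

/-- The loop state is the string written so far. After `k` rounds it is at most `k` times as long as
the bound for one item, which supplies the `B` of `fold`. -/
theorem flatMap_range {N : α → List Bool} {h : α × ℕ → List Bool} (hN : FP Γ N)
    (hh : FP Γ.index h) :
    FP Γ fun a => (List.range (N a).length).flatMap fun i => h (a, i) := by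
  obtain ⟨p, hp⟩ := hh.1
  have e : ∀ a k, iter (fun i s => s ++ h (a, i)) [] k = (List.range k).flatMap fun i => h (a, i) := by
    intro a k
    induction k with
    | zero => rfl
    | succ k ih => rw [iter, ih, List.range_succ]; simp
  refine (fold (h := fun p : α × ℕ × List Bool => p.2.2 ++ h (p.1, p.2.1)) (s := fun _ => [])
    (B := fun a => (N a).length * p.eval (Γ.size a + (N a).length)) hN nil ?_
    (hN.1.mul ((PB.size.add hN.1).eval p)) ?_).congr fun a => e a _
  · exact loop_state.append ((hh.comap fun p : α × ℕ × List Bool => (p.1, p.2.1)).weaken fun p => p.2.2)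
  · intro a i hi
    have key : ∀ k ≤ (N a).length, ((List.range k).flatMap fun i => h (a, i)).length ≤
        k * p.eval (Γ.size a + (N a).length) := by
      intro k
      induction k with
      | zero => simp
      | succ k ih =>
        intro hk
        have h₁ := ih (by omega)
        have h₂ : (h (a, k)).length ≤ _ := hp (a, k)
        have h₃ : Γ.index.size (a, k) = Γ.size a + k := by simp [Ctx.index, Ctx.size, Ctx.push, Ctx.comap]
        rw [h₃] at h₂
        have h₄ := h₂.trans (polynomial_eval_mono p (show _ ≤ Γ.size a + (N a).length by omega))
        rw [List.range_succ, List.flatMap_append, List.length_append, Nat.succ_mul]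
        simp only [List.flatMap_cons, List.flatMap_nil, List.append_nil]
        omega
    simp only [e]
    exact (key i hi).trans (Nat.mul_le_mul_right _ hi)

theorem index_unary : FP Γ.index fun p => unary p.2 := top

theorem lift_index (hf : FP Γ f) : FP Γ.index fun p => f p.1 := (hf.comap Prod.fst).weaken _

theorem flatMap_list {ι : Type} (L : List ι) {h : ι → α → List Bool} (hh : ∀ x, FP Γ (h x)) :
    FP Γ fun a => L.flatMap fun x => h x a := by
  induction L with
  | nil => exact nil
  | cons x L ih => exact (hh x).append ih

theorem unary_length (hf : FP Γ f) : FP Γ fun a => unary (f a).length := by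
  refine (flatMap_range (h := fun _ => [true]) hf (const _)).congr fun a => ?_
  induction (f a).length with
  | zero => rfl
  | succ n ih => rw [List.range_succ, List.flatMap_append, ih, unary, unary, List.replicate_succ']; rfl

theorem add {n k : α → ℕ} (hn : FP Γ fun a => unary (n a)) (hk : FP Γ fun a => unary (k a)) :
    FP Γ fun a => unary (n a + k a) :=
  (hn.append hk).congr fun _ => List.replicate_append_replicate

theorem mul {n k : α → ℕ} (hn : FP Γ fun a => unary (n a)) (hk : FP Γ fun a => unary (k a)) :
    FP Γ fun a => unary (n a * k a) := by
  refine (flatMap_range (h := fun p => unary (k p.1)) hn hk.lift_index).congr fun a => ?_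
  simp only [unary, List.length_replicate]
  induction n a with
  | zero => simp
  | succ n ih =>
    rw [List.range_succ, List.flatMap_append, ih, Nat.succ_mul, List.replicate_add]
    simp

theorem nat (n : ℕ) : FP Γ fun _ => unary n := const _

theorem eval (p : Polynomial ℕ) {n : α → ℕ} (hn : FP Γ fun a => unary (n a)) :
    FP Γ fun a => unary (p.eval (n a)) := by
  induction p using Polynomial.induction_on' with
  | add p q hp hq => exact (hp.add hq).congr fun a => by rw [Polynomial.eval_add]
  | monomial i c =>
    have : FP Γ fun a => unary (n a ^ i) := by
      induction i with
      | zero => exact (nat 1).congr fun a => by simp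
      | succ i ih => exact (ih.mul hn).congr fun a => by rw [pow_succ]
    exact ((nat c).mul this).congr fun a => by rw [Polynomial.eval_monomial]

/-- Dropping a prefix. -/
theorem drop {n : α → ℕ} (hf : FP Γ f) (hn : FP Γ fun a => unary (n a)) :
    FP Γ fun a => (f a).drop (n a) := by
  have e : ∀ a k, iter (fun _ s => s.tail) (f a) k = (f a).drop k := by
    intro a k
    induction k with
    | zero => rfl
    | succ k ih => rw [iter, ih, List.tail_drop]
  refine (fold (h := fun p : α × ℕ × List Bool => p.2.2.tail) (B := fun a => (f a).length) hn hf ?_ hf.1 ?_).congr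
    fun a => ?_
  · exact loop_state.tail
  · intro a i _
    simp only [e]
    simp
  · simp only [e]
    simp

/-- The functions of machines in the sense of `PolyTimeComputable`. -/
theorem of_polyTimeComputable {F : List Bool → List Bool} (hF : PolyTimeComputable F)
    (hf : FP Γ f) : FP Γ fun a => F (f a) := by
  obtain ⟨c, p, hc, hp⟩ := hF
  obtain ⟨M, hM⟩ := exists_act_nil c
  obtain ⟨sf, d, U, hd, hU, hf⟩ := hf
  -- The machine is specified by a distribution; for a deterministic program this is a point mass,
  -- and comparing supports gives the actual final registers.
  have hrun : ∀ x, ∃ r' : Regs, dstep^[p.eval x.length] ([c], fun i => [x].getD i []) = ([], r') ∧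
      r' 0 = F x := by
    intro x
    obtain ⟨h₁, h₂⟩ := hp x
    have hr := run_deterministic noOracle (p.eval x.length) (q := [c]) (by simpa using hc)
      (fun i => [x].getD i []) (ket ∅)
    rw [HaltsWithin, start, hr] at h₁
    rw [output, start, hr, PMF.pure_map] at h₂
    refine ⟨_, Prod.ext (h₁ _ ((PMF.mem_support_pure_iff _ _).2 rfl)) rfl, ?_⟩
    have := congrArg PMF.support h₂
    rw [PMF.support_pure, PMF.support_pure] at this
    exact Set.singleton_injective this
  have hFlen : ∀ x, (F x).length ≤ x.length + p.eval x.length := by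
    intro x
    obtain ⟨r', h₁, h₂⟩ := hrun x
    have := dstep_length_le (p.eval x.length) ([c], fun i => [x].getD i []) 0
    rw [h₁, ← h₂] at *
    simpa using this
  let L : α → ℕ := fun a => (f a).length + p.eval (f a).length
  have hL : PB Γ L := sf.add (sf.eval p)
  -- The machine may leave garbage besides its output. Only registers below `M` are ever pushed on,
  -- so clearing those after its register `0` suffices.
  let clean : ℕ → Cmd := fun k => Nat.rec (.skip (Γ.m + M + 1)) (fun i c => .seq c (.clear (Γ.m + (i + 1)))) k
  have hclean : ∀ k, (clean k).IsDeterministic := fun k => by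
    induction k with
    | zero => exact Cmd.skip_isDeterministic _
    | succ k ih => exact ⟨ih, Cmd.clear_isDeterministic _⟩
  refine ⟨hL.of_le fun a => hFlen _, .seq d (.seq (c.rename fun i => i + Γ.m) (clean M)),
    fun a => U a + (L a + (M * (2 * L a + 2) + 3) + 1) + 1,
    ⟨hd, hc.rename _, hclean M⟩, ?_, ?_⟩
  · exact (hU.add ((hL.add (((PB.const M).mul (((PB.const 2).mul hL).add (.const 2))).add
      (.const 3))).add (.const 1))).add (.const 1)
  intro a ψ
  set G := Γ.val a with hG
  have hlen : G.length = Γ.m := Γ.len a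
  refine (hf a ψ).seq ?_
  obtain ⟨r', h₁, h₂⟩ := hrun (f a)
  have hbig : Big c (fun i => [f a].getD i []) ψ (p.eval (f a).length) r' ψ := by
    have := BigList.of_dstep _ (by simpa using hc) h₁ ψ
    obtain _ | ⟨b₁, b₂, l⟩ := this
    cases b₂
    exact b₁.mono (by omega)
  -- Shifting all registers by `Γ.m` makes the machine's register `0` the one that holds `f a`.
  obtain ⟨R, hR₁, hR₂, hR₃⟩ := hbig.rename (add_left_injective Γ.m) (blk G [f a]) (by
    funext j
    rw [add_comm, ← hlen, blk_apply])
  have hlen' : ∀ j, (r' j).length ≤ L a := by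
    intro j
    have := dstep_length_le (p.eval (f a).length) ([c], fun i => [f a].getD i []) j
    rw [h₁] at this
    refine this.trans (Nat.add_le_add_right ?_ _)
    rcases j with _ | j <;> simp
  have hR₁' : ∀ j, R (Γ.m + j) = r' j := fun j => by rw [add_comm, ← hR₁]
  have hcl : ∀ k, Big (clean k) R ψ (k * (2 * L a + 2) + 3)
      (fun i => if Γ.m < i ∧ i ≤ Γ.m + k then [] else R i) ψ := by
    intro k
    induction k with
    | zero =>
      refine (Big.skip _ R ψ).of_eq ?_ (by omega)
      funext i
      rw [if_neg (by omega)]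
    | succ k ih =>
      refine Big.of_eq (ih.seq (Big.clear (Γ.m + (k + 1)) _ ψ)) ?_ ?_
      · funext i
        simp only [Function.update_apply]
        split_ifs <;> first | rfl | omega
      · rw [if_neg (by omega), hR₁']
        have := hlen' (k + 1)
        have := Nat.add_one_mul k (2 * L a + 2)
        omega
  refine (hR₃.seq (hcl M)).of_eq ?_ (by have : p.eval (f a).length ≤ L a := Nat.le_add_left _ _
                                        omega)
  funext i
  rcases lt_or_ge i Γ.m with hi | hi
  · rw [if_neg (by omega), hR₂, blk_lt _ (by omega), blk_lt _ (by omega)]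
    rintro ⟨j, hj⟩
    simp only at hj
    omega
  · obtain ⟨j, rfl⟩ := Nat.exists_eq_add_of_le hi
    rw [hR₁']
    conv_rhs => rw [← hlen, blk_apply]
    rcases j with _ | j
    · rw [if_neg (by omega), h₂]
      rfl
    · split_ifs with hj
      · simp
      · have := dstep_eq_nil hM (s := ([c], fun i => [f a].getD i []))
          (.inr (self_mem_conts c [])) (i := j + 1) (by omega) (by simp) (p.eval (f a).length)
        rw [h₁] at this
        rw [show r' (j + 1) = [] from this]
        simp

end FP

/-! ### Clauses over numbered variables -/

/-- Clauses whose variables are natural numbers. -/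
abbrev Clauses := List (List (ℕ × Bool))

def Clauses.Sat (a : ℕ → Bool) (ψ : Clauses) : Prop := ∀ c ∈ ψ, ∃ l ∈ c, a l.1 = l.2

theorem Clauses.sat_append {a : ℕ → Bool} {ψ χ : Clauses} :
    Clauses.Sat a (ψ ++ χ) ↔ ψ.Sat a ∧ χ.Sat a := by
  simp [Clauses.Sat, or_imp, forall_and]

theorem Clauses.sat_flatMap {ι : Type} {a : ℕ → Bool} {L : List ι} {f : ι → Clauses} :
    Clauses.Sat a (L.flatMap f) ↔ ∀ x ∈ L, (f x).Sat a := by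
  simp only [Clauses.Sat, List.mem_flatMap]
  exact ⟨fun h x hx c hc => h c ⟨x, hx, hc⟩, fun h c ⟨x, hx, hc⟩ => h x hx c hc⟩

open Classical in
/-- The constraint `P` on the variables `e k`, by its truth table. -/
def gadget {ι : Type} [Fintype ι] (P : (ι → Bool) → Prop) (e : ι → ℕ) : Clauses :=
  (Finset.univ.filter fun β => ¬ P β).toList.map fun β =>
    (Finset.univ : Finset ι).toList.map fun k => (e k, !β k)

/-- Every forbidden assignment `β` contributes the one clause that is violated exactly by `β`. -/
theorem sat_gadget {ι : Type} [Fintype ι] {P : (ι → Bool) → Prop} {e : ι → ℕ} {a : ℕ → Bool} :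
    (gadget P e).Sat a ↔ P fun k => a (e k) := by
  classical
  simp only [Clauses.Sat, gadget, List.mem_map, Finset.mem_toList, Finset.mem_filter,
    Finset.mem_univ, true_and, forall_exists_index, and_imp, forall_apply_eq_imp_iff₂,
    exists_exists_eq_and]
  constructor
  · intro h
    by_contra hP
    obtain ⟨k, hk⟩ := h _ hP
    simp at hk
  · intro hP β hβ
    by_contra! h
    refine hβ ?_
    convert hP with k
    simpa using (h k).symm

theorem mem_gadget {ι : Type} [Fintype ι] {P : (ι → Bool) → Prop} {e : ι → ℕ} {N : ℕ}
    (he : ∀ k, e k < N) : ∀ c ∈ gadget P e, ∀ l ∈ c, l.1 < N := by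
  classical
  intro c hc l hl
  simp only [gadget, List.mem_map] at hc
  obtain ⟨β, -, rfl⟩ := hc
  simp only [List.mem_map] at hl
  obtain ⟨k, -, rfl⟩ := hl
  exact he k

/-! ### Existentially quantified formulas -/

theorem quantify_ex (qs : List Quantifier) (hq : ∀ q ∈ qs, q = .ex)
    (P : (Fin qs.length → Bool) → Prop) : quantify qs P ↔ ∃ a, P a := by
  induction qs with
  | nil =>
    refine ⟨fun h => ⟨_, h⟩, fun ⟨a, h⟩ => ?_⟩
    rwa [show a = Fin.elim0 from funext fun i => i.elim0] at h
  | cons q qs ih =>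
    obtain rfl := hq q (by simp)
    simp only [quantify, ih fun q h => hq q (by simp [h])]
    constructor
    · rintro ⟨b, a, h⟩
      exact ⟨_, h⟩
    · rintro ⟨a, h⟩
      exact ⟨a 0, Fin.tail a, by rwa [Fin.cons_self_tail]⟩

/-- The existential closure of clauses whose variables are less than `N + 1`. -/
def exQBF (N : ℕ) (ψ : Clauses) : QBF where
  quants := List.replicate (N + 1) .ex
  matrix := ψ.map fun c => c.map fun l =>
    (⟨l.1 % (N + 1), by rw [List.length_replicate]; exact Nat.mod_lt _ N.succ_pos⟩, l.2)

/-- Under the bound on the variables the reduction modulo `N + 1` in `exQBF` changes nothing; an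
assignment to the quantified variables is extended by `false`. -/
theorem exQBF_isTrue {N : ℕ} {ψ : Clauses} (hψ : ∀ c ∈ ψ, ∀ l ∈ c, l.1 < N + 1) :
    (exQBF N ψ).IsTrue ↔ ∃ a, ψ.Sat a := by
  rw [QBF.IsTrue, quantify_ex (exQBF N ψ).quants fun q hq => List.eq_of_mem_replicate hq]
  have hlen : (exQBF N ψ).quants.length = N + 1 := List.length_replicate
  have key : ∀ (a : Fin (exQBF N ψ).quants.length → Bool) (a' : ℕ → Bool),
      (∀ i : Fin (exQBF N ψ).quants.length, a i = a' i) →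
      ((exQBF N ψ).matrix.Holds a ↔ ψ.Sat a') := by
    intro a a' h
    have h' : ∀ c ∈ ψ, ∀ l ∈ c, ∀ hl : l.1 % (N + 1) < (exQBF N ψ).quants.length,
        a ⟨l.1 % (N + 1), hl⟩ = a' l.1 := fun c hc l hl _ => by
      rw [h]
      simp only [Nat.mod_eq_of_lt (hψ c hc l hl)]
    refine List.forall_mem_map.trans (forall₂_congr fun c hc => ?_)
    constructor
    · rintro ⟨l, hl, e⟩
      obtain ⟨l, hl', rfl⟩ := List.mem_map.1 hl
      exact ⟨l, hl', (h' c hc l hl' _).symm.trans e⟩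
    · rintro ⟨l, hl, e⟩
      exact ⟨_, List.mem_map_of_mem hl, (h' c hc l hl _).trans e⟩
  constructor
  · rintro ⟨a, h⟩
    refine ⟨fun i => if hi : i < (exQBF N ψ).quants.length then a ⟨i, hi⟩ else false,
      (key a _ fun i => by simp).1 h⟩
  · rintro ⟨a, h⟩
    exact ⟨fun i => a i, (key _ a fun _ => rfl).2 h⟩

/-- The code of a list of clauses, up to the end mark. -/
def Clauses.code (ψ : Clauses) : List Bool :=
  ψ.flatMap fun c => true :: encodeList (fun l => l.2 :: encodeNat l.1) c

/-- Written in this form the code is a concatenation that `FP` can produce: each `[true, true]` is a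
list mark followed by the code of `∃`. -/
theorem exQBF_encode {N : ℕ} {ψ : Clauses} (hψ : ∀ c ∈ ψ, ∀ l ∈ c, l.1 < N + 1) :
    (exQBF N ψ).encode =
      (List.replicate (N + 1) [true, true]).flatten ++ ([false] ++ (ψ.code ++ [false])) := by
  have h₁ : encodeList Quantifier.encode (exQBF N ψ).quants =
      (List.replicate (N + 1) [true, true]).flatten ++ [false] := by
    simp [encodeList, exQBF, List.flatMap, Quantifier.encode]
  have h₂ : encodeList (encodeList fun l => l.2 :: encodeNat l.1) (exQBF N ψ).matrix =
      ψ.code ++ [false] := by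
    simp only [encodeList, exQBF, Clauses.code, List.flatMap_map, List.append_left_inj]
    refine List.flatMap_congr fun c hc => ?_
    simp only [List.cons.injEq, true_and, List.append_left_inj]
    refine List.flatMap_congr fun l hl => ?_
    simp only [Nat.mod_eq_of_lt (hψ c hc l hl)]
  rw [QBF.encode, h₁, h₂, List.append_assoc]

/-! ### The tableau of a deterministic computation -/

section Tableau
variable (c : Cmd) (M : ℕ)

/-- A column of the tableau at one time: the control state, whether it is the first column, and one
symbol of each of the registers `0`, …, `M`. -/
abbrev Cell : Type := ctlStates c × Bool × (Fin (M + 1) → Option Bool)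

instance : Finite (ctlStates c) := (ctlStates_finite c).to_subtype

instance : Fintype (Cell c M) := Fintype.ofFinite _

variable {c M}

open Classical in
def onehot (s : Cell c M) : Cell c M → Bool := fun s' => decide (s' = s)

theorem onehot_injective : Function.Injective (onehot (c := c) (M := M)) := by
  intro s s' h
  have := congrFun h s
  simpa [onehot] using this

/-- The local transition rule, given the first column, the left neighbour, the column itself and
the right neighbour. -/
def cellStep (h l s r : Cell c M) : Cell c M :=
  (⟨ctl h.1 fun i => if hi : i < M + 1 then h.2.2 ⟨i, hi⟩ else none,
      ctl_mem_ctlStates h.1.2 _⟩, s.2.1, fun i =>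
    match h.1.1 with
    | .push j b :: _ => if i = j then (if s.2.1 then some b else l.2.2 i) else s.2.2 i
    | .pop j :: _ => if i = j then r.2.2 i else s.2.2 i
    | _ => s.2.2 i)

variable (c) in
/-- The initial configuration of `c` on the input `x`. -/
def dstart (x : List Bool) : List Cmd × Regs := ([c], fun i => [x].getD i [])

theorem dstart_mem (x : List Bool) : (dstart c x).1 ∈ ctlStates c := .inr (self_mem_conts c [])

/-- Column `j` of a configuration. -/
def cellOf (s : List Cmd × Regs) (hs : s.1 ∈ ctlStates c) (j : ℕ) : Cell c M :=
  (⟨s.1, hs⟩, decide (j = 0), fun i => (s.2 i)[j]?)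

/-- A push moves a register one column to the right and a pop one to the left, while the control
reads only the tops, in column `0`. For `j = 0` the truncated `j - 1` is harmless, because the
first-column flag makes a push ignore the left neighbour. -/
theorem cellOf_dstep (s : List Cmd × Regs) (hs : s.1 ∈ ctlStates c)
    (hnil : ∀ i, M + 1 ≤ i → s.2 i = []) (j : ℕ) :
    cellOf (M := M) (dstep s) (ctl_mem_ctlStates hs _) j =
      cellStep (cellOf s hs 0) (cellOf s hs (j - 1)) (cellOf s hs j) (cellOf s hs (j + 1)) := by
  obtain ⟨q, r⟩ := s
  refine Prod.ext (Subtype.ext ?_) (Prod.ext rfl (funext fun i => ?_))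
  · simp only [dstep, cellOf, cellStep]
    congr 1
    funext i
    split_ifs with hi
    · exact List.head?_eq_getElem?
    · rw [show r i = [] from hnil i (by omega)]
      rfl
  · simp only [dstep, cellOf, cellStep]
    rcases q with _ | ⟨_ | _, _⟩
    case cons.push k i' b =>
      simp only [act]
      split_ifs with h₁ h₂
      · simp only [decide_eq_true_eq] at h₂
        simp [h₂]
      · simp only [decide_eq_true_eq] at h₂
        obtain ⟨j, rfl⟩ := Nat.exists_eq_succ_of_ne_zero h₂
        simp
      · rfl
    case cons.pop k i' =>
      simp only [act]
      split_ifs with h₁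
      · simp
      · rfl
    all_goals rfl

variable (c M) in
/-- Column `j` at time `t` of the computation of `c` on the input `x`. -/
def cellAt (x : List Bool) (t j : ℕ) : Cell c M :=
  cellOf (dstep^[t] (dstart c x)) (dstep_mem_ctlStates t (dstart_mem x)) j

theorem cellAt_succ (hM : ∀ q ∈ ctlStates c, ∀ i ≥ M + 1, act q i [] = []) (x : List Bool)
    (t j : ℕ) : cellAt c M x (t + 1) j =
      cellStep (cellAt c M x t 0) (cellAt c M x t (j - 1)) (cellAt c M x t j)
        (cellAt c M x t (j + 1)) := by
  have hnil : ∀ i, M + 1 ≤ i → (dstep^[t] (dstart c x)).2 i = [] := fun i hi =>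
    dstep_eq_nil hM (dstart_mem x) hi (by
      rcases i with _ | i
      · omega
      · simp [dstart]) t
  have e := Function.iterate_succ_apply' dstep t (dstart c x)
  have := cellOf_dstep (M := M) _ (dstep_mem_ctlStates t (dstart_mem x)) hnil j
  simp only [cellAt, e]
  exact this

end Tableau

/-! ### The formula of a computation -/

theorem FP.cases_eq_head? {γ : Type} (l : List Bool) (x y z : γ) :
    FP.cases l x y z = l.head?.elim z fun b => if b then x else y := by
  rcases l with _ | ⟨_ | _, l⟩ <;> rfl

theorem FP.cases_drop {γ : Type} (l : List Bool) (j : ℕ) (x y z : γ) :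
    FP.cases (l.drop j) x y z = l[j]?.elim z fun b => if b then x else y := by
  rw [FP.cases_eq_head?, List.head?_drop]

theorem FP.apply_cases {γ δ : Type} (F : γ → δ) (l : List Bool) (x y z : γ) :
    F (FP.cases l x y z) = FP.cases l (F x) (F y) (F z) := by
  rcases l with _ | ⟨_ | _, l⟩ <;> rfl

section Tableau
variable {c : Cmd} {M : ℕ}

variable (c M) in
/-- The number of the variable for the symbol `s` in column `q`, counted through all rows. -/
def cellVar (q : ℕ) (s : Cell c M) : ℕ := q * Fintype.card (Cell c M) + Fintype.equivFin _ s

variable (c M) in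
/-- The decoding of variable numbers. -/
def tableauAssignment (W : ℕ) (x : List Bool) (v : ℕ) : Bool :=
  if h : 0 < Fintype.card (Cell c M) then
    onehot (cellAt c M x (v / Fintype.card (Cell c M) / (W + 1))
      (v / Fintype.card (Cell c M) % (W + 1)))
      ((Fintype.equivFin _).symm ⟨v % Fintype.card (Cell c M), Nat.mod_lt _ h⟩)
  else false

/-- Variables are numbered in mixed radix by row, column and symbol; `j ≤ W` makes division with
remainder recover row and column. -/
theorem tableauAssignment_cellVar {W : ℕ} (x : List Bool) (t : ℕ) {j : ℕ} (hj : j ≤ W) :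
    (fun s => tableauAssignment c M W x (cellVar c M (t * (W + 1) + j) s)) =
      onehot (cellAt c M x t j) := by
  funext s
  have hB : 0 < Fintype.card (Cell c M) := Fintype.card_pos_iff.2 ⟨s⟩
  have hs := (Fintype.equivFin (Cell c M) s).2
  have h₁ : cellVar c M (t * (W + 1) + j) s / Fintype.card (Cell c M) = t * (W + 1) + j := by
    rw [cellVar, mul_comm, Nat.mul_add_div hB, Nat.div_eq_of_lt hs, add_zero]
  have h₂ : cellVar c M (t * (W + 1) + j) s % Fintype.card (Cell c M) = Fintype.equivFin _ s := by
    rw [cellVar, mul_comm, Nat.mul_add_mod, Nat.mod_eq_of_lt hs]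
  have h₃ : (t * (W + 1) + j) / (W + 1) = t := by
    rw [mul_comm, Nat.mul_add_div (by omega), Nat.div_eq_of_lt (by omega), add_zero]
  have h₄ : (t * (W + 1) + j) % (W + 1) = j := by
    rw [mul_comm, Nat.mul_add_mod, Nat.mod_eq_of_lt (by omega)]
  simp only [tableauAssignment, hB, dif_pos, h₁, h₂, h₃, h₄, Fin.eta, Equiv.symm_apply_apply]

/-- The symbols that may stand in place `j` of a string of length `n` with prefix `u`. -/
def allowedSymbols (n : ℕ) (u : List Bool) (j : ℕ) : Set (Option Bool) :=
  FP.cases (u.drop j) {some true} {some false}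
    (FP.cases ((unary n).drop j) {some true, some false} ∅ {none})

theorem getElem?_mem_allowedSymbols {u x : List Bool} (h : u <+: x) (j : ℕ) :
    x[j]? ∈ allowedSymbols x.length u j := by
  rw [allowedSymbols, FP.cases_drop, FP.cases_drop]
  rcases lt_or_ge j u.length with hj | hj
  · rw [List.prefix_iff_getElem?.1 h j hj, List.getElem?_eq_getElem hj]
    cases u[j] <;> simp
  · rw [List.getElem?_eq_none hj]
    rcases lt_or_ge j x.length with hj' | hj'
    · have : (unary x.length)[j]? = some true := by simp [unary, hj']
      rw [this, List.getElem?_eq_getElem hj']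
      cases x[j] <;> simp
    · have : (unary x.length)[j]? = none := by simp [unary, hj']
      rw [this, List.getElem?_eq_none hj']
      simp

theorem exists_of_allowedSymbols {n W : ℕ} {u : List Bool} (hu : u.length ≤ n) (hn : n ≤ W)
    {v : ℕ → Option Bool} (hv : ∀ j ≤ W, v j ∈ allowedSymbols n u j) :
    ∃ x : List Bool, x.length = n ∧ u <+: x ∧ ∀ j ≤ W, x[j]? = v j := by
  -- The default is never used: below `n` the allowed symbols are bits.
  refine ⟨List.ofFn fun j : Fin n => (v j).getD false, by simp, ?_, fun j hj => ?_⟩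
  · rw [List.prefix_iff_getElem?]
    intro i hi
    have := hv i (by omega)
    rw [allowedSymbols, FP.cases_drop, List.getElem?_eq_getElem hi] at this
    rw [List.getElem?_ofFn, dif_pos (by omega)]
    revert this
    cases u[i] <;> simp +contextual
  · have := hv j hj
    rw [allowedSymbols, FP.cases_drop, FP.cases_drop] at this
    rw [List.getElem?_ofFn]
    split_ifs with h
    · rcases hv' : v j with _ | b
      · rw [hv'] at this
        rcases lt_or_ge j u.length with hj | hj
        · rw [List.getElem?_eq_getElem hj] at this
          revert this
          cases u[j] <;> simp
        · rw [List.getElem?_eq_none hj] at this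
          simp [h] at this
      · simp
    · rw [List.getElem?_eq_none (by omega)] at this
      have h' : (unary n)[j]? = none := by simp [unary]; omega
      rw [h'] at this
      simpa using this.symm

/-- A column at time `0`. -/
def IsInitial (z : Bool) (A : Set (Option Bool)) (β : Cell c M → Bool) : Prop :=
  ∃ v ∈ A, β = onehot (⟨[c], .inr (self_mem_conts c [])⟩, z, fun i => if i = 0 then v else none)

/-- Four columns at one time and one column at the next. -/
def IsTransition (β : Fin 5 × Cell c M → Bool) : Prop :=
  ∃ h l s r : Cell c M, (fun x => β (0, x)) = onehot h ∧ (fun x => β (1, x)) = onehot l ∧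
    (fun x => β (2, x)) = onehot s ∧ (fun x => β (3, x)) = onehot r ∧
    (fun x => β (4, x)) = onehot (cellStep h l s r)

/-- A column with symbol `v` in register `0`. -/
def IsFinal (v : Option Bool) (β : Cell c M → Bool) : Prop :=
  ∃ s : Cell c M, β = onehot s ∧ s.2.2 0 = v

/-- The columns to which the transition rule is applied. -/
def transIndex (W t j : ℕ) (k : Fin 5) : ℕ :=
  match k with
  | 0 => t * (W + 1) + 0
  | 1 => t * (W + 1) + (j - 1)
  | 2 => t * (W + 1) + j
  | 3 => t * (W + 1) + (j + 1)
  | 4 => (t + 1) * (W + 1) + j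

variable (c M) in
def initClauses (n W : ℕ) (u : List Bool) : Clauses :=
  (List.range (W + 1)).flatMap fun j =>
    gadget (IsInitial (FP.cases (unary j) false false true) (allowedSymbols n u j)) (cellVar c M j)

variable (c M) in
def transClauses (T W : ℕ) : Clauses :=
  (List.range T).flatMap fun t => (List.range W).flatMap fun j =>
    gadget IsTransition fun k => cellVar c M (transIndex W t j k.1) k.2

variable (c M) in
def finalClauses (T W : ℕ) (y : List Bool) : Clauses :=
  (List.range (y.length + 1)).flatMap fun j =>
    gadget (IsFinal (FP.cases (y.drop j) (some true) (some false) none))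
      (cellVar c M (T * (W + 1) + j))

variable (c M) in
/-- The computation of `c` on some input of length `n` with prefix `u` yields `y` after `T` steps. -/
def tableau (n T W : ℕ) (u y : List Bool) : Clauses :=
  initClauses c M n W u ++ (transClauses c M T W ++ finalClauses c M T W y)

theorem cases_drop_eq_getElem? (y : List Bool) (j : ℕ) :
    FP.cases (y.drop j) (some true) (some false) none = y[j]? := by
  rw [FP.cases_drop]
  rcases y[j]? with _ | _ | _ <;> rfl

theorem cases_unary (j : ℕ) : FP.cases (unary j) false false true = decide (j = 0) := by
  cases j <;> rfl

theorem cellAt_zero (x : List Bool) (j : ℕ) :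
    cellAt c M x 0 j =
      (⟨[c], .inr (self_mem_conts c [])⟩, decide (j = 0), fun i => if i = 0 then x[j]? else none) := by
  refine Prod.ext rfl (Prod.ext rfl (funext fun i => ?_))
  simp only [cellAt, cellOf, Function.iterate_zero, id, dstart]
  split_ifs with h
  · subst h; rfl
  · obtain ⟨k, hk⟩ := Nat.exists_eq_succ_of_ne_zero (fun h' => h (Fin.ext h'))
    rw [hk]
    simp

/-- The first row encodes some input with prefix `u`, and the transition rule forces every later
row. The last column has no right neighbour, so one column is lost per step; `W` is so large that
the columns needed for the output survive `T` steps. -/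
theorem tableau_sat {n T W : ℕ} {u y : List Bool} {F : List Bool → List Bool}
    (hM : ∀ q ∈ ctlStates c, ∀ i ≥ M + 1, act q i [] = [])
    (hF : ∀ x, x.length = n → (dstep^[T] (dstart c x)).2 0 = F x)
    (hu : u.length ≤ n) (hW : T + n + y.length + 1 ≤ W) :
    (∃ a, (tableau c M n T W u y).Sat a) ↔ ∃ x, x.length = n ∧ u <+: x ∧ F x = y := by
  simp only [tableau, initClauses, transClauses, finalClauses, Clauses.sat_append,
    Clauses.sat_flatMap, sat_gadget, List.mem_range, cases_drop_eq_getElem?, cases_unary]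
  constructor
  · rintro ⟨a, hI, hT, hE⟩
    choose! v hv hv' using fun j (hj : j ≤ W) => hI j (Nat.lt_succ_of_le hj)
    obtain ⟨x, hx, hux, hxv⟩ := exists_of_allowedSymbols hu (by omega) hv
    refine ⟨x, hx, hux, ?_⟩
    -- Row `t` is determined only on the triangle `j + t ≤ W`: the column below `(t + 1, j)` and its
    -- right neighbour still lie in the triangle for `t`.
    have key : ∀ t ≤ T, ∀ j, j + t ≤ W →
        (fun s => a (cellVar c M (t * (W + 1) + j) s)) = onehot (cellAt c M x t j) := by
      intro t
      induction t with
      | zero =>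
        intro _ j hj
        rw [cellAt_zero, hxv j (by omega), zero_mul, zero_add]
        exact hv' j (by omega)
      | succ t ih =>
        intro ht j hj
        obtain ⟨h, l, s, r, h₁, h₂, h₃, h₄, h₅⟩ := hT t (by omega) j (by omega)
        obtain rfl := onehot_injective (h₁.symm.trans (ih (by omega) 0 (by omega)))
        obtain rfl := onehot_injective (h₂.symm.trans (ih (by omega) (j - 1) (by omega)))
        obtain rfl := onehot_injective (h₃.symm.trans (ih (by omega) j (by omega)))
        obtain rfl := onehot_injective (h₄.symm.trans (ih (by omega) (j + 1) (by omega)))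
        rw [cellAt_succ hM]
        exact h₅
    have hget : ∀ j ≤ y.length, (F x)[j]? = y[j]? := by
      intro j hj
      obtain ⟨s, hs, hs'⟩ := hE j (by omega)
      obtain rfl := onehot_injective (hs.symm.trans (key T le_rfl j (by omega)))
      rw [← hs', ← hF x hx]
      rfl
    -- The final clauses include column `y.length`, whose blank excludes a longer output.
    have hlen : (F x).length ≤ y.length := by
      have := hget y.length le_rfl
      rw [List.getElem?_eq_none le_rfl] at this
      exact List.getElem?_eq_none_iff.1 this
    refine List.ext_getElem? fun j => ?_
    rcases le_or_gt j y.length with hj | hj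
    · exact hget j hj
    · rw [List.getElem?_eq_none (by omega), List.getElem?_eq_none (by omega)]
  · rintro ⟨x, rfl, hux, hxy⟩
    refine ⟨tableauAssignment c M W x, fun j hj => ?_, fun t ht j hj => ?_, fun j hj => ?_⟩
    · refine ⟨x[j]?, getElem?_mem_allowedSymbols hux j, ?_⟩
      have := tableauAssignment_cellVar (c := c) (M := M) x 0 (Nat.le_of_lt_succ hj)
      rwa [zero_mul, zero_add, cellAt_zero] at this
    · refine ⟨_, _, _, _, tableauAssignment_cellVar x t (Nat.zero_le _),
        tableauAssignment_cellVar x t (by omega), tableauAssignment_cellVar x t hj.le,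
        tableauAssignment_cellVar x t hj, ?_⟩
      rw [← cellAt_succ hM]
      exact tableauAssignment_cellVar x (t + 1) hj.le
    · refine ⟨_, tableauAssignment_cellVar x T (by omega), ?_⟩
      rw [← hxy, ← hF x rfl]
      rfl

theorem cellVar_lt {T W t j : ℕ} (ht : t ≤ T) (hj : j ≤ W) (s : Cell c M) :
    cellVar c M (t * (W + 1) + j) s < (T + 1) * (W + 1) * Fintype.card (Cell c M) + 1 := by
  have hs := (Fintype.equivFin (Cell c M) s).2
  have h₁ : t * (W + 1) + j + 1 ≤ (T + 1) * (W + 1) := by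
    have := Nat.mul_le_mul_right (W + 1) ht
    rw [Nat.add_one_mul]
    omega
  have h₂ := Nat.mul_le_mul_right (Fintype.card (Cell c M)) h₁
  rw [Nat.add_one_mul] at h₂
  simp only [cellVar]
  omega

theorem tableau_lt {n T W : ℕ} {u y : List Bool} (hW : y.length ≤ W) :
    ∀ d ∈ tableau c M n T W u y, ∀ l ∈ d,
      l.1 < (T + 1) * (W + 1) * Fintype.card (Cell c M) + 1 := by
  intro d hd
  simp only [tableau, initClauses, transClauses, finalClauses, List.mem_append, List.mem_flatMap,
    List.mem_range] at hd
  rcases hd with ⟨j, hj, hd⟩ | ⟨t, ht, j, hj, hd⟩ | ⟨j, hj, hd⟩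
  · refine mem_gadget (fun s => ?_) d hd
    have := cellVar_lt (T := T) (t := 0) (Nat.zero_le _) (Nat.le_of_lt_succ hj) s
    rwa [zero_mul, zero_add] at this
  · refine mem_gadget (fun s => ?_) d hd
    obtain ⟨k, s⟩ := s
    match k with
    | 0 => exact cellVar_lt ht.le (Nat.zero_le _) s
    | 1 => exact cellVar_lt ht.le (by omega) s
    | 2 => exact cellVar_lt ht.le hj.le s
    | 3 => exact cellVar_lt ht.le hj s
    | 4 => exact cellVar_lt ht hj.le s
  · exact mem_gadget (fun s => cellVar_lt le_rfl (by omega) s) d hd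

end Tableau

/-! ### The formula is computable in polynomial time -/

theorem Clauses.code_append (ψ χ : Clauses) : Clauses.code (ψ ++ χ) = ψ.code ++ χ.code := by
  simp [Clauses.code]

theorem Clauses.code_flatMap {ι : Type} (L : List ι) (f : ι → Clauses) :
    Clauses.code (L.flatMap f) = L.flatMap fun x => (f x).code := List.flatMap_assoc

namespace FP
variable {α : Type} {Γ : Ctx α}

theorem flatMap_nat {n : α → ℕ} {h : α × ℕ → List Bool} (hn : FP Γ fun a => unary (n a))
    (hh : FP Γ.index h) : FP Γ fun a => (List.range (n a)).flatMap fun i => h (a, i) :=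
  (flatMap_range hn hh).congr fun a => by rw [List.length_replicate]

/-- For fixed `P` the truth table has fixed size and is hard-wired into the program; only the
variable numbers are computed from the data. -/
theorem code_gadget {ι : Type} [Fintype ι] (P : (ι → Bool) → Prop) {e : α → ι → ℕ}
    (he : ∀ k, FP Γ fun a => unary (e a k)) : FP Γ fun a => (gadget P (e a)).code := by
  classical
  have h₁ : ∀ β : ι → Bool, FP Γ fun a => true ::
      ((Finset.univ : Finset ι).toList.flatMap (fun k => true :: (!β k) :: (unary (e a k) ++ [false]))
        ++ [false]) := fun β =>
    ((flatMap_list _ fun k => (((he k).append (const _)).cons _).cons _).append (const _)).cons _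
  refine (flatMap_list (Finset.univ.filter fun β => ¬ P β).toList h₁).congr fun a => ?_
  simp [Clauses.code, gadget, List.flatMap_map, encodeList, encodeNat]

theorem cellVar {c : Cmd} {M : ℕ} {q : α → ℕ} (hq : FP Γ fun a => unary (q a)) (s : Cell c M) :
    FP Γ fun a => unary (cellVar c M (q a) s) :=
  (hq.mul (nat _)).add (nat _)

theorem code_transClauses (c : Cmd) (M : ℕ) {T W : α → ℕ} (hT : FP Γ fun a => unary (T a))
    (hW : FP Γ fun a => unary (W a)) : FP Γ fun a => (transClauses c M (T a) (W a)).code := by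
  have hW' : FP Γ.index.index fun p => unary (W p.1.1 + 1) :=
    (hW.add (nat 1)).lift_index.lift_index
  have ht : FP Γ.index.index fun p => unary p.1.2 := index_unary.lift_index
  have hj : FP Γ.index.index fun p => unary p.2 := index_unary
  have hk : ∀ k, FP Γ.index.index fun p => unary (transIndex (W p.1.1) p.1.2 p.2 k) := by
    intro k
    match k with
    | 0 => exact (ht.mul hW').add (nat 0)
    | 1 => exact (ht.mul hW').add (hj.tail.congr fun p => by simp [unary])
    | 2 => exact (ht.mul hW').add hj
    | 3 => exact (ht.mul hW').add (hj.add (nat 1))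
    | 4 => exact ((ht.add (nat 1)).mul hW').add hj
  have h₁ : FP Γ.index.index fun p => (gadget (IsTransition (c := c) (M := M)) fun k =>
      TQBFVerification.cellVar c M (transIndex (W p.1.1) p.1.2 p.2 k.1) k.2).code :=
    code_gadget _ fun k => (hk k.1).cellVar k.2
  have h₂ := flatMap_nat hW.lift_index h₁
  refine (flatMap_nat hT h₂).congr fun a => ?_
  simp only [transClauses, Clauses.code_flatMap]

theorem code_tableau (c : Cmd) (M : ℕ) {n T W : α → ℕ} {u y : α → List Bool}
    (hn : FP Γ fun a => unary (n a)) (hT : FP Γ fun a => unary (T a))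
    (hW : FP Γ fun a => unary (W a)) (hu : FP Γ u) (hy : FP Γ y) :
    FP Γ fun a => (tableau c M (n a) (T a) (W a) (u a) (y a)).code := by
  have hW₁ : FP Γ fun a => unary (W a + 1) := hW.add (nat 1)
  have h₁ : FP Γ fun a => (initClauses c M (n a) (W a) (u a)).code := by
    simp only [initClauses, Clauses.code_flatMap]
    refine flatMap_nat (h := fun p => (gadget (IsInitial (FP.cases (unary p.2) false false true)
      (allowedSymbols (n p.1) (u p.1) p.2)) (TQBFVerification.cellVar c M p.2)).code) hW₁ ?_
    -- The constraint varies with the column, but takes only finitely many values; each is a fixed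
    -- gadget, and the program branches among them.
    have hg : ∀ z A, FP Γ.index fun p =>
        (gadget (IsInitial z A) (TQBFVerification.cellVar c M p.2)).code := fun z A =>
      code_gadget _ fun s => index_unary.cellVar s
    have hA : ∀ z, FP Γ.index fun p => (gadget (IsInitial z
        (allowedSymbols (n p.1) (u p.1) p.2)) (TQBFVerification.cellVar c M p.2)).code := fun z => by
      refine ((hu.lift_index.drop index_unary).branch (hg z {some true}) (hg z {some false})
        ((hn.lift_index.drop index_unary).branch (hg z {some true, some false}) (hg z ∅)
          (hg z {none}))).congr fun p => ?_
      rw [allowedSymbols, apply_cases (fun A => (gadget (IsInitial z A)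
        (TQBFVerification.cellVar c M p.2)).code), apply_cases (fun A => (gadget (IsInitial z A)
        (TQBFVerification.cellVar c M p.2)).code)]
    refine (index_unary.branch (hA false) (hA false) (hA true)).congr fun p => ?_
    rw [apply_cases (fun z => (gadget (IsInitial z (allowedSymbols (n p.1) (u p.1) p.2))
      (TQBFVerification.cellVar c M p.2)).code)]
  have h₂ := code_transClauses c M hT hW
  have h₃ : FP Γ fun a => (finalClauses c M (T a) (W a) (y a)).code := by
    simp only [finalClauses, Clauses.code_flatMap]
    refine flatMap_nat (h := fun p => (gadget (IsFinal (FP.cases ((y p.1).drop p.2) (some true)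
      (some false) none)) (TQBFVerification.cellVar c M (T p.1 * (W p.1 + 1) + p.2))).code)
      (hy.unary_length.add (nat 1)) ?_
    have hg : ∀ v, FP Γ.index fun p => (gadget (IsFinal v)
        (TQBFVerification.cellVar c M (T p.1 * (W p.1 + 1) + p.2))).code := fun v =>
      code_gadget _ fun s => (((hT.lift_index).mul hW₁.lift_index).add index_unary).cellVar s
    refine ((hy.lift_index.drop index_unary).branch (hg (some true)) (hg (some false))
      (hg none)).congr fun p => ?_
    rw [apply_cases (fun v => (gadget (IsFinal v)
      (TQBFVerification.cellVar c M (T p.1 * (W p.1 + 1) + p.2))).code)]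
  exact (h₁.append (h₂.append h₃)).congr fun a => by
    rw [tableau, Clauses.code_append, Clauses.code_append]

end FP

/-- The statement that a string with given prefix is a preimage of `y` under a polynomial-time
function can be written as a quantified Boolean formula, in polynomial time. -/
theorem exists_preimage_formula {F : List Bool → List Bool} (hF : PolyTimeComputable F) :
    ∃ Φ : ℕ → List Bool → List Bool → QBF,
      (∀ n u y, u.length ≤ n →
        ((Φ n u y).IsTrue ↔ ∃ x, x.length = n ∧ u <+: x ∧ F x = y)) ∧
      ∀ {α : Type} {Γ : Ctx α} {n : α → ℕ} {u y : α → List Bool},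
        FP Γ (fun a => unary (n a)) → FP Γ u → FP Γ y →
        FP Γ fun a => (Φ (n a) (u a) (y a)).encode := by
  obtain ⟨c, p, hc, hp⟩ := hF
  obtain ⟨M, hM⟩ := exists_act_nil c
  replace hM : ∀ q ∈ ctlStates c, ∀ i ≥ M + 1, act q i [] = [] := fun q hq i hi =>
    hM q hq i (by omega)
  have hrun : ∀ x, (dstep^[p.eval x.length] (dstart c x)).2 0 = F x := by
    intro x
    obtain ⟨h₁, h₂⟩ := hp x
    have hr := run_deterministic noOracle (p.eval x.length) (q := [c]) (by simpa using hc)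
      (fun i => [x].getD i []) (ket ∅)
    rw [output, start, hr, PMF.pure_map] at h₂
    have := congrArg PMF.support h₂
    rw [PMF.support_pure, PMF.support_pure] at this
    exact Set.singleton_injective this
  let W : ℕ → List Bool → ℕ := fun n y => p.eval n + n + y.length + 1
  let N : ℕ → List Bool → ℕ := fun n y =>
    (p.eval n + 1) * (W n y + 1) * Fintype.card (Cell c M)
  have hlt : ∀ n u y, ∀ d ∈ tableau c M n (p.eval n) (W n y) u y, ∀ l ∈ d, l.1 < N n y + 1 :=
    fun n u y => tableau_lt (by simp only [W]; omega)
  refine ⟨fun n u y => exQBF (N n y) (tableau c M n (p.eval n) (W n y) u y), fun n u y hu => ?_, ?_⟩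
  · rw [exQBF_isTrue (hlt n u y)]
    exact tableau_sat hM (fun x hx => by rw [← hx]; exact hrun x) hu le_rfl
  · intro α Γ n u y hn hu hy
    have hT : FP Γ fun a => unary (p.eval (n a)) := hn.eval p
    have hW : FP Γ fun a => unary (W (n a) (y a)) :=
      ((hT.add hn).add hy.unary_length).add (FP.nat 1)
    have hN : FP Γ fun a => unary (N (n a) (y a) + 1) :=
      (((hT.add (FP.nat 1)).mul (hW.add (FP.nat 1))).mul (FP.nat _)).add (FP.nat 1)
    refine ((FP.flatMap_nat (h := fun _ => [true, true]) hN (FP.const _)).append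
      ((FP.const [false]).append ((FP.code_tableau c M hn hT hW hu hy).append
        (FP.const [false])))).congr fun a => ?_
    rw [exQBF_encode (hlt _ _ _)]
    congr 1
    generalize N (n a) (y a) + 1 = k
    induction k with
    | zero => rfl
    | succ k ih =>
      rw [List.range_succ, List.flatMap_append, ih, List.replicate_succ', List.flatten_append]
      rfl

/-! ### Quantum states: scaling, supports, measurement -/

theorem normSq_smul (z : ℂ) (ψ : QState) : normSq (z • ψ) = ‖z‖₊ ^ 2 * normSq ψ := by
  by_cases hz : z = 0
  · simp [hz, normSq]
  · rw [normSq, normSq, Finsupp.support_smul_eq hz, Finset.mul_sum]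
    refine Finset.sum_congr rfl fun s _ => ?_
    rw [Finsupp.smul_apply, smul_eq_mul, nnnorm_mul, mul_pow]

theorem normSq_eq_zero {ψ : QState} : normSq ψ = 0 ↔ ψ = 0 := by
  constructor
  · intro h
    rw [normSq, Finset.sum_eq_zero_iff] at h
    ext s
    by_contra hs
    have := h s (Finsupp.mem_support_iff.2 hs)
    simp at this
    exact hs this
  · rintro rfl
    simp [normSq]

theorem project_smul (q : ℕ) (b : Bool) (z : ℂ) (ψ : QState) :
    project q b (z • ψ) = z • project q b ψ := Finsupp.filter_smul

/-- Measured states are not rescaled, so scalars accumulate from query to query; they have no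
influence on later measurements. -/
theorem qubitProb_smul (q : ℕ) {z : ℂ} (hz : z ≠ 0) (ψ : QState) :
    qubitProb q (z • ψ) = qubitProb q ψ := by
  rw [qubitProb, qubitProb, project_smul, normSq_smul, normSq_smul]
  exact mul_div_mul_left _ _ (by simpa using hz)

theorem measureQubit_smul (q : ℕ) {z : ℂ} (hz : z ≠ 0) (ψ : QState) :
    measureQubit q (z • ψ) = measureQubit q ψ := by
  ext b
  simp only [measureQubit, PMF.ofFintype_apply, qubitProb_smul q hz]

/-- An outcome of positive probability leaves a nonzero state. -/
theorem project_ne_zero {q : ℕ} {b : Bool} {ψ : QState} (hψ : ψ ≠ 0)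
    (hb : b ∈ (measureQubit q ψ).support) : project q b ψ ≠ 0 := by
  intro h
  rw [PMF.mem_support_iff, measureQubit, PMF.ofFintype_apply] at hb
  cases b
  · have e : project q true ψ = ψ := by
      have := Finsupp.filter_add_filter_not ψ fun s => decide (q ∈ s) = true
      rw [show ψ.filter (fun s => ¬ decide (q ∈ s) = true) = project q false ψ by
        simp [project], h, add_zero] at this
      exact this
    have : qubitProb q ψ = 1 := by
      rw [qubitProb, e]
      exact div_self fun h => hψ (normSq_eq_zero.1 h)
    simp [this] at hb
  · simp [qubitProb, h, normSq_eq_zero.2] at hb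

/-- States that are combinations of basis vectors from `S`. -/
abbrev supp (S : Set (Finset ℕ)) : Submodule ℂ QState := Finsupp.supported ℂ ℂ S

theorem ket_mem_supp {S : Set (Finset ℕ)} {s : Finset ℕ} (h : s ∈ S) : ket s ∈ supp S :=
  Finsupp.single_mem_supported ℂ 1 h

theorem map_mem_supp {S S' : Set (Finset ℕ)} (f : QState →ₗ[ℂ] QState)
    (h : ∀ s ∈ S, f (ket s) ∈ supp S') {ψ : QState} (hψ : ψ ∈ supp S) : f ψ ∈ supp S' := by
  rw [← ψ.sum_single, Finsupp.sum, map_sum]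
  refine Submodule.sum_mem _ fun s hs => ?_
  rw [← mul_one (ψ s), ← smul_eq_mul, ← Finsupp.smul_single, map_smul]
  exact Submodule.smul_mem _ _ (h s (hψ hs))

theorem project_mem_supp {S : Set (Finset ℕ)} {ψ : QState} (hψ : ψ ∈ supp S) (q : ℕ) (b : Bool) :
    project q b ψ ∈ supp {s ∈ S | decide (q ∈ s) = b} := by
  intro s hs
  rw [project, Finsupp.support_filter, Finset.coe_filter] at hs
  exact ⟨hψ hs.1, hs.2⟩

theorem map_eq_of_ket {f g : QState →ₗ[ℂ] QState} (h : ∀ s, f (ket s) = g (ket s)) : f = g :=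
  Finsupp.lhom_ext fun s z => by
    rw [← mul_one z, ← smul_eq_mul, ← Finsupp.smul_single, map_smul, map_smul]
    exact congrArg _ (h s)

/-! ### Gates -/

theorem Gate.apply_ket (g : Gate ℕ) (s : Finset ℕ) : g.apply (ket s) = g.applyKet s := by
  simp [Gate.apply, ket]

theorem inv_sqrt_two_sq : ((1 / Real.sqrt 2 : ℝ) : ℂ) * ((1 / Real.sqrt 2 : ℝ) : ℂ) = 1 / 2 := by
  rw [← Complex.ofReal_mul, div_mul_div_comm, Real.mul_self_sqrt (by norm_num)]
  norm_num

theorem hadamard_sq (q : ℕ) : (Gate.H q).apply ∘ₗ (Gate.H q).apply = LinearMap.id := by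
  refine map_eq_of_ket fun s => ?_
  simp only [LinearMap.comp_apply, Gate.apply_ket, Gate.applyKet, map_smul, map_add, LinearMap.id_apply]
  by_cases h : q ∈ s
  · have e₁ : (s.erase q).erase q = s.erase q := by simp
    have e₂ : insert q (s.erase q) = s := Finset.insert_erase h
    have e₃ : insert q s = s := Finset.insert_eq_self.2 h
    simp only [e₁, e₂, e₃, h, Finset.notMem_erase, if_true, if_false]
    have hc := inv_sqrt_two_sq
    generalize ((1 / Real.sqrt 2 : ℝ) : ℂ) = z at hc ⊢
    match_scalars <;> first | linear_combination 2 * hc | ring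
  · have e₁ : s.erase q = s := Finset.erase_eq_self.2 h
    have e₂ : (insert q s).erase q = s := Finset.erase_insert h
    have e₃ : insert q (insert q s) = insert q s := by simp
    simp only [e₁, e₂, e₃, h, Finset.mem_insert_self, if_true, if_false]
    have hc := inv_sqrt_two_sq
    generalize ((1 / Real.sqrt 2 : ℝ) : ℂ) = z at hc ⊢
    match_scalars <;> first | linear_combination 2 * hc | ring

/-- Each gate has a left inverse: `H` and `CNOT` are their own, and `T` is diagonal with nonzero
entries. No other consequence of unitarity is needed, as `qubitProb` normalises. -/
theorem Gate.apply_ne_zero (g : Gate ℕ) {ψ : QState} (hψ : ψ ≠ 0) : g.apply ψ ≠ 0 := by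
  suffices ∃ f : QState →ₗ[ℂ] QState, f ∘ₗ g.apply = LinearMap.id by
    obtain ⟨f, hf⟩ := this
    intro h
    have := LinearMap.congr_fun hf ψ
    rw [LinearMap.comp_apply, h, map_zero] at this
    exact hψ this.symm
  cases g with
  | H q => exact ⟨_, hadamard_sq q⟩
  | T q =>
    refine ⟨Finsupp.linearCombination ℂ fun s =>
      (if q ∈ s then Complex.exp (Complex.I * (Real.pi / 4)) else 1)⁻¹ • ket s,
      map_eq_of_ket fun s => ?_⟩
    rw [LinearMap.comp_apply, Gate.apply_ket, Gate.applyKet, map_smul]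
    simp only [ket, Finsupp.linearCombination_single, one_smul, LinearMap.id_apply]
    rw [smul_smul, mul_inv_cancel₀, one_smul]
    split_ifs
    · exact Complex.exp_ne_zero _
    · exact one_ne_zero
  | CNOT c t =>
    refine ⟨(Gate.CNOT c t).apply, map_eq_of_ket fun s => ?_⟩
    rw [LinearMap.comp_apply, Gate.apply_ket, Gate.applyKet, Gate.apply_ket, Gate.applyKet,
      LinearMap.id_apply]
    by_cases h : c ∈ s ∧ c ≠ t
    · have h' : c ∈ symmDiff s {t} ∧ c ≠ t := ⟨by simp [Finset.mem_symmDiff, h.1, h.2], h.2⟩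
      rw [if_pos h, if_pos h', symmDiff_symmDiff_cancel_right]
    · rw [if_neg h, if_neg h]

/-- The qubits of a gate. -/
def Gate.qubits {α : Type} : Gate α → List α
  | .H q => [q]
  | .T q => [q]
  | .CNOT c t => [c, t]

theorem Gate.apply_mem_supp {g : Gate ℕ} {K : ℕ} (hg : ∀ q ∈ g.qubits, q < K) {ψ : QState}
    (hψ : ψ ∈ supp {s | ∀ q ∈ s, q < K}) : g.apply ψ ∈ supp {s | ∀ q ∈ s, q < K} := by
  refine map_mem_supp _ (fun s hs => ?_) hψ
  rw [Gate.apply_ket]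
  have hs' : ∀ q ∈ s, q < K := hs
  cases g with
  | H q =>
    have hq : q < K := hg q (by simp [Gate.qubits])
    refine Submodule.smul_mem _ _ (Submodule.add_mem _ (ket_mem_supp ?_)
      (Submodule.smul_mem _ _ (ket_mem_supp ?_)))
    · exact fun q' h => hs' q' (Finset.mem_of_mem_erase h)
    · intro q' h
      rcases Finset.mem_insert.1 h with rfl | h
      exacts [hq, hs' _ h]
  | T q => exact Submodule.smul_mem _ _ (ket_mem_supp hs)
  | CNOT c t =>
    have ht : t < K := hg t (by simp [Gate.qubits])
    refine ket_mem_supp ?_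
    split_ifs
    · intro q h
      rcases Finset.mem_symmDiff.1 h with h | h
      · exact hs' _ h.1
      · rw [Finset.mem_singleton.1 h.1]
        exact ht
    · exact hs

theorem Circuit.apply_cons (g : Gate ℕ) (C : Circuit) (ψ : QState) :
    Circuit.apply (g :: C) ψ = C.apply (g.apply ψ) := rfl

theorem Circuit.apply_smul (C : Circuit) (z : ℂ) (ψ : QState) :
    C.apply (z • ψ) = z • C.apply ψ := by
  induction C generalizing ψ with
  | nil => rfl
  | cons g C ih => rw [Circuit.apply_cons, Circuit.apply_cons, map_smul, ih]

theorem Circuit.apply_ne_zero (C : Circuit) {ψ : QState} (hψ : ψ ≠ 0) : C.apply ψ ≠ 0 := by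
  induction C generalizing ψ with
  | nil => exact hψ
  | cons g C ih => exact ih (g.apply_ne_zero hψ)

theorem Circuit.apply_mem_supp {C : Circuit} {K : ℕ} (hC : ∀ g ∈ C, ∀ q ∈ g.qubits, q < K)
    {ψ : QState} (hψ : ψ ∈ supp {s | ∀ q ∈ s, q < K}) :
    C.apply ψ ∈ supp {s | ∀ q ∈ s, q < K} := by
  induction C generalizing ψ with
  | nil => exact hψ
  | cons g C ih =>
    exact ih (fun g' h => hC g' (by simp [h])) (Gate.apply_mem_supp (hC g (by simp)) hψ)

/-- Qubit numbers are coded in unary, so the length of the code bounds them. It tells the simulating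
program how many qubits have to be reset. -/
theorem Gate.lt_length_encode (g : Gate ℕ) : ∀ q ∈ g.qubits, q < g.encode.length := by
  cases g <;> simp [Gate.qubits, Gate.encode, encodeNat] <;> omega

theorem Circuit.lt_length_encode (C : Circuit) :
    ∀ g ∈ C, ∀ q ∈ g.qubits, q < C.encode.length := by
  induction C with
  | nil => simp
  | cons g C ih =>
    intro g' hg' q hq
    have e : (Circuit.encode (g :: C)).length = g.encode.length + 1 + (Circuit.encode C).length := by
      simp [Circuit.encode, encodeList]
      omega
    rw [e]
    rcases List.mem_cons.1 hg' with rfl | h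
    · have := g'.lt_length_encode q hq
      omega
    · have := ih g' h q hq
      omega

/-- Negation of a qubit. -/
def notGates (q : ℕ) : Circuit := [.H q, .T q, .T q, .T q, .T q, .H q]

theorem exp_quarter_pow : Complex.exp (Complex.I * (Real.pi / 4)) ^ 4 = -1 := by
  rw [← Complex.exp_nat_mul, ← Complex.exp_pi_mul_I]
  congr 1
  push_cast
  ring

/-- `T⁴ = Z` and `H Z H = X`. -/
theorem notGates_apply_ket (q : ℕ) (s : Finset ℕ) :
    (notGates q).apply (ket s) = ket (symmDiff s {q}) := by
  have hT : ∀ s, (Gate.T q).apply ((Gate.T q).apply ((Gate.T q).apply ((Gate.T q).apply (ket s)))) =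
      (if q ∈ s then (-1 : ℂ) else 1) • ket s := by
    intro s
    simp only [Gate.apply_ket, Gate.applyKet, map_smul, smul_smul]
    congr 1
    split_ifs
    · rw [← exp_quarter_pow]
      ring
    · ring
  simp only [notGates, Circuit.apply, List.foldl_cons, List.foldl_nil]
  rw [Gate.apply_ket (.H q) s, Gate.applyKet]
  simp only [map_smul, map_add, hT]
  simp only [Gate.apply_ket, Gate.applyKet]
  by_cases h : q ∈ s
  · have e₁ : (s.erase q).erase q = s.erase q := by simp
    have e₂ : insert q (s.erase q) = s := Finset.insert_erase h
    have e₃ : insert q s = s := Finset.insert_eq_self.2 h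
    have e₄ : symmDiff s {q} = s.erase q := by
      ext x
      simp only [Finset.mem_symmDiff, Finset.mem_singleton, Finset.mem_erase]
      constructor
      · rintro (⟨h₁, h₂⟩ | ⟨rfl, h₂⟩)
        exacts [⟨h₂, h₁⟩, absurd h h₂]
      · rintro ⟨h₁, h₂⟩
        exact .inl ⟨h₂, h₁⟩
    simp only [e₁, e₂, e₃, e₄, h, Finset.notMem_erase, if_true, if_false]
    have hc := inv_sqrt_two_sq
    generalize ((1 / Real.sqrt 2 : ℝ) : ℂ) = z at hc ⊢
    match_scalars <;> first | linear_combination 2 * hc | ring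
  · have e₁ : s.erase q = s := Finset.erase_eq_self.2 h
    have e₂ : (insert q s).erase q = s := Finset.erase_insert h
    have e₃ : insert q (insert q s) = insert q s := by simp
    have e₄ : symmDiff s {q} = insert q s := by
      ext x
      simp only [Finset.mem_symmDiff, Finset.mem_singleton, Finset.mem_insert]
      constructor
      · rintro (⟨h₁, h₂⟩ | ⟨rfl, h₂⟩)
        exacts [.inr h₁, .inl rfl]
      · rintro (rfl | h₁)
        exacts [.inr ⟨rfl, h⟩, .inl ⟨h₁, fun h' => h (h' ▸ h₁)⟩]
    simp only [e₁, e₂, e₃, e₄, h, Finset.mem_insert_self, if_true, if_false]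
    have hc := inv_sqrt_two_sq
    generalize ((1 / Real.sqrt 2 : ℝ) : ℂ) = z at hc ⊢
    match_scalars <;> first | linear_combination 2 * hc | ring

theorem Circuit.apply_add (C : Circuit) (ψ φ : QState) :
    C.apply (ψ + φ) = C.apply ψ + C.apply φ := by
  induction C generalizing ψ φ with
  | nil => rfl
  | cons g C ih => rw [Circuit.apply_cons, map_add, ih]; rfl

/-- The linear map of a circuit. -/
def Circuit.linear (C : Circuit) : QState →ₗ[ℂ] QState where
  toFun := C.apply
  map_add' := C.apply_add
  map_smul' := C.apply_smul

/-- All qubits are `0`, up to a scalar factor. -/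
def Clean (ψ : QState) : Prop := ∃ z : ℂ, z ≠ 0 ∧ ψ = z • ket ∅

theorem clean_ket : Clean (ket ∅) := ⟨1, one_ne_zero, (one_smul _ _).symm⟩

theorem clean_of_supp {ψ : QState} (h0 : ψ ≠ 0) (h : ψ ∈ supp {s | ∀ q ∈ s, q < 0}) : Clean ψ := by
  have e : ψ = ψ ∅ • ket ∅ := by
    ext s
    by_cases hs : s = ∅
    · simp [hs, ket]
    · have : ψ s = 0 := by
        by_contra hne
        have := h (Finset.mem_coe.2 (Finsupp.mem_support_iff.2 hne))
        exact hs (Finset.eq_empty_of_forall_notMem fun q hq => absurd (this q hq) (by omega))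
      simp [this, ket, Ne.symm hs]
  refine ⟨ψ ∅, fun hz => h0 ?_, e⟩
  rw [e, hz, zero_smul]

/-! ### Programs for quantum circuits -/

/-- Negate the qubit whose number is the length of register `i`. -/
def Cmd.notAt (i : ℕ) : Cmd :=
  Cmd.block (.gate (.H i)) [.gate (.T i), .gate (.T i), .gate (.T i), .gate (.T i), .gate (.H i)]

theorem Big.notAt (i : ℕ) (R : Regs) (ψ : QState) :
    Big (.notAt i) R ψ 11 R ((notGates (R i).length).apply ψ) :=
  (Big.gate (.H i) R _).seq ((Big.gate (.T i) R _).seq ((Big.gate (.T i) R _).seq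
    ((Big.gate (.T i) R _).seq ((Big.gate (.T i) R _).seq (Big.gate (.H i) R _)))))

/-- Read a number from register `s` into register `j`, using the empty register `f`. -/
def Cmd.readNat (s j f : ℕ) : Cmd :=
  .seq (.push f true) (.loop f (.branch s (.seq (.pop s) (.push j true)) (.seq (.pop s) (.pop f))
    (.pop f)))

/-- A loop tests only whether a register is empty. Register `f` therefore serves as a flag, which
the end mark of the number clears. -/
theorem Big.readNat {s j f : ℕ} (hsj : s ≠ j) (hsf : s ≠ f) (hjf : j ≠ f) (R : Regs) (ψ : QState)
    (hf : R f = []) (q : ℕ) (rest : List Bool) (hs : R s = encodeNat q ++ rest) :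
    Big (.readNat s j f) R ψ (5 * q + 8)
      (Function.update (Function.update R j (unary q ++ R j)) s rest) ψ := by
  have key : ∀ (q : ℕ) (R : Regs), R f = [true] → R s = encodeNat q ++ rest →
      Big (.loop f (.branch s (.seq (.pop s) (.push j true)) (.seq (.pop s) (.pop f)) (.pop f))) R ψ
        (5 * q + 6) (Function.update (Function.update (Function.update R j (unary q ++ R j)) s rest)
          f []) ψ := by
    intro q
    induction q with
    | zero =>
      intro R hf hs
      refine (Big.loop_cons (by simp [hf]) (.branch_false (l := rest) (by simpa [encodeNat] using hs)
        ((Big.pop s R ψ).seq (Big.pop f _ ψ))) (Big.loop_nil ?_)).of_eq ?_ (by omega)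
      · simp [hsf.symm, hf]
      · funext k
        by_cases h₁ : k = f
        · subst h₁; simp [hsf.symm, hf]
        · by_cases h₂ : k = s
          · subst h₂; simp [h₁, hs, encodeNat]
          · simp [h₁, h₂]
    | succ q ih =>
      intro R hf hs
      have hs' : R s = true :: (encodeNat q ++ rest) := by
        rw [hs, encodeNat, encodeNat, unary, List.replicate_succ]
        rfl
      refine (Big.loop_cons (by simp [hf]) (.branch_true hs' ((Big.pop s R ψ).seq
        (Big.push j true _ ψ))) (ih _ ?_ ?_)).of_eq ?_ (by omega)
      · simp [hsf.symm, hjf.symm, hf]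
      · simp [hsj, hs']
      · funext k
        by_cases h₁ : k = f
        · subst h₁; simp
        · by_cases h₂ : k = s
          · subst h₂; simp [h₁]
          · by_cases h₃ : k = j
            · subst h₃; simp [h₁, h₂, unary, List.replicate_succ']
            · simp [h₁, h₂, h₃]
  refine ((Big.push f true R ψ).seq (key q _ (by simp [hf]) (by simp [hsf, hs]))).of_eq ?_ (by omega)
  funext k
  by_cases h₁ : k = f
  · subst h₁; simp [hsf.symm, hjf.symm, hf]
  · by_cases h₂ : k = s
    · subst h₂; simp [h₁]
    · by_cases h₃ : k = j
      · subst h₃; simp [h₁, h₂]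
      · simp [h₁, h₂, h₃]

theorem Big.blk_readNat {m : ℕ} {G : List (List Bool)} (hG : G.length = m) (xs : List (List Bool))
    (ψ : QState) {s j f : ℕ} (hs : s < xs.length) (hj : j < xs.length) (hsj : s ≠ j) (hsf : s ≠ f)
    (hjf : j ≠ f) (hf : xs.getD f [] = []) (q : ℕ) (rest : List Bool)
    (h : xs.getD s [] = encodeNat q ++ rest) :
    Big (.readNat (m + s) (m + j) (m + f)) (blk G xs) ψ (5 * q + 8)
      (blk G ((xs.set j (unary q ++ xs.getD j [])).set s rest)) ψ := by
  subst hG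
  have := Big.readNat (s := G.length + s) (j := G.length + j) (f := G.length + f) (by omega)
    (by omega) (by omega) (blk G xs) ψ (by rw [blk_apply, hf]) q rest (by rw [blk_apply, h])
  rwa [blk_apply, blk_update _ _ hj, blk_update _ _ (by simpa using hs)] at this

/-- Read the code of a gate from register `m` and apply the gate. -/
def Cmd.readGate (m : ℕ) : Cmd :=
  .branch (m + 0)
    (Cmd.block (.pop (m + 0)) [.readNat (m + 0) (m + 3) (m + 5), .readNat (m + 0) (m + 4) (m + 5),
      .gate (.CNOT (m + 3) (m + 4)), .clear (m + 3), .clear (m + 4)])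
    (.seq (.pop (m + 0)) (.branch (m + 0)
      (Cmd.block (.pop (m + 0)) [.readNat (m + 0) (m + 3) (m + 5), .gate (.T (m + 3)),
        .clear (m + 3)])
      (Cmd.block (.pop (m + 0)) [.readNat (m + 0) (m + 3) (m + 5), .gate (.H (m + 3)),
        .clear (m + 3)])
      (.pop (m + 0))))
    (.pop (m + 0))

section
variable {m : ℕ} {G : List (List Bool)}

theorem Big.blk_gate (hG : G.length = m) (xs : List (List Bool)) (ψ : QState) (g : Gate ℕ) :
    Big (.gate (g.map fun i => m + i)) (blk G xs) ψ 1 (blk G xs)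
      ((g.map fun i => (xs.getD i []).length).apply ψ) := by
  subst hG
  have := Big.gate (g.map fun i => G.length + i) (blk G xs) ψ
  rw [Gate.map_map] at this
  simpa only [blk_apply] using this

theorem Big.readGate (hG : G.length = m) (g : Gate ℕ) (rest x y : List Bool) (ψ : QState) :
    Big (.readGate m) (blk G [g.encode ++ rest, x, y, [], [], []]) ψ (20 * g.encode.length + 40)
      (blk G [rest, x, y, [], [], []]) (g.apply ψ) := by
  have hr : ∀ x xs, blk G (x :: xs) (m + 0) = x := by
    intro x xs
    rw [← hG, blk_apply]
    rfl
  cases g with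
  | CNOT a b =>
    have h₁ := Big.blk_pop hG [(Gate.CNOT a b).encode ++ rest, x, y, [], [], []] ψ (i := 0) (by simp)
    have h₂ := Big.blk_readNat hG [encodeNat a ++ (encodeNat b ++ rest), x, y, [], [], []] ψ
      (s := 0) (j := 3) (f := 5) (by simp) (by simp) (by simp) (by simp) (by simp) rfl a _ rfl
    have h₃ := Big.blk_readNat hG [encodeNat b ++ rest, x, y, unary a ++ [], [], []] ψ
      (s := 0) (j := 4) (f := 5) (by simp) (by simp) (by simp) (by simp) (by simp) rfl b _ rfl
    have h₄ := Big.blk_gate hG [rest, x, y, unary a ++ [], unary b ++ [], []] ψ (.CNOT 3 4)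
    have h₅ := Big.blk_clear hG [rest, x, y, unary a ++ [], unary b ++ [], []]
      ((Gate.CNOT a b).apply ψ) (i := 3) (by simp)
    have h₆ := Big.blk_clear hG [rest, x, y, [], unary b ++ [], []]
      ((Gate.CNOT a b).apply ψ) (i := 4) (by simp)
    have e : ((Gate.CNOT 3 4).map fun i =>
        ([rest, x, y, unary a ++ [], unary b ++ [], []].getD i []).length) = Gate.CNOT a b := by
      simp [Gate.map]
    rw [e] at h₄
    simp only [Gate.encode, List.cons_append, List.append_assoc] at h₁ ⊢
    refine Big.mono (Big.branch_true (hr _ _) (h₁.seq (h₂.seq (h₃.seq (h₄.seq (h₅.seq h₆)))))) ?_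
    simp [encodeNat]
    omega
  | T a =>
    have h₀ := Big.blk_pop hG [(Gate.T a).encode ++ rest, x, y, [], [], []] ψ (i := 0) (by simp)
    have h₁ := Big.blk_pop hG [true :: (encodeNat a ++ rest), x, y, [], [], []] ψ (i := 0) (by simp)
    have h₂ := Big.blk_readNat hG [encodeNat a ++ rest, x, y, [], [], []] ψ
      (s := 0) (j := 3) (f := 5) (by simp) (by simp) (by simp) (by simp) (by simp) rfl a _ rfl
    have h₄ := Big.blk_gate hG [rest, x, y, unary a ++ [], [], []] ψ (.T 3)
    have h₅ := Big.blk_clear hG [rest, x, y, unary a ++ [], [], []]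
      ((Gate.T a).apply ψ) (i := 3) (by simp)
    have e : ((Gate.T 3).map fun i =>
        ([rest, x, y, unary a ++ [], [], []].getD i []).length) = Gate.T a := by
      simp [Gate.map]
    rw [e] at h₄
    simp only [Gate.encode, List.cons_append] at h₀ ⊢
    refine Big.mono (Big.branch_false (hr _ _) (h₀.seq (Big.branch_true (hr _ _)
      (h₁.seq (h₂.seq (h₄.seq h₅)))))) ?_
    simp [encodeNat]
    omega
  | H a =>
    have h₀ := Big.blk_pop hG [(Gate.H a).encode ++ rest, x, y, [], [], []] ψ (i := 0) (by simp)
    have h₁ := Big.blk_pop hG [false :: (encodeNat a ++ rest), x, y, [], [], []] ψ (i := 0) (by simp)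
    have h₂ := Big.blk_readNat hG [encodeNat a ++ rest, x, y, [], [], []] ψ
      (s := 0) (j := 3) (f := 5) (by simp) (by simp) (by simp) (by simp) (by simp) rfl a _ rfl
    have h₄ := Big.blk_gate hG [rest, x, y, unary a ++ [], [], []] ψ (.H 3)
    have h₅ := Big.blk_clear hG [rest, x, y, unary a ++ [], [], []]
      ((Gate.H a).apply ψ) (i := 3) (by simp)
    have e : ((Gate.H 3).map fun i =>
        ([rest, x, y, unary a ++ [], [], []].getD i []).length) = Gate.H a := by
      simp [Gate.map]
    rw [e] at h₄
    simp only [Gate.encode, List.cons_append] at h₀ ⊢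
    refine Big.mono (Big.branch_false (hr _ _) (h₀.seq (Big.branch_false (hr _ _)
      (h₁.seq (h₂.seq (h₄.seq h₅)))))) ?_
    simp [encodeNat]
    omega

/-- Read the code of a circuit from register `m` and apply the circuit. -/
def Cmd.readCircuit (m : ℕ) : Cmd :=
  .loop (m + 0) (.branch (m + 0) (.seq (.pop (m + 0)) (.readGate m)) (.pop (m + 0)) (.pop (m + 0)))

/-- No flag is needed here: the end mark is the last bit of the register, so removing it ends the
loop. -/
theorem Big.readCircuit (hG : G.length = m) (C : Circuit) (x y : List Bool) (ψ : QState) :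
    Big (.readCircuit m) (blk G [C.encode, x, y, [], [], []]) ψ (60 * C.encode.length)
      (blk G [[], x, y, [], [], []]) (C.apply ψ) := by
  have hr : ∀ x xs, blk G (x :: xs) (m + 0) = x := by
    intro x xs
    rw [← hG, blk_apply]
    rfl
  induction C generalizing ψ with
  | nil =>
    have h₁ := Big.blk_pop hG [[false], x, y, [], [], []] ψ (i := 0) (by simp)
    refine Big.mono (Big.loop_cons (by rw [hr]; simp [Circuit.encode, encodeList])
      (Big.branch_false (hr _ _) h₁) (Big.loop_nil (hr _ _))) ?_
    simp [Circuit.encode, encodeList]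
  | cons g C ih =>
    have e : Circuit.encode (g :: C) = true :: (g.encode ++ Circuit.encode C) := by
      simp [Circuit.encode, encodeList]
    have h₁ := Big.blk_pop hG [Circuit.encode (g :: C), x, y, [], [], []] ψ (i := 0) (by simp)
    have h₂ := Big.readGate hG g (Circuit.encode C) x y ψ
    rw [e] at h₁ ⊢
    refine Big.mono (Big.loop_cons (by rw [hr]; simp)
      (Big.branch_true (hr _ _) (h₁.seq h₂)) (ih _)) ?_
    simp
    omega

/-- The basis state in which the first `i` qubits carry the first `i` bits of `w`. -/
def inputKet (w : List Bool) (i : ℕ) : QState :=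
  ket ((Finset.range i).filter fun i => w.getD i false = true)

theorem notGates_inputKet {w : List Bool} {i : ℕ} (h : w.getD i false = true) :
    (notGates i).apply (inputKet w i) = inputKet w (i + 1) := by
  rw [inputKet, notGates_apply_ket, inputKet]
  congr 1
  ext x
  simp only [Finset.mem_symmDiff, Finset.mem_filter, Finset.mem_range, Finset.mem_singleton]
  constructor
  · rintro (⟨⟨h₁, h₂⟩, h₃⟩ | ⟨rfl, h₁⟩)
    exacts [⟨by omega, h₂⟩, ⟨by omega, h⟩]
  · rintro ⟨h₁, h₂⟩
    by_cases hx : x = i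
    · exact .inr ⟨hx, by omega⟩
    · exact .inl ⟨⟨by omega, h₂⟩, hx⟩

theorem inputKet_succ {w : List Bool} {i : ℕ} (h : w.getD i false = false) :
    inputKet w i = inputKet w (i + 1) := by
  rw [inputKet, inputKet]
  congr 1
  ext x
  simp only [Finset.mem_filter, Finset.mem_range]
  constructor
  · rintro ⟨h₁, h₂⟩
    exact ⟨by omega, h₂⟩
  · rintro ⟨h₁, h₂⟩
    refine ⟨?_, h₂⟩
    by_contra hx
    obtain rfl : x = i := by omega
    rw [h] at h₂
    cases h₂

/-- Write the string in register `m + 2` into the qubits. -/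
def Cmd.writeQubits (m : ℕ) : Cmd :=
  .seq (.loop (m + 2) (Cmd.block (.branch (m + 2) (.notAt (m + 3)) (.skip (m + 4)) (.skip (m + 4)))
    [.pop (m + 2), .push (m + 3) true])) (.clear (m + 3))

/-- The input is prepared from `|0⋯0⟩` by negations. The unary loop index in register `m + 3` is at
the same time the address of the qubit. -/
theorem Big.writeQubits (hG : G.length = m) (x y w : List Bool) (z : ℂ) :
    Big (.writeQubits m) (blk G [x, y, w, [], [], []]) (z • ket ∅) (30 * w.length + 10)
      (blk G [x, y, [], [], [], []]) (z • inputState w) := by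
  have hr : ∀ x y l t, blk G (x :: y :: l :: t) (m + 2) = l := by
    intro x y l t
    rw [← hG, blk_apply]
    rfl
  have hr' : ∀ x y l t t', blk G (x :: y :: l :: t :: t') (m + 3) = t := by
    intro x y l t t'
    rw [← hG, blk_apply]
    rfl
  have key : ∀ n i, i + n = w.length →
      Big (.loop (m + 2) (Cmd.block (.branch (m + 2) (.notAt (m + 3)) (.skip (m + 4)) (.skip (m + 4)))
        [.pop (m + 2), .push (m + 3) true])) (blk G [x, y, w.drop i, unary i, [], []])
        (z • inputKet w i) (20 * n + 1) (blk G [x, y, [], unary w.length, [], []])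
        (z • inputKet w w.length) := by
    intro n
    induction n with
    | zero =>
      intro i hi
      obtain rfl : i = w.length := by omega
      rw [List.drop_length]
      exact (Big.loop_nil (hr _ _ _ _)).mono (by omega)
    | succ n ih =>
      intro i hi
      have hlt : i < w.length := by omega
      have hd : w.drop i = w[i] :: w.drop (i + 1) := List.drop_eq_getElem_cons hlt
      have hg : w.getD i false = w[i] := by simp [List.getD_eq_getElem?_getD, hlt]
      have h₁ : Big (.branch (m + 2) (.notAt (m + 3)) (.skip (m + 4)) (.skip (m + 4)))
          (blk G [x, y, w.drop i, unary i, [], []]) (z • inputKet w i) 12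
          (blk G [x, y, w.drop i, unary i, [], []]) (z • inputKet w (i + 1)) := by
        rcases hb : w[i] with _ | _
        · rw [hb] at hd hg
          rw [← inputKet_succ hg]
          exact (Big.branch_false ((hr _ _ _ _).trans hd) (Big.skip _ _ _)).mono (by omega)
        · rw [hb] at hd hg
          rw [← notGates_inputKet hg, ← Circuit.apply_smul]
          have := Big.notAt (m + 3) (blk G [x, y, w.drop i, unary i, [], []]) (z • inputKet w i)
          rw [hr', unary, List.length_replicate] at this
          exact (Big.branch_true ((hr _ _ _ _).trans hd) this).mono (by omega)
      have h₂ := Big.blk_pop hG [x, y, w.drop i, unary i, [], []] (z • inputKet w (i + 1)) (i := 2)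
        (by simp)
      have h₃ := Big.blk_push hG [x, y, (w.drop i).tail, unary i, [], []] (z • inputKet w (i + 1))
        (i := 3) (by simp) true
      have h₄ := ih (i + 1) (by omega)
      rw [hd, List.tail_cons] at h₃
      rw [hd] at h₁ h₂ ⊢
      exact Big.mono (Big.loop_cons (by rw [hr]; exact List.cons_ne_nil _ _) (h₁.seq (h₂.seq h₃)) h₄)
        (by omega)
  have h₁ := key w.length 0 (by omega)
  have h₂ := Big.blk_clear hG [x, y, [], unary w.length, [], []] (z • inputKet w w.length)
    (i := 3) (by simp)
  have e : inputKet w 0 = ket ∅ := by simp [inputKet]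
  rw [e] at h₁
  refine Big.mono (h₁.seq h₂) ?_
  simp
  omega

end

/-- Measure the qubits below the length of register `m + 1` and set them to `0`. -/
def Cmd.resetBody (m : ℕ) : Cmd :=
  Cmd.block (.meas (m + 3) (m + 4)) [.branch (m + 4) (.notAt (m + 3)) (.skip (m + 2)) (.skip (m + 2)),
    .pop (m + 4), .push (m + 3) true, .pop (m + 1)]

/-- The circuit leaves its qubits in an arbitrary entangled state. There is no need to uncompute it:
each qubit is measured and negated if it is `1`. The invariant is that all qubits outside `l ≤ q <
K` are `0`. -/
theorem Out.reset {O : Oracle} {m : ℕ} {G : List (List Bool)} (hG : G.length = m) {k : List Cmd}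
    {T' K : ℕ} {A : PMF (List Bool)}
    (hk : ∀ ψ, Clean ψ → Out O ⟨k, blk G [[], [], [], unary K, [], []], ψ⟩ T' A)
    (n l : ℕ) (hn : l + n = K) {ψ : QState} (h0 : ψ ≠ 0)
    (hψ : ψ ∈ supp {s | ∀ q ∈ s, l ≤ q ∧ q < K}) :
    Out O ⟨.loop (m + 1) (.resetBody m) :: k, blk G [[], unary n, [], unary l, [], []], ψ⟩
      (40 * n + 1 + T') A := by
  have hr₁ : ∀ x y t, blk G (x :: y :: t) (m + 1) = y := by
    intro x y t
    rw [← hG, blk_apply]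
    rfl
  have hr₃ : ∀ x y l t t', blk G (x :: y :: l :: t :: t') (m + 3) = t := by
    intro x y l t t'
    rw [← hG, blk_apply]
    rfl
  have hr₄ : ∀ x y l t u t', blk G (x :: y :: l :: t :: u :: t') (m + 4) = u := by
    intro x y l t t' u
    rw [← hG, blk_apply]
    rfl
  induction n generalizing l ψ with
  | zero =>
    obtain rfl : l = K := by omega
    refine (Big.loop_nil (hr₁ _ _ _)).out (hk _ (clean_of_supp h0 ?_)) |>.mono (by omega)
    exact Finsupp.supported_mono (fun s hs q hq => by have := hs q hq; omega) hψ
  | succ n ih =>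
    have s₁ : step O ⟨.loop (m + 1) (.resetBody m) :: k,
        blk G [[], unary (n + 1), [], unary l, [], []], ψ⟩ =
        PMF.pure ⟨.resetBody m :: .loop (m + 1) (.resetBody m) :: k,
          blk G [[], unary (n + 1), [], unary l, [], []], ψ⟩ := by
      simp only [step, hr₁, unary, List.replicate_succ]
    have rest : ∀ b, ∀ φ : QState, φ ≠ 0 →
        φ ∈ supp {s ∈ {s : Finset ℕ | ∀ q ∈ s, l ≤ q ∧ q < K} | decide (l ∈ s) = b} →
        Out O ⟨Cmd.block (.branch (m + 4) (.notAt (m + 3)) (.skip (m + 2)) (.skip (m + 2)))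
          [.pop (m + 4), .push (m + 3) true, .pop (m + 1)] :: .loop (m + 1) (.resetBody m) :: k,
          blk G [[], unary (n + 1), [], unary l, [b], []], φ⟩ (30 + (40 * n + 1 + T')) A := by
      intro b φ hφ hφ'
      obtain ⟨φ', h₁, h₂, h₃⟩ : ∃ φ' : QState, φ' ≠ 0 ∧
          φ' ∈ supp {s | ∀ q ∈ s, l + 1 ≤ q ∧ q < K} ∧
          Big (.branch (m + 4) (.notAt (m + 3)) (.skip (m + 2)) (.skip (m + 2)))
            (blk G [[], unary (n + 1), [], unary l, [b], []]) φ 12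
            (blk G [[], unary (n + 1), [], unary l, [b], []]) φ' := by
        cases b
        · refine ⟨φ, hφ, Finsupp.supported_mono ?_ hφ', ?_⟩
          · rintro s ⟨hs, hl⟩ q hq
            have := hs q hq
            have hl : l ∉ s := by simpa using hl
            have hne : q ≠ l := fun h => hl (h ▸ hq)
            omega
          · exact (Big.branch_false (hr₄ _ _ _ _ _ _) (Big.skip _ _ _)).mono (by omega)
        · refine ⟨(notGates l).apply φ, Circuit.apply_ne_zero _ hφ, ?_, ?_⟩
          · refine map_mem_supp (notGates l).linear ?_ hφ'
            rintro s ⟨hs, hl⟩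
            change (notGates l).apply (ket s) ∈ _
            rw [notGates_apply_ket]
            refine ket_mem_supp fun q hq => ?_
            have hl : l ∈ s := by simpa using hl
            rcases Finset.mem_symmDiff.1 hq with ⟨h₁, h₂⟩ | ⟨h₁, h₂⟩
            · have := hs q h₁
              have : q ≠ l := by simpa using h₂
              omega
            · rw [Finset.mem_singleton] at h₁
              exact absurd hl (h₁ ▸ h₂)
          · have := Big.notAt (m + 3) (blk G [[], unary (n + 1), [], unary l, [true], []]) φ
            rw [hr₃, unary, unary, List.length_replicate] at this
            exact (Big.branch_true (hr₄ _ _ _ _ _ _) this).mono (by omega)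
      have b₁ := Big.blk_pop hG [[], unary (n + 1), [], unary l, [b], []] φ' (i := 4) (by simp)
      have b₂ := Big.blk_push hG [[], unary (n + 1), [], unary l, [], []] φ' (i := 3) (by simp) true
      have b₃ := Big.blk_pop hG [[], unary (n + 1), [], unary (l + 1), [], []] φ' (i := 1) (by simp)
      exact ((h₃.seq (b₁.seq (b₂.seq b₃))).out (ih (l + 1) (by omega) h₁ h₂)).mono (by omega)
    have s₂ := Out.of_bind (O := O) (C := ⟨.meas (m + 3) (m + 4) ::
        Cmd.block (.branch (m + 4) (.notAt (m + 3)) (.skip (m + 2)) (.skip (m + 2)))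
          [.pop (m + 4), .push (m + 3) true, .pop (m + 1)] :: .loop (m + 1) (.resetBody m) :: k,
        blk G [[], unary (n + 1), [], unary l, [], []], ψ⟩) (B := fun _ => A)
      (T := 30 + (40 * n + 1 + T')) rfl (fun b hb => by
        rw [hr₃, unary, List.length_replicate] at hb ⊢
        rw [hr₄, ← hG, blk_update _ _ (by simp), hG]
        exact rest b _ (project_ne_zero h0 hb) (project_mem_supp hψ l b))
    -- Both outcomes lead to the same output distribution `A`, so the randomness of the measurement
    -- disappears.
    rw [PMF.bind_const] at s₂
    exact (Out.of_pure s₁ (Out.of_pure rfl s₂)).mono (by omega)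

/-! ### Programs on a fixed number of registers -/

/-- Arbitrary contents of `m` registers. -/
def Ctx.all (m : ℕ) : Ctx {G : List (List Bool) // G.length = m} := ⟨m, Subtype.val, Subtype.property⟩

/-- The total length of some strings. -/
def totalLength (G : List (List Bool)) : ℕ := (G.map List.length).sum

theorem blk_set_lt {G : List (List Bool)} (xs : List (List Bool)) {i : ℕ} (hi : i < G.length)
    (v : List Bool) : Function.update (blk G xs) i v = blk (G.set i v) xs := by
  funext k
  by_cases h : k = i
  · subst h
    rw [Function.update_self, blk_lt _ (by simpa using hi)]
    simp [List.getD_eq_getElem?_getD, hi]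
  · rw [Function.update_of_ne h]
    rcases lt_or_ge k G.length with h' | h'
    · rw [blk_lt _ h', blk_lt _ (by simpa using h')]
      simp [List.getD_eq_getElem?_getD, List.getElem?_set_ne (Ne.symm h)]
    · obtain ⟨k, rfl⟩ := Nat.exists_eq_add_of_le h'
      rw [blk_apply]
      have := blk_apply (G.set i v) xs k
      rw [List.length_set] at this
      exact this.symm

theorem blk_nil_update {G : List (List Bool)} {m : ℕ} (hG : G.length = m) (v : List Bool) :
    Function.update (blk G []) m v = blk G [v] := by
  subst hG
  rw [← show blk G [[]] = blk G [] from blk_pad G [] 1]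
  exact blk_update G [[]] (j := 0) (by simp) v

theorem getD_length_le (G : List (List Bool)) (i : ℕ) : (G.getD i []).length ≤ totalLength G := by
  rcases lt_or_ge i G.length with h | h
  · rw [List.getD_eq_getElem?_getD, List.getElem?_eq_getElem h, Option.getD_some]
    exact List.single_le_sum (by simp) _ (List.mem_map_of_mem (List.getElem_mem h))
  · simp [List.getD_eq_getElem?_getD, List.getElem?_eq_none h]

theorem FP.get {m i : ℕ} (hi : i < m) : FP (Ctx.all m) fun G => G.1.getD i [] := by
  refine ⟨PB.size.of_le fun G => getD_length_le G.1 i, .copy i m (m + 1),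
    fun G => 12 * (G.1.getD i []).length + 3, Cmd.copy_isDeterministic _ _ _,
    (((PB.const 12).mul PB.size).add (.const 3)).of_le fun G =>
      Nat.add_le_add_right (Nat.mul_le_mul_left _ (getD_length_le G.1 i)) 3, fun G ψ => ?_⟩
  obtain ⟨G, hG⟩ := G
  have hnil : ∀ j, blk G [] (m + j) = [] := fun j => by
    rw [← hG, blk_apply]
    simp
  have := Big.copy (i := i) (j := m) (s := m + 1) (by omega) (by omega) (by omega) (blk G []) ψ
    (hnil 1) (hnil 0)
  rwa [blk_lt _ (by omega), blk_nil_update hG] at this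

/-- Assignment to a register. -/
theorem FP.exists_assign {m i : ℕ} (hi : i < m) {f : {G : List (List Bool) // G.length = m} → List Bool}
    (hf : FP (Ctx.all m) f) : ∃ (c : Cmd) (p : Polynomial ℕ), c.IsDeterministic ∧
      ∀ G (hG : G.length = m), (f ⟨G, hG⟩).length ≤ p.eval (totalLength G) ∧
        ∀ ψ, Big c (blk G []) ψ (p.eval (totalLength G)) (blk (G.set i (f ⟨G, hG⟩)) []) ψ := by
  obtain ⟨⟨p, hp⟩, c, T, hc, ⟨q, hq⟩, h⟩ := hf
  refine ⟨Cmd.block c [.clear i, .transfer (m + 0) i (m + 1)],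
    q + 2 * Polynomial.X + 10 * p + 10 + p, ⟨hc, Cmd.clear_isDeterministic _,
    Cmd.transfer_isDeterministic _ _ _⟩, fun G hG => ⟨?_, fun ψ => ?_⟩⟩
  · have := hp ⟨G, hG⟩
    simp only [Polynomial.eval_add]
    exact this.trans (Nat.le_add_left _ _)
  · have h₁ := h ⟨G, hG⟩ ψ
    change Big _ (blk G []) ψ _ (blk G [f ⟨G, hG⟩]) ψ at h₁
    set v := f ⟨G, hG⟩
    have h₂ := Big.clear i (blk G [v]) ψ
    rw [blk_lt _ (by omega), blk_set_lt _ (by omega)] at h₂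
    have hlen : (G.set i []).length = m := by simpa using hG
    have hr : ∀ xs j, blk (G.set i []) xs (m + j) = xs.getD j [] := fun xs j => by
      rw [← hlen, blk_apply]
    have h₃ := Big.transfer (i := m + 0) (j := i) (s := m + 1) (by omega) (by omega) (by omega)
      (blk (G.set i []) [v]) ψ (by rw [hr]; rfl)
    have hup : ∀ x y, Function.update (blk ((G.set i []).set i x) [v]) (m + 0) y =
        blk ((G.set i []).set i x) [y] := fun x y => by
      have := blk_update ((G.set i []).set i x) [v] (j := 0) (by simp) y
      rwa [List.length_set, hlen] at this
    rw [hr, blk_lt _ (by omega), blk_set_lt _ (by omega), hup] at h₃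
    refine (h₁.seq (h₂.seq h₃)).of_eq ?_ ?_
    · have e : (G.set i []).getD i [] = [] := by simp [List.getD_eq_getElem?_getD, hG, hi]
      rw [e]
      simp only [List.getD_cons_zero, List.append_nil, List.set_set]
      exact blk_pad _ [] 1
    · have l₁ : v.length ≤ p.eval (totalLength G) := hp ⟨G, hG⟩
      have l₂ : T ⟨G, hG⟩ ≤ q.eval (totalLength G) := hq ⟨G, hG⟩
      have l₃ := getD_length_le G i
      simp only [Polynomial.eval_add, Polynomial.eval_mul, Polynomial.eval_ofNat, Polynomial.eval_X,
        List.getD_cons_zero]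
      omega

theorem Cmd.IsDeterministic.isOracleFree {c : Cmd} (h : c.IsDeterministic) : c.IsOracleFree := by
  induction c with
  | seq c d ihc ihd => exact ⟨ihc h.1, ihd h.2⟩
  | branch i c d e ihc ihd ihe => exact ⟨ihc h.1, ihd h.2.1, ihe h.2.2⟩
  | loop i c ih => exact ih h
  | push | pop => trivial
  | _ => exact h.elim

theorem Cmd.IsDeterministic.isClassical {c : Cmd} (h : c.IsDeterministic) : c.IsClassical := by
  induction c with
  | seq c d ihc ihd => exact ⟨ihc h.1, ihd h.2⟩
  | branch i c d e ihc ihd ihe => exact ⟨ihc h.1, ihd h.2.1, ihe h.2.2⟩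
  | loop i c ih => exact ih h
  | push | pop => trivial
  | _ => exact h.elim

/-! ### Oracle queries by subprograms -/

/-- With oracle `O'`, the program `q` asks the query in register `i` to the oracle `O` and pushes the
answer on register `j`; it uses `m` registers and further ones as scratch, and returns all qubits in
the state `0`. -/
def Simulates (O' : Oracle) (q : Cmd) (m i j : ℕ) (O : Oracle) (t : Polynomial ℕ) : Prop :=
  ∀ G : List (List Bool), G.length = m → ∀ ψ, Clean ψ →
    ∀ (k : List Cmd) (T' : ℕ) (A : Bool → PMF (List Bool)),
      (∀ b ∈ (O (G.getD i [])).support, ∀ ψ', Clean ψ' →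
        Out O' ⟨k, blk (G.set j (b :: G.getD j [])) [], ψ'⟩ T' (A b)) →
      Out O' ⟨q :: k, blk G [], ψ⟩ (t.eval (totalLength G) + T') ((O (G.getD i [])).bind A)

theorem simulates_query (O : Oracle) {m i j : ℕ} (hi : i < m) (hj : j < m) :
    Simulates O (.query i j) m i j O 1 := by
  intro G hG ψ hψ k T' A h
  refine (Out.of_bind (μ := O (G.getD i [])) (g := fun b =>
    ⟨k, blk (G.set j (b :: G.getD j [])) [], ψ⟩) (T := T') ?_ fun b hb => h b hb ψ hψ).mono ?_
  · simp only [step]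
    rw [blk_lt _ (by omega), blk_lt _ (by omega)]
    congr 1
    funext b
    rw [blk_set_lt _ (by omega)]
  · simp [add_comm]

/-- The program computes the circuit for the length of the query, runs it on the query, measures the
answer and resets the qubits, so that the next query starts afresh and its answer is independent of
the previous ones. -/
theorem exists_simulates {O : Oracle} (hO : IsQuantumImplemented O) {m i j : ℕ} (hi : i < m)
    (hj : j < m) : ∃ (q : Cmd) (t : Polynomial ℕ), q.IsOracleFree ∧
      ∀ O', Simulates O' q m i j O t := by
  obtain ⟨C, ⟨g, hg, hgC⟩, hO⟩ := hO
  let Γ := Ctx.all m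
  let w : {G : List (List Bool) // G.length = m} → List Bool := fun G => G.1.getD i []
  let e : {G : List (List Bool) // G.length = m} → List Bool := fun G => g (unary (w G).length)
  -- The sum bounds all qubits that are touched: those of the circuit by the length of its code,
  -- those of the input by the length of the query.
  let K : {G : List (List Bool) // G.length = m} → List Bool := fun G =>
    unary ((e G).length + (w G).length)
  have hw : FP Γ w := FP.get hi
  have he : FP Γ e := FP.of_polyTimeComputable hg hw.unary_length
  have hK : FP Γ K := he.unary_length.add hw.unary_length
  obtain ⟨-, c₁, T₁, hc₁, hT₁, h₁⟩ := id he
  obtain ⟨-, c₂, T₂, hc₂, hT₂, h₂⟩ := hK.weaken e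
  obtain ⟨-, c₃, T₃, hc₃, hT₃, h₃⟩ := (hw.weaken e).weaken K
  have hT₂ := hT₂.of_push he.1
  have hT₃ := (hT₃.of_push (hK.1.push e)).of_push he.1
  obtain ⟨t, ht⟩ : PB Γ fun G => T₁ G + T₂ G + T₃ G + 100 * (w G).length + 100 * (e G).length +
      100 * (K G).length + 100 :=
    ((((((hT₁.add hT₂).add hT₃).add ((PB.const 100).mul hw.1)).add ((PB.const 100).mul he.1)).add
      ((PB.const 100).mul hK.1)).add (.const 100))
  refine ⟨Cmd.block c₁ [c₂, c₃, .writeQubits m, .readCircuit m, .meas (m + 2) j,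
    .loop (m + 1) (.resetBody m), .clear (m + 3)], t, ?_, ?_⟩
  · refine ⟨hc₁.isOracleFree, hc₂.isOracleFree, hc₃.isOracleFree, ?_, ?_, trivial, ?_, (Cmd.clear_isDeterministic _).isOracleFree⟩ <;>
      simp [Cmd.writeQubits, Cmd.readCircuit, Cmd.readGate, Cmd.readNat, Cmd.resetBody, Cmd.notAt,
        Cmd.block, Cmd.skip, Cmd.clear, Cmd.IsOracleFree]
  intro O' G hG ψ hψ k T' A hk
  obtain ⟨z, hz, rfl⟩ := hψ
  have h₁ := h₁ ⟨G, hG⟩ (z • ket ∅)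
  have h₂ := h₂ ⟨G, hG⟩ (z • ket ∅)
  have h₃ := h₃ ⟨G, hG⟩ (z • ket ∅)
  have ht := ht ⟨G, hG⟩
  change _ ≤ t.eval (totalLength G) at ht
  change Big _ (blk G []) _ _ (blk G [e ⟨G, hG⟩]) _ at h₁
  change Big _ (blk (G ++ [e ⟨G, hG⟩]) []) _ _ (blk (G ++ [e ⟨G, hG⟩]) [K ⟨G, hG⟩]) _ at h₂
  change Big _ (blk (G ++ [e ⟨G, hG⟩] ++ [K ⟨G, hG⟩]) []) _ _
    (blk (G ++ [e ⟨G, hG⟩] ++ [K ⟨G, hG⟩]) [w ⟨G, hG⟩]) _ at h₃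
  simp only [blk_snoc] at h₂ h₃
  have hwG : w ⟨G, hG⟩ = G.getD i [] := rfl
  set w' := w ⟨G, hG⟩
  have heG : e ⟨G, hG⟩ = (C w'.length).encode := hgC _
  set e' := e ⟨G, hG⟩
  have hKG : K ⟨G, hG⟩ = unary (e'.length + w'.length) := rfl
  set K' := K ⟨G, hG⟩
  rw [← blk_pad G [e', K', w'] 3] at h₃
  have h₄ := Big.writeQubits hG e' K' w' z
  have h₅ := Big.readCircuit hG (C w'.length) K' [] (z • inputState w')
  rw [← heG] at h₅
  set φ := (C w'.length).apply (z • inputState w') with hφ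
  have hφ0 : φ ≠ 0 := by
    refine Circuit.apply_ne_zero _ (smul_ne_zero hz ?_)
    simp [inputState, ket]
  have hφs : φ ∈ supp {s | ∀ q ∈ s, 0 ≤ q ∧ q < e'.length + w'.length} := by
    have : φ ∈ supp {s | ∀ q ∈ s, q < e'.length + w'.length} := by
      refine Circuit.apply_mem_supp (fun g hg q hq => ?_)
        (Submodule.smul_mem _ _ (ket_mem_supp fun q hq => ?_))
      · have := (C w'.length).lt_length_encode g hg q hq
        rw [← heG] at this
        omega
      · have := Finset.mem_range.1 (Finset.mem_filter.1 hq).1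
        omega
    exact Finsupp.supported_mono (fun s hs q hq => ⟨Nat.zero_le _, hs q hq⟩) this
  have hmeas : measureQubit 0 φ = O w' := by
    rw [hφ, Circuit.apply_smul, measureQubit_smul _ hz, hO]
  have key : ∀ b ∈ (O w').support,
      Out O' ⟨Cmd.block (.loop (m + 1) (.resetBody m)) [.clear (m + 3)] :: k,
        blk (G.set j (b :: G.getD j [])) [[], K', [], [], [], []], project 0 b φ⟩
        ((40 * (e'.length + w'.length) + 1 + (2 * (e'.length + w'.length) + 1 + T')) + 1) (A b) := by
    intro b hb
    have hG' : (G.set j (b :: G.getD j [])).length = m := by simpa using hG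
    refine Out.of_pure rfl (Out.reset hG' (K := e'.length + w'.length) (fun ψ' hψ' => ?_)
      (e'.length + w'.length) 0
      (by omega) (project_ne_zero hφ0 (by rwa [hmeas])) ?_)
    · have h := Big.blk_clear hG' [[], [], [], unary (e'.length + w'.length), [], []] ψ' (i := 3)
        (by simp)
      have h' := hk b (by rwa [← hwG]) ψ' hψ'
      rw [← blk_pad _ [] 6] at h'
      exact (h.out h').mono (by simp)
    · exact Finsupp.supported_mono (fun s hs => hs.1) (project_mem_supp hφs 0 b)
  have hm := Out.of_bind (O := O') (C := ⟨.meas (m + 2) j ::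
      Cmd.block (.loop (m + 1) (.resetBody m)) [.clear (m + 3)] :: k,
      blk G [[], K', [], [], [], []], φ⟩) (μ := O w')
      (g := fun b => ⟨Cmd.block (.loop (m + 1) (.resetBody m)) [.clear (m + 3)] :: k,
        blk (G.set j (b :: G.getD j [])) [[], K', [], [], [], []], project 0 b φ⟩) (B := A) (by
      -- Register `m + 2`, emptied while the input was written, names qubit `0` by its length.
      have hr : blk G [[], K', [], [], [], []] (m + 2) = [] := by
        rw [← hG, blk_apply]
        rfl
      simp only [step, hr, List.length_nil, hmeas]
      congr 1
      funext b
      rw [blk_lt _ (by omega), blk_set_lt _ (by omega)]) key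
  refine Out.mono (Out.of_pure rfl (h₁.out (Out.of_pure rfl (h₂.out (Out.of_pure rfl (h₃.out
    (Out.of_pure rfl (h₄.out (Out.of_pure rfl (h₅.out (Out.of_pure rfl hm))))))))))) ?_
  change T₁ ⟨G, hG⟩ + T₂ ⟨G, hG⟩ + T₃ ⟨G, hG⟩ + 100 * w'.length + 100 * e'.length +
    100 * K'.length + 100 ≤ t.eval (totalLength G) at ht
  have hKl : K'.length = e'.length + w'.length := by rw [hKG, unary, List.length_replicate]
  omega

/-! ### Majority and equality of strings in polynomial time -/

/-- The majority of the bits of a string. -/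
def majority (l : List Bool) : Bool := decide (l.count false < l.count true)

theorem flatMap_cases_drop (l x y : List Bool) :
    ((List.range l.length).flatMap fun j => FP.cases (l.drop j) x y []) =
      l.flatMap fun b => if b then x else y := by
  induction l with
  | nil => rfl
  | cons b l ih =>
    rw [List.length_cons, List.range_succ_eq_map, List.flatMap_cons, List.flatMap_map,
      List.flatMap_cons, ← ih]
    cases b <;> rfl

theorem length_flatMap_ite (l : List Bool) (b : Bool) :
    (l.flatMap fun b' => if b' then (if b then [true] else []) else
      if b then [] else [true]).length = l.count b := by
  induction l with
  | nil => rfl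
  | cons b' l ih =>
    rw [List.flatMap_cons, List.length_append, ih, List.count_cons]
    cases b <;> cases b' <;> simp [add_comm]

namespace FP
variable {α : Type} {Γ : Ctx α} {f g : α → List Bool}

theorem count (hf : FP Γ f) (b : Bool) : FP Γ fun a => unary ((f a).count b) := by
  refine (flatMap_range hf ((hf.lift_index.drop index_unary).branch
    (const (if b then [true] else [])) (const (if b then [] else [true])) nil)).unary_length.congr
    fun a => ?_
  dsimp only
  rw [flatMap_cases_drop, length_flatMap_ite]

/-- Numbers are compared in unary: something remains of the ones after dropping as many symbols as
there are zeros exactly if the ones prevail. -/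
theorem majority (hf : FP Γ f) : FP Γ fun a => [majority (f a)] := by
  refine (((hf.count true).drop (hf.count false)).branch (const [true]) (const [true])
    (const [false])).congr fun a => ?_
  rw [cases_drop, TQBFVerification.majority]
  by_cases h : (f a).count false < (f a).count true
  · simp [h, unary]
  · simp [h, unary]

/-- One symbol is written for each position where the strings differ, the end of a string counting
as a symbol; the strings agree exactly if nothing is written. -/
theorem eq_test (hf : FP Γ f) (hg : FP Γ g) : FP Γ fun a => [decide (f a = g a)] := by
  have hg' : FP Γ.index fun p => (g p.1).drop p.2 := hg.lift_index.drop index_unary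
  refine ((flatMap_nat (hf.unary_length.add hg.unary_length)
    ((hf.lift_index.drop index_unary).branch
      (hg'.branch (const []) (const [true]) (const [true]))
      (hg'.branch (const [true]) (const []) (const [true]))
      (hg'.branch (const [true]) (const [true]) (const [])))).branch
    (const [false]) (const [false]) (const [true])).congr fun a => ?_
  dsimp only
  have e : ∀ j, cases ((f a).drop j) (cases ((g a).drop j) [] [true] [true])
      (cases ((g a).drop j) [true] [] [true]) (cases ((g a).drop j) [true] [true] []) =
      if (f a)[j]? = (g a)[j]? then [] else [true] := by
    intro j
    simp only [cases_drop]
    rcases (f a)[j]? with _ | _ | _ <;> rcases (g a)[j]? with _ | _ | _ <;> simp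
  simp only [e]
  by_cases h : f a = g a
  · have : ((List.range ((f a).length + (g a).length)).flatMap fun j =>
        if (f a)[j]? = (g a)[j]? then [] else [true]) = [] := by
      simp [h]
    rw [this]
    simp [h, cases]
  · obtain ⟨j, hj⟩ : ∃ j, (f a)[j]? ≠ (g a)[j]? := by
      by_contra! h'
      exact h (List.ext_getElem? h')
    have hj' : j < (f a).length + (g a).length := by
      by_contra! h'
      exact hj (by rw [List.getElem?_eq_none (by omega), List.getElem?_eq_none (by omega)])
    have : ((List.range ((f a).length + (g a).length)).flatMap fun j =>
        if (f a)[j]? = (g a)[j]? then [] else [true]) ≠ [] := by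
      intro h'
      have := List.flatMap_eq_nil_iff.1 h' j (List.mem_range.2 hj')
      rw [if_neg hj] at this
      cases this
    rcases hl : ((List.range ((f a).length + (g a).length)).flatMap fun j =>
        if (f a)[j]? = (g a)[j]? then [] else [true]) with _ | ⟨_ | _, l⟩
    · exact absurd hl this
    · simp [cases, h]
    · simp [cases, h]

end FP

/-! ### The search for a preimage -/

/-- `k` independent samples are pushed on a string. -/
def sampleDist (μ : PMF Bool) : ℕ → List Bool → PMF (List Bool)
  | 0, l => PMF.pure l
  | k + 1, l => μ.bind fun b => sampleDist μ k (b :: l)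

/-- The prefix `u` is extended by `k` bits, each of which is the majority of `51 n` answers to
the query `Q n u y`. -/
def searchDist (Q : ℕ → List Bool → List Bool → List Bool) (O : Oracle) (n : ℕ) (y : List Bool) :
    ℕ → List Bool → PMF (List Bool)
  | 0, u => PMF.pure u
  | k + 1, u => (sampleDist (O (Q n u y)) (51 * n) []).bind fun l =>
      searchDist Q O n y k (u ++ [majority l])

theorem Big.pop_lt {G : List (List Bool)} {i : ℕ} (hi : i < G.length) (ψ : QState) :
    Big (.pop i) (blk G []) ψ 1 (blk (G.set i (G.getD i []).tail) []) ψ := by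
  have := Big.pop i (blk G []) ψ
  rwa [blk_lt _ hi, blk_set_lt _ hi] at this

theorem Big.clear_lt {G : List (List Bool)} {i : ℕ} (hi : i < G.length) (ψ : QState) :
    Big (.clear i) (blk G []) ψ (2 * (G.getD i []).length + 1) (blk (G.set i []) []) ψ := by
  have := Big.clear i (blk G []) ψ
  rwa [blk_lt _ hi, blk_set_lt _ hi] at this

theorem totalLength_cons (x : List Bool) (G : List (List Bool)) :
    totalLength (x :: G) = x.length + totalLength G := by
  simp [totalLength]

theorem totalLength_nil : totalLength [] = 0 := rfl

theorem step_loop_unary (O : Oracle) {i n : ℕ} {c : Cmd} {k : List Cmd} {R : Regs} {ψ : QState}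
    (h : R i = unary (n + 1)) :
    step O ⟨.loop i c :: k, R, ψ⟩ = PMF.pure ⟨c :: .loop i c :: k, R, ψ⟩ := by
  simp only [step, h, unary, List.replicate_succ]

/-- Answers still to come and answers present add up to the constant `L`, so `S` bounds the
registers in all rounds and one time bound serves every query. -/
theorem Out.samples {O' O : Oracle} {q : Cmd} {t : Polynomial ℕ} (hq : Simulates O' q 7 4 5 O t)
    {x₀ x₁ x₂ x₃ w : List Bool} {k : List Cmd} {T' L S : ℕ} {A : List Bool → PMF (List Bool)}
    (hk : ∀ l ψ, l.length = L → Clean ψ →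
      Out O' ⟨k, blk [x₀, x₁, x₂, x₃, w, l, []] [], ψ⟩ T' (A l))
    (hS : x₀.length + x₁.length + x₂.length + x₃.length + w.length + L ≤ S) (N : ℕ) :
    ∀ (l : List Bool) (ψ : QState), N + l.length = L → Clean ψ →
      Out O' ⟨.loop 6 (.seq (.pop 6) q) :: k, blk [x₀, x₁, x₂, x₃, w, l, unary N] [], ψ⟩
        (N * (t.eval S + 3) + 1 + T') ((sampleDist (O w) N l).bind A) := by
  induction N with
  | zero =>
    intro l ψ hl hψ
    rw [sampleDist, PMF.pure_bind]
    exact ((Big.loop_nil (by rw [blk_lt _ (by simp)]; rfl)).out (hk l ψ (by omega) hψ)).mono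
      (by omega)
  | succ N ih =>
    intro l ψ hl hψ
    rw [sampleDist, PMF.bind_bind]
    have h₁ := hq [x₀, x₁, x₂, x₃, w, l, unary N] rfl ψ hψ
      (.loop 6 (.seq (.pop 6) q) :: k) (N * (t.eval S + 3) + 1 + T')
      (fun b => (sampleDist (O w) N (b :: l)).bind A)
      (fun b _ ψ' hψ' => ih (b :: l) ψ' (by rw [List.length_cons]; omega) hψ')
    have h₂ := Big.pop_lt (G := [x₀, x₁, x₂, x₃, w, l, unary (N + 1)]) (i := 6) (by simp) ψ
    refine Out.mono (Out.of_pure (step_loop_unary _ (blk_lt _ (by simp)))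
      (Out.of_pure rfl (h₂.out h₁))) ?_
    have h₃ : t.eval (totalLength [x₀, x₁, x₂, x₃, w, l, unary N]) ≤ t.eval S := by
      refine polynomial_eval_mono t ?_
      simp only [totalLength_cons, totalLength_nil, unary, List.length_replicate]
      omega
    have := Nat.add_one_mul N (t.eval S + 3)
    omega

/-- The search as a program with a subprogram for queries. -/
theorem exists_search {Q : ℕ → List Bool → List Bool → List Bool}
    (hQ : FP (Ctx.all 7) fun G => Q (G.1.getD 0 []).length (G.1.getD 3 []) (G.1.getD 1 [])) :
    ∃ S : Cmd → Cmd, (∀ q, q.IsClassical → (S q).IsClassical) ∧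
      (∀ q, q.IsOracleFree → (S q).IsOracleFree) ∧
      ∀ t : Polynomial ℕ, ∃ P : Polynomial ℕ, ∀ (O' O : Oracle) (q : Cmd), Simulates O' q 7 4 5 O t →
        ∀ (n : ℕ) (y : List Bool) (ψ : QState) (k : List Cmd) (T' : ℕ)
          (A : List Bool → PMF (List Bool)), Clean ψ →
          (∀ u ψ', u.length = n → Clean ψ' →
            Out O' ⟨k, blk [unary n, y, [], u, [], [], []] [], ψ'⟩ T' (A u)) →
          Out O' ⟨S q :: k, blk [unary n, y, [], [], [], [], []] [], ψ⟩
            (P.eval (n + y.length) + T') ((searchDist Q O n y n []).bind A) := by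
  obtain ⟨c₂, p₂, hc₂, h₂⟩ := FP.exists_assign (m := 7) (i := 2) (by omega)
    (FP.get (m := 7) (i := 0) (by omega))
  obtain ⟨c₄, p₄, hc₄, h₄⟩ := FP.exists_assign (i := 4) (by omega) hQ
  obtain ⟨c₆, p₆, hc₆, h₆⟩ := FP.exists_assign (m := 7) (i := 6) (by omega)
    ((FP.nat 51).mul (FP.get (m := 7) (i := 0) (by omega)).unary_length)
  obtain ⟨c₃, p₃, hc₃, h₃⟩ := FP.exists_assign (m := 7) (i := 3) (by omega)
    ((FP.get (m := 7) (i := 3) (by omega)).append (FP.get (m := 7) (i := 5) (by omega)).majority)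
  -- Register `0` holds `n` in unary, `1` the image `y`, `2` the number of bits still to find, `3`
  -- the prefix, `4` the query, `5` the answers, `6` the number of answers still to come.
  let body : Cmd → Cmd := fun q => Cmd.block (.pop 2) [c₄, c₆, .loop 6 (.seq (.pop 6) q), c₃,
    .clear 4, .clear 5]
  refine ⟨fun q => .seq c₂ (.loop 2 (body q)), fun q hq => ⟨hc₂.isClassical, trivial,
    hc₄.isClassical, hc₆.isClassical, ⟨trivial, hq⟩, hc₃.isClassical, trivial, trivial⟩,
    fun q hq => ⟨hc₂.isOracleFree, trivial, hc₄.isOracleFree, hc₆.isOracleFree, ⟨trivial, hq⟩,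
    hc₃.isOracleFree, trivial, trivial⟩, fun t => ?_⟩
  -- With `s = n + y.length`, registers `0` to `3` hold at most `3 * s` bits, the query at most `W
  -- s`, and answers and their counter together at most `51 * s`; this gives the `54` in `S`.
  let W : ℕ → ℕ := fun s => p₄.eval (3 * s)
  let S : ℕ → ℕ := fun s => 54 * s + W s
  let D : ℕ → ℕ := fun s => W s + p₆.eval (S s) + 51 * s * (t.eval (S s) + 3) + p₃.eval (S s) +
    2 * W s + 102 * s + 30
  obtain ⟨P, hP⟩ : ∃ P : Polynomial ℕ, ∀ s, P.eval s = p₂.eval s + s * D s + 2 := by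
    let X : Polynomial ℕ := Polynomial.X
    let Wp := p₄.comp (3 * X)
    let Sp := 54 * X + Wp
    exact ⟨p₂ + X * (Wp + p₆.comp Sp + 51 * X * (t.comp Sp + 3) + p₃.comp Sp + 2 * Wp + 102 * X + 30)
      + 2, fun s => by simp [X, Wp, Sp, D, S, W]⟩
  refine ⟨P, fun O' O q hq n y ψ k T' A hψ hk => ?_⟩
  set s := n + y.length with hs
  have hlen : ∀ n, (unary n).length = n := fun n => List.length_replicate
  have key : ∀ c u ψ, c + u.length = n → Clean ψ →
      Out O' ⟨.loop 2 (body q) :: k, blk [unary n, y, unary c, u, [], [], []] [], ψ⟩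
        (c * D s + 1 + T') ((searchDist Q O n y c u).bind A) := by
    intro c
    induction c with
    | zero =>
      intro u ψ hu hψ
      rw [searchDist, PMF.pure_bind]
      exact ((Big.loop_nil (by rw [blk_lt _ (by simp)]; rfl)).out (hk u ψ (by omega) hψ)).mono
        (by omega)
    | succ c ih =>
      intro u ψ hu hψ
      rw [searchDist, PMF.bind_bind]
      have b₁ := Big.pop_lt (G := [unary n, y, unary (c + 1), u, [], [], []]) (i := 2) (by simp) ψ
      obtain ⟨l₂, b₂⟩ := h₄ [unary n, y, unary c, u, [], [], []] rfl
      have b₂ := b₂ ψ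
      simp only [List.getD_cons_zero, List.getD_cons_succ, hlen] at l₂ b₂
      have hW : (Q n u y).length ≤ W s := by
        refine l₂.trans (polynomial_eval_mono p₄ ?_)
        simp only [totalLength_cons, totalLength_nil, hlen, List.length_nil]
        omega
      have hW' : p₄.eval (totalLength [unary n, y, unary c, u, [], [], []]) ≤ W s := by
        refine polynomial_eval_mono p₄ ?_
        simp only [totalLength_cons, totalLength_nil, hlen, List.length_nil]
        omega
      set w := Q n u y
      obtain ⟨-, b₃⟩ := h₆ [unary n, y, unary c, u, w, [], []] rfl
      have b₃ := b₃ ψ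
      simp only [List.getD_cons_zero, hlen] at b₃
      have h6 : p₆.eval (totalLength [unary n, y, unary c, u, w, [], []]) ≤ p₆.eval (S s) := by
        refine polynomial_eval_mono p₆ ?_
        simp only [totalLength_cons, totalLength_nil, hlen, List.length_nil, S]
        omega
      have rest : ∀ l ψ, l.length = 51 * n → Clean ψ →
          Out O' ⟨Cmd.block c₃ [.clear 4, .clear 5] :: .loop 2 (body q) :: k,
            blk [unary n, y, unary c, u, w, l, []] [], ψ⟩
            (p₃.eval (S s) + 2 * W s + 102 * s + 10 + (c * D s + 1 + T'))
            ((searchDist Q O n y c (u ++ [majority l])).bind A) := by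
        intro l ψ hl hψ
        obtain ⟨-, b₄⟩ := h₃ [unary n, y, unary c, u, w, l, []] rfl
        have b₄ := b₄ ψ
        simp only [List.getD_cons_zero, List.getD_cons_succ] at b₄
        have h3 : p₃.eval (totalLength [unary n, y, unary c, u, w, l, []]) ≤ p₃.eval (S s) := by
          refine polynomial_eval_mono p₃ ?_
          simp only [totalLength_cons, totalLength_nil, hlen, List.length_nil, S]
          omega
        have b₅ := Big.clear_lt (G := [unary n, y, unary c, u ++ [majority l], w, l, []]) (i := 4)
          (by simp) ψ
        have b₆ := Big.clear_lt (G := [unary n, y, unary c, u ++ [majority l], [], l, []]) (i := 5)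
          (by simp) ψ
        refine ((b₄.seq (b₅.seq b₆)).out (ih (u ++ [majority l]) ψ (by simp; omega) hψ)).mono ?_
        simp only [List.getD_cons_zero, List.getD_cons_succ]
        omega
      have b₇ := Out.samples hq rest (S := S s) (by simp only [hlen, S]; omega) (51 * n) []
        ψ (by simp) hψ
      refine Out.mono (Out.of_pure (step_loop_unary _ (blk_lt _ (by simp))) (Out.of_pure rfl
        (b₁.out (Out.of_pure rfl (b₂.out (Out.of_pure rfl (b₃.out (Out.of_pure rfl b₇)))))))) ?_
      have e₁ := Nat.add_one_mul c (D s)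
      have e₂ : 51 * n * (t.eval (S s) + 3) ≤ 51 * s * (t.eval (S s) + 3) :=
        Nat.mul_le_mul_right _ (by omega)
      have e₃ : D s = W s + p₆.eval (S s) + 51 * s * (t.eval (S s) + 3) + p₃.eval (S s) +
        2 * W s + 102 * s + 30 := rfl
      omega
  obtain ⟨-, b⟩ := h₂ [unary n, y, [], [], [], [], []] rfl
  have b := b ψ
  simp only [List.getD_cons_zero] at b
  refine Out.mono (Out.of_pure rfl (b.out (key n [] ψ (by simp) hψ))) ?_
  have e₁ : totalLength [unary n, y, [], [], [], [], []] = s := by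
    simp only [totalLength_cons, totalLength_nil, hlen, List.length_nil]
    omega
  have e₂ : n * D s ≤ s * D s := Nat.mul_le_mul_right _ (by omega)
  rw [e₁, hP]
  omega

/-! ### The inverter and the verifier -/

theorem start_eq_blk (c : Cmd) (G : List (List Bool)) (k : ℕ) :
    start c G = ⟨[c], blk (G ++ List.replicate k []) [], ket ∅⟩ := by
  rw [start]
  congr 1
  funext i
  have h := congrFun (blk_pad [] G k) i
  simp only [blk, List.nil_append, List.append_nil] at h ⊢
  exact h.symm

/-- The search with a quantum oracle is a quantum algorithm. -/
theorem exists_inverter {Q : ℕ → List Bool → List Bool → List Bool}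
    (hQ : FP (Ctx.all 7) fun G => Q (G.1.getD 0 []).length (G.1.getD 3 []) (G.1.getD 1 []))
    {O : Oracle} (hO : IsQuantumImplemented O) :
    ∃ (A : Cmd) (p : Polynomial ℕ), A.IsOracleFree ∧ ∀ (n : ℕ) (y : List Bool),
      Out noOracle (start A [unary n, y]) (p.eval (n + y.length)) (searchDist Q O n y n []) := by
  obtain ⟨S, -, hS, hrun⟩ := exists_search hQ
  obtain ⟨q, t, hq, hsim⟩ := exists_simulates hO (m := 7) (i := 4) (j := 5) (by omega) (by omega)
  obtain ⟨P, hP⟩ := hrun t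
  obtain ⟨c, p, hc, h⟩ := FP.exists_assign (m := 7) (i := 0) (by omega)
    (FP.get (m := 7) (i := 3) (by omega))
  refine ⟨.seq (S q) c, P + p.comp (2 * Polynomial.X) + 1, ⟨hS q hq, hc.isOracleFree⟩, fun n y => ?_⟩
  rw [start_eq_blk _ _ 5]
  have h₁ := hP noOracle O q (hsim _) n y (ket ∅) [c] (p.eval (2 * (n + y.length))) PMF.pure clean_ket
    (fun u ψ hu hψ => by
      obtain ⟨-, b⟩ := h [unary n, y, [], u, [], [], []] rfl
      refine ((b ψ).out (Out.halted _ _)).mono ?_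
      refine polynomial_eval_mono p ?_
      simp only [totalLength_cons, totalLength_nil, unary, List.length_replicate, List.length_nil]
      omega)
  rw [PMF.bind_pure] at h₁
  refine Out.mono (Out.of_pure rfl h₁) ?_
  simp only [Polynomial.eval_add, Polynomial.eval_comp, Polynomial.eval_mul, Polynomial.eval_ofNat,
    Polynomial.eval_X, Polynomial.eval_one]
  omega

theorem Out.tosses {O : Oracle} {n : ℕ} {k : List Cmd} {T' L : ℕ} {A : List Bool → PMF (List Bool)}
    (hk : ∀ x, x.length = L → Out O ⟨k, blk [unary n, x, [], [], [], [], []] [], ket ∅⟩ T' (A x))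
    (N : ℕ) : ∀ x : List Bool, N + x.length = L →
      Out O ⟨.loop 2 (.seq (.pop 2) (.toss 1)) :: k, blk [unary n, x, unary N, [], [], [], []] [],
        ket ∅⟩ (N * 5 + 1 + T') ((sampleDist (PMF.uniformOfFintype Bool) N x).bind A) := by
  induction N with
  | zero =>
    intro x hx
    rw [sampleDist, PMF.pure_bind]
    exact ((Big.loop_nil (by rw [blk_lt _ (by simp)]; rfl)).out (hk x (by omega))).mono (by omega)
  | succ N ih =>
    intro x hx
    rw [sampleDist, PMF.bind_bind]
    have h₁ := Big.pop_lt (G := [unary n, x, unary (N + 1), [], [], [], []]) (i := 2) (by simp) (ket ∅)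
    have h₂ := Out.of_bind (O := O) (C := ⟨.toss 1 :: .loop 2 (.seq (.pop 2) (.toss 1)) :: k,
      blk [unary n, x, unary N, [], [], [], []] [], ket ∅⟩) (μ := PMF.uniformOfFintype Bool)
      (g := fun b => ⟨.loop 2 (.seq (.pop 2) (.toss 1)) :: k,
        blk [unary n, b :: x, unary N, [], [], [], []] [], ket ∅⟩)
      (B := fun b => (sampleDist (PMF.uniformOfFintype Bool) N (b :: x)).bind A) (by
        simp only [step]
        congr 1
        funext b
        rw [blk_lt _ (by simp), blk_set_lt _ (by simp)]
        rfl) (fun b _ => ih (b :: x) (by rw [List.length_cons]; omega))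
    exact Out.mono (Out.of_pure (step_loop_unary _ (blk_lt _ (by simp)))
      (Out.of_pure rfl (h₁.out h₂))) (by omega)

/-- The verifier: search a preimage of `f x` for a random `x` and test whether it is one. -/
theorem exists_verifier {Q : ℕ → List Bool → List Bool → List Bool}
    (hQ : FP (Ctx.all 7) fun G => Q (G.1.getD 0 []).length (G.1.getD 3 []) (G.1.getD 1 []))
    {f : List Bool → List Bool} (hf : PolyTimeComputable f) :
    ∃ (V : Cmd) (p : Polynomial ℕ), V.IsClassical ∧ ∀ (O : Oracle) (n : ℕ),
      Out O (start V [unary n]) (p.eval n)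
        ((sampleDist (PMF.uniformOfFintype Bool) n []).bind fun x =>
          (searchDist Q O n (f x) n []).bind fun u => PMF.pure [decide (f u = f x)]) := by
  obtain ⟨S, hS, -, hrun⟩ := exists_search hQ
  -- A genuine query takes one step, hence the constant polynomial `1`.
  obtain ⟨P, hP⟩ := hrun 1
  obtain ⟨c₂, p₂, hc₂, h₂⟩ := FP.exists_assign (m := 7) (i := 2) (by omega)
    (FP.get (m := 7) (i := 0) (by omega))
  obtain ⟨c₁, p₁, hc₁, h₁⟩ := FP.exists_assign (m := 7) (i := 1) (by omega)
    (FP.of_polyTimeComputable hf (FP.get (m := 7) (i := 1) (by omega)))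
  obtain ⟨c₀, p₀, hc₀, h₀⟩ := FP.exists_assign (m := 7) (i := 0) (by omega)
    (FP.eq_test (FP.of_polyTimeComputable hf (FP.get (m := 7) (i := 3) (by omega)))
      (FP.get (m := 7) (i := 1) (by omega)))
  -- A bound for the length of `f x`: it is computed when `n` in unary and `x` fill the registers
  -- with `2 * n` bits.
  let Y : ℕ → ℕ := fun n => p₁.eval (2 * n)
  obtain ⟨R, hR⟩ : ∃ R : Polynomial ℕ, ∀ n, R.eval n =
      p₂.eval n + (n * 5 + 1) + Y n + P.eval (n + Y n) + p₀.eval (2 * n + Y n) + 10 := by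
    let X : Polynomial ℕ := Polynomial.X
    let Yp := p₁.comp (2 * X)
    exact ⟨p₂ + (X * 5 + 1) + Yp + P.comp (X + Yp) + p₀.comp (2 * X + Yp) + 10,
      fun s => by simp [X, Yp, Y]⟩
  refine ⟨Cmd.block c₂ [.loop 2 (.seq (.pop 2) (.toss 1)), c₁, S (.query 4 5), c₀], R,
    ⟨hc₂.isClassical, ⟨trivial, trivial⟩, hc₁.isClassical, hS _ trivial, hc₀.isClassical⟩,
    fun O n => ?_⟩
  have hlen : ∀ n, (unary n).length = n := fun n => List.length_replicate
  rw [start_eq_blk _ _ 6]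
  have rest : ∀ x : List Bool, x.length = n →
      Out O ⟨Cmd.block c₁ [S (.query 4 5), c₀] :: [], blk [unary n, x, [], [], [], [], []] [], ket ∅⟩
        (Y n + P.eval (n + Y n) + p₀.eval (2 * n + Y n) + 2)
        ((searchDist Q O n (f x) n []).bind fun u => PMF.pure [decide (f u = f x)]) := by
    intro x hx
    obtain ⟨l₁, b₁⟩ := h₁ [unary n, x, [], [], [], [], []] rfl
    have b₁ := b₁ (ket ∅)
    have e₁ : totalLength [unary n, x, [], [], [], [], []] = 2 * n := by
      simp only [totalLength_cons, totalLength_nil, hlen, List.length_nil, hx]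
      omega
    simp only [List.getD_cons_succ, List.getD_cons_zero, e₁] at l₁ b₁
    have h := hP O O (.query 4 5) (simulates_query O (by omega) (by omega)) n (f x) (ket ∅) [c₀]
      (p₀.eval (2 * n + Y n)) (fun u => PMF.pure [decide (f u = f x)]) clean_ket
      (fun u ψ hu hψ => by
        obtain ⟨-, b⟩ := h₀ [unary n, f x, [], u, [], [], []] rfl
        refine ((b ψ).out (Out.halted _ _)).mono ?_
        refine polynomial_eval_mono p₀ ?_
        simp only [totalLength_cons, totalLength_nil, hlen, List.length_nil, Y]
        omega)
    refine Out.mono (Out.of_pure rfl (b₁.out (Out.of_pure rfl h))) ?_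
    have := polynomial_eval_mono P (show n + (f x).length ≤ n + Y n by simp only [Y]; omega)
    simp only [Y] at *
    omega
  obtain ⟨-, b₂⟩ := h₂ [unary n, [], [], [], [], [], []] rfl
  have b₂ := b₂ (ket ∅)
  have e₂ : totalLength [unary n, [], [], [], [], [], []] = n := by
    simp only [totalLength_cons, totalLength_nil, hlen, List.length_nil, add_zero]
  simp only [List.getD_cons_zero, e₂] at b₂
  refine Out.mono (Out.of_pure rfl (b₂.out (Out.of_pure rfl (Out.tosses rest n [] (by simp))))) ?_
  rw [hR]
  omega

/-! ### Amplification -/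

theorem tsum_bind_mul {α β : Type*} (μ : PMF α) (f : α → PMF β) (g : β → ℝ≥0∞) :
    ∑' b, μ.bind f b * g b = ∑' a, μ a * ∑' b, f a b * g b := by
  simp only [PMF.bind_apply, ← ENNReal.tsum_mul_right, ← ENNReal.tsum_mul_left]
  rw [ENNReal.tsum_comm]
  simp only [mul_assoc]

theorem tsum_pure_mul {α : Type*} (a : α) (g : α → ℝ≥0∞) : ∑' b, PMF.pure a b * g b = g a := by
  rw [tsum_eq_single a fun b hb => by simp [PMF.pure_apply, hb]]
  simp [PMF.pure_apply]

/-- Each bit that equals `c` contributes `2/3`, and every other bit `3/2`. -/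
def bitWeight (c b : Bool) : ℝ≥0∞ := if b = c then 2 / 3 else (2 / 3)⁻¹

/-- The expectation of a product over independent samples is the product of the expectations, as in
a Chernoff bound. -/
theorem tsum_sampleDist_mul_prod (μ : PMF Bool) (w : Bool → ℝ≥0∞) (N : ℕ) (l : List Bool) :
    ∑' l', sampleDist μ N l l' * (l'.map w).prod = (l.map w).prod * (∑ b, μ b * w b) ^ N := by
  induction N generalizing l with
  | zero => rw [sampleDist, tsum_pure_mul, pow_zero, mul_one]
  | succ N ih =>
    rw [sampleDist, tsum_bind_mul]
    simp only [ih, List.map_cons, List.prod_cons, tsum_fintype]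
    rw [pow_succ, ← mul_assoc, Finset.mul_sum]
    exact Finset.sum_congr rfl fun b _ => by ring

theorem pmf_bool_not (μ : PMF Bool) (c : Bool) : μ c + μ (!c) = 1 := by
  have h := μ.tsum_coe
  rw [tsum_bool] at h
  cases c
  · exact h
  · rw [add_comm]; exact h

/-- With `a = μ c` the sum is `3/2 - 5a/6`, which at `a = 2/3` equals `17/18`. -/
theorem sum_mul_bitWeight_le {μ : PMF Bool} {c : Bool} (h : 2 / 3 ≤ μ c) :
    ∑ b, μ b * bitWeight c b ≤ 17 / 18 := by
  have e : ∑ b, μ b * bitWeight c b = μ c * (2 / 3) + μ (!c) * (3 / 2) := by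
    have : (2 / 3 : ℝ≥0∞)⁻¹ = 3 / 2 := ENNReal.inv_div (by simp) (by simp)
    cases c <;> simp [bitWeight, this, add_comm]
  have hs := pmf_bool_not μ c
  have h₁ : μ c ≠ ∞ := μ.apply_ne_top c
  have h₂ : μ (!c) ≠ ∞ := μ.apply_ne_top _
  rw [e]
  lift μ c to ℝ≥0 using h₁ with a
  lift μ (!c) to ℝ≥0 using h₂ with b
  have e₁ : (2 / 3 : ℝ≥0∞) = ((2 / 3 : ℝ≥0) : ℝ≥0∞) := by simp
  have e₂ : (3 / 2 : ℝ≥0∞) = ((3 / 2 : ℝ≥0) : ℝ≥0∞) := by simp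
  have e₃ : (17 / 18 : ℝ≥0∞) = ((17 / 18 : ℝ≥0) : ℝ≥0∞) := by simp
  rw [e₁] at h ⊢
  rw [e₂, e₃]
  norm_cast at h hs ⊢
  rw [← NNReal.coe_le_coe] at h ⊢
  rw [← NNReal.coe_inj] at hs
  push_cast at *
  linarith

/-- If the majority is not `c`, other bits are at least as many as those equal to `c` (a tie yields
`false`), and weights of opposite bits cancel in pairs. The product thus dominates the indicator of
a wrong majority. -/
theorem one_le_prod_bitWeight {c : Bool} {l : List Bool} (h : majority l ≠ c) :
    1 ≤ (l.map (bitWeight c)).prod := by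
  have key : (l.map (bitWeight c)).prod = (2 / 3) ^ l.count c * (2 / 3)⁻¹ ^ l.count (!c) := by
    clear h
    induction l with
    | nil => simp
    | cons b l ih =>
      rw [List.map_cons, List.prod_cons, ih]
      rcases eq_or_ne b c with rfl | hb
      · simp [bitWeight, pow_succ]
        ring
      · obtain rfl : b = !c := by cases b <;> cases c <;> simp_all
        simp [bitWeight, pow_succ]
        ring
  have hle : l.count c ≤ l.count (!c) := by
    cases c
    · simp only [majority, ne_eq, decide_eq_false_iff_not, not_not] at h
      exact h.le
    · simp only [majority, ne_eq, decide_eq_true_eq, not_lt] at h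
      exact h
  obtain ⟨d, hd⟩ := Nat.exists_eq_add_of_le hle
  have h23 : (2 / 3 : ℝ≥0∞) * (2 / 3)⁻¹ = 1 :=
    ENNReal.mul_inv_cancel (by simp) (ENNReal.div_ne_top (by simp) (by simp))
  rw [key, hd, pow_add, ← mul_assoc, ← mul_pow, h23, one_pow, one_mul]
  refine one_le_pow₀ (ENNReal.one_le_inv.2 ?_)
  exact ENNReal.div_le_of_le_mul (by norm_num)

/-- Bernoulli's inequality gives `(18/17) ^ (51 * n) ≥ 1 + 3 * n`; the number `51 = 3 * 17` of
repetitions per bit is chosen for this. -/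
theorem mul_pow_le_third (n : ℕ) : (n : ℝ≥0∞) * (17 / 18) ^ (51 * n) ≤ 1 / 3 := by
  have h : (n : ℝ) * (17 / 18) ^ (51 * n) ≤ 1 / 3 := by
    have h₁ := one_add_mul_le_pow (show (-2 : ℝ) ≤ 1 / 17 by norm_num) (51 * n)
    have h₂ : (17 / 18 : ℝ) ^ (51 * n) * (1 + 1 / 17) ^ (51 * n) = 1 := by
      rw [← mul_pow]; norm_num
    have h₃ : (0 : ℝ) < (17 / 18) ^ (51 * n) := by positivity
    push_cast at h₁
    nlinarith
  have e₁ : (17 / 18 : ℝ≥0∞) = ((17 / 18 : ℝ≥0) : ℝ≥0∞) := by simp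
  have e₂ : (1 / 3 : ℝ≥0∞) = ((1 / 3 : ℝ≥0) : ℝ≥0∞) := by simp
  rw [e₁, e₂]
  norm_cast

/-- A search of a preimage fails with small probability if the prefix can be extended. -/
theorem searchDist_failure {f : List Bool → List Bool} {Φ : ℕ → List Bool → List Bool → QBF}
    (hΦ : ∀ n u y, u.length ≤ n → ((Φ n u y).IsTrue ↔ ∃ x, x.length = n ∧ u <+: x ∧ f x = y))
    {O : Oracle} (hO : SolvesTQBF O) {n : ℕ} {y : List Bool} (k : ℕ) (u : List Bool)
    (hk : u.length + k = n) (hu : ∃ x, x.length = n ∧ u <+: x ∧ f x = y) :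
    ((searchDist (fun n u y => (Φ n (u ++ [true]) y).encode) O n y k u).bind fun u' =>
      PMF.pure (decide (f u' = y))) false ≤ k * (17 / 18) ^ (51 * n) := by
  induction k generalizing u with
  | zero =>
    obtain ⟨x, hx, hux, rfl⟩ := hu
    obtain rfl := hux.eq_of_length (by omega)
    simp [searchDist]
  | succ k ih =>
    rw [searchDist, PMF.bind_bind, PMF.bind_apply]
    set φ := Φ n (u ++ [true]) y with hφ
    set ε : ℝ≥0∞ := (17 / 18) ^ (51 * n)
    classical
    set c := decide φ.IsTrue with hc
    have hsol : 2 / 3 ≤ O φ.encode c := by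
      have := hO φ
      convert this
    have hφu := hΦ n (u ++ [true]) y (by simp; omega)
    -- The true answer keeps the prefix extendable: if no preimage continues with `true`, the one
    -- known to extend `u` continues with `false`.
    have good : ∃ x, x.length = n ∧ u ++ [c] <+: x ∧ f x = y := by
      by_cases hT : φ.IsTrue
      · rw [show c = true by simp [hc, hT]]
        exact hφu.1 hT
      · rw [show c = false by simp [hc, hT]]
        obtain ⟨x, hx, ⟨v, rfl⟩, hxy⟩ := hu
        rcases v with _ | ⟨b, v⟩
        · simp at hx; omega
        cases b
        · exact ⟨_, hx, ⟨v, by simp⟩, hxy⟩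
        · exact absurd (hφu.2 ⟨_, hx, ⟨v, by simp⟩, hxy⟩) hT
    have hgood := ih (u ++ [c]) (by simp; omega) good
    have hw := tsum_sampleDist_mul_prod (O φ.encode) (bitWeight c) (51 * n) []
    -- If the majority is right, the remaining search fails with probability at most `k * ε`;
    -- otherwise failure is bounded by `1`, hence by the product of the weights.
    calc _ ≤ ∑' l, sampleDist (O φ.encode) (51 * n) [] l *
            (k * ε + (l.map (bitWeight c)).prod) := by
          refine ENNReal.tsum_le_tsum fun l => ?_
          gcongr
          by_cases hl : majority l = c
          · rw [hl]
            exact hgood.trans le_self_add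
          · exact (PMF.coe_le_one _ _).trans ((one_le_prod_bitWeight hl).trans le_add_self)
      _ = k * ε + (∑ b, O φ.encode b * bitWeight c b) ^ (51 * n) := by
          simp only [mul_add]
          rw [ENNReal.tsum_add, ENNReal.tsum_mul_right, PMF.tsum_coe, one_mul, hw, List.map_nil,
            List.prod_nil, one_mul]
      _ ≤ k * ε + ε := by
          gcongr
          exact pow_le_pow_left' (sum_mul_bitWeight_le hsol) _
      _ = _ := by push_cast; ring

/-! ### Random inputs and the success probability of the search -/

theorem tsum_sampleDist_uniform (N : ℕ) (l : List Bool) (g : List Bool → ℝ≥0∞) :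
    ∑' l', sampleDist (PMF.uniformOfFintype Bool) N l l' * g l' =
      (∑ x : Fin N → Bool, g (List.ofFn x ++ l)) / 2 ^ N := by
  induction N generalizing l with
  | zero => simp [sampleDist]
  | succ N ih =>
    rw [sampleDist, tsum_bind_mul]
    simp only [ih, tsum_fintype, PMF.uniformOfFintype_apply, Fintype.card_bool, Nat.cast_ofNat]
    -- Bits are pushed on the front, so the first toss is the last entry of the vector.
    rw [← (Fin.snocEquiv fun _ => Bool).sum_comp, Fintype.sum_prod_type]
    simp only [Fin.snocEquiv, Equiv.coe_fn_mk, List.ofFn_succ_last, Fin.snoc_castSucc, Fin.snoc_last,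
      List.append_assoc, List.singleton_append]
    rw [← Finset.mul_sum]
    simp only [div_eq_mul_inv]
    rw [← Finset.sum_mul, pow_succ, ENNReal.mul_inv (by simp) (by simp)]
    ring

theorem tsum_sampleDist_uniform_le {N : ℕ} {g : List Bool → ℝ≥0∞} {B : ℝ≥0∞}
    (h : ∀ x : List Bool, x.length = N → g x ≤ B) :
    ∑' l, sampleDist (PMF.uniformOfFintype Bool) N [] l * g l ≤ B := by
  rw [tsum_sampleDist_uniform]
  refine ENNReal.div_le_of_le_mul ?_
  calc _ ≤ ∑ _x : Fin N → Bool, B := Finset.sum_le_sum fun x _ => h _ (by simp)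
    _ = _ := by simp [mul_comm]

/-- Whether the search inverts `f` on a random input. -/
def searchSuccess (f : List Bool → List Bool) (Q : ℕ → List Bool → List Bool → List Bool)
    (O : Oracle) (n : ℕ) : PMF Bool :=
  (sampleDist (PMF.uniformOfFintype Bool) n []).bind fun x =>
    (searchDist Q O n (f x) n []).bind fun u => PMF.pure (decide (f u = f x))

theorem searchSuccess_false_le {f : List Bool → List Bool} {Φ : ℕ → List Bool → List Bool → QBF}
    (hΦ : ∀ n u y, u.length ≤ n → ((Φ n u y).IsTrue ↔ ∃ x, x.length = n ∧ u <+: x ∧ f x = y))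
    {O : Oracle} (hO : SolvesTQBF O) (n : ℕ) :
    searchSuccess f (fun n u y => (Φ n (u ++ [true]) y).encode) O n false ≤ 1 / 3 := by
  rw [searchSuccess, PMF.bind_apply]
  refine tsum_sampleDist_uniform_le fun x hx => ?_
  exact (searchDist_failure hΦ hO n [] (by simp) ⟨x, hx, List.nil_prefix, rfl⟩).trans
    (mul_pow_le_third n)

/-- Here the inverter meets the verifier: both average the same search over uniform `x` and accept
any `u` with `f u = f x`. -/
theorem inversionProb_eq {f : List Bool → List Bool} {Q : ℕ → List Bool → List Bool → List Bool}
    {O : Oracle} {A : Cmd} {p : Polynomial ℕ}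
    (h : ∀ (n : ℕ) (y : List Bool),
      output noOracle A [unary n, y] (p.eval (n + y.length)) = searchDist Q O n y n []) (n : ℕ) :
    inversionProb f A p n = (searchSuccess f Q O n true).toReal := by
  rw [searchSuccess, PMF.bind_apply, tsum_sampleDist_uniform, inversionProb, ENNReal.toReal_div,
    ENNReal.toReal_sum fun x _ => PMF.apply_ne_top _ _]
  simp only [h, ENNReal.toReal_pow, ENNReal.toReal_ofNat, List.append_nil]
  congr 1
  refine Finset.sum_congr rfl fun x _ => congrArg _ ?_
  rw [PMF.toOuterMeasure_apply, PMF.bind_apply]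
  refine tsum_congr fun u => ?_
  by_cases hu : f u = f (List.ofFn x) <;> simp [Set.indicator, PMF.pure_apply, hu]

theorem two_thirds_le {μ : PMF Bool} {b : Bool} (h : μ b ≤ 1 / 3) : 2 / 3 ≤ μ (!b) := by
  have hs := pmf_bool_not μ b
  have e : (2 / 3 : ℝ≥0∞) + 1 / 3 = 1 := by
    rw [ENNReal.div_add_div_same, show (2 + 1 : ℝ≥0∞) = 3 by norm_num]
    exact ENNReal.div_self (by simp) (by simp)
  have h₃ : (1 / 3 : ℝ≥0∞) ≠ ∞ := ENNReal.div_ne_top (by simp) (by simp)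
  refine (ENNReal.add_le_add_iff_right h₃).1 ?_
  calc _ = (μ !b) + μ b := by rw [e, ← hs, add_comm]
    _ ≤ _ := add_le_add_right h _

theorem verdict_eq {O : Oracle} {V : Cmd} {n t : ℕ} {μ : PMF Bool}
    (h : output O V [unary n] t = μ.bind fun b => PMF.pure [b]) :
    verdict O V n t .True = μ true ∧ verdict O V n t .Pseudo = μ false := by
  rw [verdict, h, PMF.map_bind]
  simp [PMF.bind_apply, PMF.pure_map, PMF.pure_apply, verdictOf]

end TQBFVerification

end

/-! ### The main theorem -/

theorem mainTheorem5 (hOWF : ∃ f : List Bool → List Bool, IsQuantumSecureOWF f) :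
    ∃ (V : Cmd) (p : Polynomial ℕ),
      V.IsClassical ∧
      (∀ (O : Oracle) (n : ℕ), HaltsWithin O V [unary n] (p.eval n)) ∧
      (∀ O : Oracle, SolvesTQBF O →
        ∀ n : ℕ, (2 / 3 : ENNReal) ≤ verdict O V n (p.eval n) Verdict.True) ∧
      (∀ O : Oracle, IsQuantumImplemented O →
        ∃ n₀ : ℕ, ∀ n ≥ n₀, (2 / 3 : ENNReal) ≤ verdict O V n (p.eval n) Verdict.Pseudo) := by
  obtain ⟨f, hf, hsec⟩ := hOWF
  obtain ⟨Φ, hΦ, hΦ'⟩ := exists_preimage_formula hf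
  set Q : ℕ → List Bool → List Bool → List Bool := fun n u y => (Φ n (u ++ [true]) y).encode
    with hQdef
  have hQ : FP (Ctx.all 7) fun G => Q (G.1.getD 0 []).length (G.1.getD 3 []) (G.1.getD 1 []) :=
    hΦ' (FP.get (m := 7) (i := 0) (by omega)).unary_length
      ((FP.get (m := 7) (i := 3) (by omega)).append (FP.const [true]))
      (FP.get (m := 7) (i := 1) (by omega))
  obtain ⟨V, p, hV, hout⟩ := exists_verifier hQ hf
  have hverdict : ∀ O n, verdict O V n (p.eval n) .True = searchSuccess f Q O n true ∧
      verdict O V n (p.eval n) .Pseudo = searchSuccess f Q O n false := fun O n =>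
    verdict_eq <| (hout O n).dist.trans <| by
      simp only [searchSuccess, PMF.bind_bind, PMF.pure_bind]
  refine ⟨V, p, hV, fun O n => (hout O n).halts, fun O hO n => ?_, fun O hO => ?_⟩
  · rw [(hverdict O n).1]
    exact two_thirds_le (b := false) (searchSuccess_false_le hΦ hO n)
  · obtain ⟨A, q, hA, hrun⟩ := exists_inverter hQ hO
    have hdecay := hsec A q hA fun n y => (hrun n y).halts
    -- The exponent `0` suffices: only convergence of the inversion probability to `0` is used.
    have hlim := hdecay 0
    simp only [pow_zero, one_mul] at hlim
    obtain ⟨n₀, hn₀⟩ := Filter.eventually_atTop.1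
      (hlim.eventually (gt_mem_nhds (show (0 : ℝ) < 1 / 3 by norm_num)))
    refine ⟨n₀, fun n hn => ?_⟩
    have hlt := hn₀ n hn
    rw [inversionProb_eq fun n y => (hrun n y).dist] at hlt
    rw [(hverdict O n).2]
    refine two_thirds_le (b := true) ?_
    rw [← ENNReal.toReal_le_toReal (PMF.apply_ne_top _ _) (ENNReal.div_ne_top (by simp) (by simp))]
    simpa using hlt.le
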